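/- Let $\mathscr H=\mathbb H^n\times\mathrm{Im}\,\mathbb H\cong\mathbb R^{4n}\times\mathbb R^3$ be the right quaternionic Heisenberg group, with multiplication $(x,t)\cdot(y,s)=(x+y,\;t+s+2\,\mathrm{Im}(x\bar y))$, where $x\bar y=\sum_l x_l\bar y_l$. Let $\mathscr H_{\mathbb Z}=\mathbb Z^{4n+3}\subset\mathscr H$, and let $\mathscr H/\mathscr H_{\mathbb Z}$ be the compact manifold of orbits of $\mathscr H_{\mathbb Z}$ acting on $\mathscr H$ by left translations, with the measure given by Lebesgue measure on the fundamental set $[0,1)^{4n+3}$. Let $Y_a\varphi(\xi)=\frac{d}{dt}\varphi(\xi\cdot te_a)|_{t=0}$, $a=1,\dots,4n$, be the left invariant horizontal vector fields, which act on functions on $\mathscr H/\mathscr H_{\mathbb Z}$, and for $l=0,\dots,n-1$ put $$\begin{pmatrix} Z_{2l}^{0'}& Z_{2l}^{1'}\\ Z_{2l+1}^{0'}& Z_{2l+1}^{1'}\end{pmatrix}=\begin{pmatrix}-Y_{4l+3}-\mathbf iY_{4l+4}& -Y_{4l+1}-\mathbf iY_{4l+2}\\ Y_{4l+1}-\mathbf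 iY_{4l+2}& -Y_{4l+3}+\mathbf iY_{4l+4}\end{pmatrix}.$$ For $0\le j\le k$ let $\mathscr V_j=\odot^{k-j}\mathbb C^2\otimes\wedge^j\mathbb C^{2n}$ be the space of complex tuples $(f_{A_1\cdots A_jA_1'\cdots A_{k-j}'})$, $A_i\in\{0,\dots,2n-1\}$, $A_i'\in\{0',1'\}$, which are antisymmetric in the $A_i$ and symmetric in the $A_i'$, with the Hermitian inner product given by summation over all indices. For $j<k$ let $$(\mathscr D_jf)_{A_0\cdots A_jA_1'\cdots A_{k-j-1}'}=(j+1)\sum_{A'=0',1'}Z_{[A_0}^{A'}f_{A_1\cdots A_j]A'A_1'\cdots A_{k-j-1}'},$$ where $[\cdots]$ denotes antisymmetrisation with the factor $\frac1{(j+1)!}$; this is regarded as an operator from $L^2(\mathscr H/\mathscr H_{\mathbb Z},\mathscr V_j)$ to $L^2(\mathscr H/\mathscr H_{\mathbb Z},\mathscr V_{j+1})$ in the sense of distributions, with domain $\mathrm{Dom}(\mathscr D_j)$ the set of all $f\in L^2$ with $\mathscr D_jf\in L^2$. **Theorem.** Suppose that $\dim\mathscr H=4n+3\ge 19$ and $k\ge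 2$. If $f\in\mathrm{Dom}(\mathscr D_1)\subset L^2(\mathscr H/\mathscr H_{\mathbb Z},\mathscr V_1)$ satisfies $\mathscr D_1f=0$, and $f$ is orthogonal in $L^2(\mathscr H/\mathscr H_{\mathbb Z},\mathscr V_1)$ to all constant $\mathscr V_1$-valued functions, then there exists $u\in L^2(\mathscr H/\mathscr H_{\mathbb Z},\mathscr V_0)$, lying in $\mathrm{Dom}(\mathscr D_0)$, such that $\mathscr D_0u=f$. -/

import Mathlib

open MeasureTheory
open scoped ContDiff

noncomputable section

namespace QHeis

/-! ### The right quaternionic Heisenberg group -/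

/-- The underlying space `ℝ^{4n} × ℝ^3` of the right quaternionic Heisenberg group `ℍⁿ × Im ℍ`.
The index `(l, j)` of a horizontal coordinate, `l < n`, `j < 4`, stands for the real coordinate
number `4l + j + 1`, that is, for the `j`-th real component of the quaternion `q_l`. -/
def Heis (n : ℕ) : Type := (Fin n × Fin 4 → ℝ) × (Fin 3 → ℝ)

variable {n : ℕ}

instance : NormedAddCommGroup (Heis n) :=
  inferInstanceAs (NormedAddCommGroup ((Fin n × Fin 4 → ℝ) × (Fin 3 → ℝ)))

instance : NormedSpace ℝ (Heis n) :=
  inferInstanceAs (NormedSpace ℝ ((Fin n × Fin 4 → ℝ) × (Fin 3 → ℝ)))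

/-- The measure `volume` on `Heis n` is Lebesgue measure. -/
instance : MeasureSpace (Heis n) :=
  inferInstanceAs (MeasureSpace ((Fin n × Fin 4 → ℝ) × (Fin 3 → ℝ)))

/-- The matrices `B¹, B², B³`: `Im (x * conj y) = ∑ β, (∑ k j, B β k j * x k * y j) i_β`
for quaternions `x`, `y`. -/
def B : Fin 3 → Matrix (Fin 4) (Fin 4) ℤ :=
  ![!![0, -1, 0, 0; 1, 0, 0, 0; 0, 0, 0, -1; 0, 0, 1, 0],
    !![0, 0, -1, 0; 0, 0, 0, 1; 1, 0, 0, 0; 0, -1, 0, 0],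
    !![0, 0, 0, -1; 0, 0, -1, 0; 0, 1, 0, 0; 1, 0, 0, 0]]

/-- The `β`-th component of `Im (x * conj y)` for `x, y ∈ ℍⁿ`. -/
def imPart (x y : Fin n × Fin 4 → ℝ) (β : Fin 3) : ℝ :=
  ∑ l : Fin n, ∑ k : Fin 4, ∑ j : Fin 4, (B β k j : ℝ) * x (l, k) * y (l, j)

/-- `(x, t) * (y, s) = (x + y, t + s + 2 Im (x * conj y))`. -/
instance : Mul (Heis n) :=
  ⟨fun ξ η => (ξ.1 + η.1, fun β => ξ.2 β + η.2 β + 2 * imPart ξ.1 η.1 β)⟩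

instance : One (Heis n) := ⟨((0 : Fin n × Fin 4 → ℝ), (0 : Fin 3 → ℝ))⟩

instance : Inv (Heis n) := ⟨fun ξ => (-ξ.1, fun β => -ξ.2 β + 2 * imPart ξ.1 ξ.1 β)⟩

theorem imPart_add_left (x x' y : Fin n × Fin 4 → ℝ) (β : Fin 3) :
    imPart (x + x') y β = imPart x y β + imPart x' y β := by
  simp only [imPart, Pi.add_apply, ← Finset.sum_add_distrib]
  refine Finset.sum_congr rfl fun l _ => Finset.sum_congr rfl fun k _ =>
    Finset.sum_congr rfl fun j _ => ?_
  ring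

theorem imPart_add_right (x y y' : Fin n × Fin 4 → ℝ) (β : Fin 3) :
    imPart x (y + y') β = imPart x y β + imPart x y' β := by
  simp only [imPart, Pi.add_apply, ← Finset.sum_add_distrib]
  refine Finset.sum_congr rfl fun l _ => Finset.sum_congr rfl fun k _ =>
    Finset.sum_congr rfl fun j _ => ?_
  ring

theorem imPart_neg_left (x y : Fin n × Fin 4 → ℝ) (β : Fin 3) :
    imPart (-x) y β = -imPart x y β := by
  simp [imPart, Finset.sum_neg_distrib]

@[simp] theorem imPart_zero_left (y : Fin n × Fin 4 → ℝ) (β : Fin 3) :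
    imPart 0 y β = 0 := by
  simp [imPart]

@[simp] theorem imPart_zero_right (x : Fin n × Fin 4 → ℝ) (β : Fin 3) :
    imPart x 0 β = 0 := by
  simp [imPart]

theorem ext' {ξ η : Heis n} (h₁ : ∀ a, ξ.1 a = η.1 a) (h₂ : ∀ β, ξ.2 β = η.2 β) : ξ = η :=
  Prod.ext (funext h₁) (funext h₂)

@[simp] theorem mul_fst (ξ η : Heis n) : (ξ * η).1 = ξ.1 + η.1 := rfl
@[simp] theorem mul_snd (ξ η : Heis n) (β : Fin 3) :
    (ξ * η).2 β = ξ.2 β + η.2 β + 2 * imPart ξ.1 η.1 β := rfl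
@[simp] theorem one_fst : (1 : Heis n).1 = 0 := rfl
@[simp] theorem one_snd : (1 : Heis n).2 = 0 := rfl
@[simp] theorem inv_fst (ξ : Heis n) : (ξ⁻¹).1 = -ξ.1 := rfl
@[simp] theorem inv_snd (ξ : Heis n) (β : Fin 3) :
    (ξ⁻¹).2 β = -ξ.2 β + 2 * imPart ξ.1 ξ.1 β := rfl

instance : Group (Heis n) :=
  Group.ofLeftAxioms
    (fun ξ η ζ => ext' (fun a => by simp [add_assoc])
      (fun β => by simp [imPart_add_left, imPart_add_right]; ring))
    (fun ξ => ext' (fun a => by simp) (fun β => by simp))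
    (fun ξ => ext' (fun a => by simp) (fun β => by simp [imPart_neg_left]))

/-! ### The lattice and the compact quotient -/

/-- The lattice `ℤ^{4n+3}` of all points with integer coordinates. -/
def lattice (n : ℕ) : Subgroup (Heis n) where
  carrier := {ξ | (∀ a, ξ.1 a ∈ (Int.castRingHom ℝ).range) ∧
    ∀ β, ξ.2 β ∈ (Int.castRingHom ℝ).range}
  one_mem' := ⟨fun _ => zero_mem _, fun _ => zero_mem _⟩
  mul_mem' := by
    rintro ξ η ⟨h₁, h₂⟩ ⟨h₃, h₄⟩
    refine ⟨fun a => add_mem (h₁ a) (h₃ a), fun β => ?_⟩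
    refine add_mem (add_mem (h₂ β) (h₄ β)) (mul_mem ⟨2, by simp⟩ ?_)
    exact sum_mem fun l _ => sum_mem fun k _ => sum_mem fun j _ =>
      mul_mem (mul_mem ⟨_, rfl⟩ (h₁ _)) (h₃ _)
  inv_mem' := by
    rintro ξ ⟨h₁, h₂⟩
    refine ⟨fun a => neg_mem (h₁ a), fun β => ?_⟩
    refine add_mem (neg_mem (h₂ β)) (mul_mem ⟨2, by simp⟩ ?_)
    exact sum_mem fun l _ => sum_mem fun k _ => sum_mem fun j _ =>
      mul_mem (mul_mem ⟨_, rfl⟩ (h₁ _)) (h₁ _)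

/-- The compact manifold of orbits of the lattice acting on the group by left translations.
A function on it is the same as a function `f` on the group with `f (γ * ξ) = f ξ` for all `γ` in
the lattice. -/
def Nil (n : ℕ) : Type := MulAction.orbitRel.Quotient (lattice n) (Heis n)

instance : MeasurableSpace (Nil n) :=
  inferInstanceAs (MeasurableSpace (Quotient (MulAction.orbitRel (lattice n) (Heis n))))

/-- The projection of the group onto the quotient. -/
def proj (ξ : Heis n) : Nil n := Quotient.mk (MulAction.orbitRel (lattice n) (Heis n)) ξ

/-- The fundamental set of the lattice: all coordinates lie in `[0, 1)`. -/
def fundSet (n : ℕ) : Set (Heis n) :=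
  {ξ | (∀ a, ξ.1 a ∈ Set.Ico (0 : ℝ) 1) ∧ ∀ β, ξ.2 β ∈ Set.Ico (0 : ℝ) 1}

/-- The measure on the quotient: Lebesgue measure on the fundamental set. -/
def nilMeasure (n : ℕ) : Measure (Nil n) :=
  Measure.map proj ((volume : Measure (Heis n)).restrict (fundSet n))

instance : IsFiniteMeasure (nilMeasure n) := by
  have h : (volume : Measure (Heis n)) (fundSet n) < ⊤ := by
    have hc : (volume : Measure ((Fin n × Fin 4 → ℝ) × (Fin 3 → ℝ))) (Set.Icc 0 1) < ⊤ :=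
      isCompact_Icc.measure_lt_top
    refine lt_of_le_of_lt (measure_mono ?_) hc
    rintro ξ ⟨h₁, h₂⟩
    exact ⟨⟨fun a => (h₁ a).1, fun β => (h₂ β).1⟩, ⟨fun a => (h₁ a).2.le, fun β => (h₂ β).2.le⟩⟩
  have : IsFiniteMeasure ((volume : Measure (Heis n)).restrict (fundSet n)) :=
    ⟨by rwa [Measure.restrict_apply_univ]⟩
  unfold nilMeasure
  infer_instance

/-- Right translation by `η`, which descends to the quotient. -/
def translate (η : Heis n) : Nil n → Nil n :=
  Quotient.map (· * η) (by
    rintro ξ ζ ⟨γ, hγ⟩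
    exact ⟨γ, by rw [← hγ]; exact (mul_assoc (γ : Heis n) ζ η).symm⟩)

/-- A complex function on the quotient is smooth if its lift to `ℝ^{4n+3}` is. -/
def SmoothFun (φ : Nil n → ℂ) : Prop := ContDiff ℝ ∞ fun ξ : Heis n => φ (proj ξ)

/-! ### Left invariant vector fields on the quotient -/

/-- The point `t e_a` of the group. -/
def axis (a : Fin n × Fin 4) (t : ℝ) : Heis n := (Pi.single a t, 0)

/-- The left invariant vector field `Y_a`: `(Y_a φ)(q) = d/dt φ(q * t e_a)` at `t = 0`. -/
def Y (a : Fin n × Fin 4) (φ : Nil n → ℂ) : Nil n → ℂ :=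
  fun q => deriv (fun t : ℝ => φ (translate (axis a t) q)) 0

/-- The complex horizontal vector field `Z_A^{A'}`. The index `A = (l, ε)` stands for the
number `2l + ε` in `{0, …, 2n - 1}`, and `A'` is `0'` or `1'`. -/
def Z (A : Fin n × Fin 2) (A' : Fin 2) (φ : Nil n → ℂ) (q : Nil n) : ℂ :=
  match A.2, A' with
  | 0, 0 => -Y (A.1, 2) φ q - Complex.I * Y (A.1, 3) φ q
  | 0, 1 => -Y (A.1, 0) φ q - Complex.I * Y (A.1, 1) φ q
  | 1, 0 => Y (A.1, 0) φ q - Complex.I * Y (A.1, 1) φ q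
  | 1, 1 => -Y (A.1, 2) φ q + Complex.I * Y (A.1, 3) φ q

/-- The distribution `Z_A^{A'} u` for a function `u` on the quotient, applied to the
test function `φ`. The field `Z_A^{A'}` has divergence zero, so its transpose is `-Z_A^{A'}`. -/
def distZ (A : Fin n × Fin 2) (A' : Fin 2) (u φ : Nil n → ℂ) : ℂ :=
  -∫ q, u q * Z A A' φ q ∂(nilMeasure n)

/-! ### The spaces `𝒱_j` and the operators `𝒟_j`, for `j ≤ k` and `j < k` respectively -/

/-- The space `⊙^{k-j} ℂ² ⊗ ∧^j ℂ^{2n}` (for `j ≤ k`): tuples `f_{A'_1 … A'_{k-j} A_1 … A_j}`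
which are symmetric in the primed and antisymmetric in the unprimed indices, with the Hermitian
inner product `∑ f * conj h` over all values of the indices. -/
def V (n k j : ℕ) :
    Submodule ℂ (EuclideanSpace ℂ ((Fin (k - j) → Fin 2) × (Fin j → Fin n × Fin 2))) where
  carrier := {f | (∀ (σ : Equiv.Perm (Fin (k - j))) (a : Fin (k - j) → Fin 2)
        (A : Fin j → Fin n × Fin 2), f (a ∘ σ, A) = f (a, A)) ∧
      ∀ (σ : Equiv.Perm (Fin j)) (a : Fin (k - j) → Fin 2) (A : Fin j → Fin n × Fin 2),
        f (a, A ∘ σ) = ((Equiv.Perm.sign σ : ℤ) : ℂ) * f (a, A)}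
  zero_mem' := by simp
  add_mem' := by
    rintro f g ⟨h₁, h₂⟩ ⟨h₃, h₄⟩
    exact ⟨fun σ a A => by simp [h₁, h₃], fun σ a A => by simp [h₂, h₄, mul_add]⟩
  smul_mem' := by
    rintro c f ⟨h₁, h₂⟩
    exact ⟨fun σ a A => by simp [h₁], fun σ a A => by simp [h₂, mul_left_comm]⟩

/-- The Hilbert space of square integrable sections of `𝒱_j` over the quotient. -/
abbrev L2 (n k j : ℕ) : Type := Lp (V n k j) 2 (nilMeasure n)

/-- The component `f_{a A}` of a function with values in `𝒱_j`. -/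
def comp {k j : ℕ} (f : L2 n k j) (a : Fin (k - j) → Fin 2) (A : Fin j → Fin n × Fin 2) :
    Nil n → ℂ :=
  fun q => (f q : EuclideanSpace ℂ ((Fin (k - j) → Fin 2) × (Fin j → Fin n × Fin 2))) (a, A)

/-- The tuple `A', a_1, …, a_{k-j-1}` of `k - j` primed indices. -/
def consIdx {k j : ℕ} (A' : Fin 2) (a : Fin (k - (j + 1)) → Fin 2) : Fin (k - j) → Fin 2 :=
  fun i => if h : i.val = 0 then A' else a ⟨i.val - 1, by have := i.isLt; omega⟩

/-- For `j < k`: `f` lies in the domain of `𝒟_j : L²(𝒱_j) → L²(𝒱_{j+1})` and `𝒟_j f = g`. The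
operator is taken in the sense of distributions, that is, both sides of
`g_{a A_0 … A_j} = (j + 1) ∑_{A'} Z_{[A_0}^{A'} f_{A_1 … A_j] A' a}`
agree on all smooth test functions; the bracket is
`(1 / (j + 1)!) ∑_σ sign σ (…)` over the permutations `σ` of `0, …, j`. -/
def IsD {k j : ℕ} (f : L2 n k j) (g : L2 n k (j + 1)) : Prop :=
  ∀ (a : Fin (k - (j + 1)) → Fin 2) (A : Fin (j + 1) → Fin n × Fin 2) (φ : Nil n → ℂ),
    SmoothFun φ →
      ∫ q, comp g a A q * φ q ∂(nilMeasure n) =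
        ((j : ℂ) + 1) * (1 / ((j + 1).factorial : ℂ) *
          ∑ σ : Equiv.Perm (Fin (j + 1)), ((Equiv.Perm.sign σ : ℤ) : ℂ) *
            ∑ A' : Fin 2,
              distZ (A (σ 0)) A' (comp f (consIdx A' a) fun i => A (σ i.succ)) φ)

/-- The domain of `𝒟_j`, for `j < k`. -/
def domD (n k j : ℕ) : Set (L2 n k j) := {f | ∃ g : L2 n k (j + 1), IsD f g}

/-- `f` is orthogonal in `L²` to all constant vectors. -/
def PerpConst {k j : ℕ} (f : L2 n k j) : Prop :=
  ∀ c : V n k j, inner ℂ (Lp.const 2 (nilMeasure n) c) f = 0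

end QHeis

end

noncomputable section

namespace QHeis

variable {n : ℕ}

/-! ### Coordinates -/

/-! The argument is Hodge theory in weak form. Since `f` is symmetric in its primed indices, it is a
family of scalar functions `f m A`, with `m` the number of ones among the primed indices. The
closedness equation couples only the neighbours `m` and `m + 1`.

Closed range. The 2×2 block of fields `Z` attached to one quaternionic variable behaves like the
matrix of a quaternion, so summing over `A` removes the mixed terms: for smooth tuples `‖D₀ φ‖²` is
a sum of the squared horizontal gradients of the components (`sum_norm_smZ_add_smZ`,
`norm_smoothD_sq`). With the Poincaré inequality (`poincare`), every element of the closure of the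
range of `D₀` is a weak image (`exists_of_mem_closure`). Horizontal derivatives suffice for Poincaré
because central translations are commutators of horizontal ones (`norm_smR_central`).

No harmonic part. Project `f` orthogonally onto that closure and let `g` be the remainder. It has
mean zero, is closed since `D₁ D₀ = 0`, and is annihilated by the adjoint of `D₀`. Conjugate fields
are again fields `Z` up to sign, so a trace of the closedness equation combines with the adjoint
equation to make each divergence vanish separately (`sum_inner_smW_trace`). Every adjacent pair of
components of `g` is then a closed, divergence free tuple with one primed index.

Such a tuple is zero by a Bochner type estimate (`basic_estimate`). Expanding the antisymmetrised
derivative gives twice the gradient energy, divergence terms and a central term. The central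
commutator is the same operator for all `n` quaternionic variables, so averaging a positivity
statement over them bounds that term below by `-1/n` times the energy (`smC_lower_bound`), and `n ≥
2` leaves a positive multiple.

The estimate needs smooth functions, whereas `g` is only square integrable. Mollifying by right
translations fails to commute with the left invariant fields only through central derivatives; these
are moved onto the mollifier, which is taken much narrower horizontally than centrally so that the
error tends to zero (`norm_sum_smY_smM_le`, `exists_mollifier`, `eq_zero_of_weak`). -/

instance : BorelSpace (Heis n) :=
  inferInstanceAs (BorelSpace ((Fin n × Fin 4 → ℝ) × (Fin 3 → ℝ)))

instance : FiniteDimensional ℝ (Heis n) :=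
  inferInstanceAs (FiniteDimensional ℝ ((Fin n × Fin 4 → ℝ) × (Fin 3 → ℝ)))

instance : SecondCountableTopology (Heis n) :=
  inferInstanceAs (SecondCountableTopology ((Fin n × Fin 4 → ℝ) × (Fin 3 → ℝ)))

instance : ProperSpace (Heis n) :=
  inferInstanceAs (ProperSpace ((Fin n × Fin 4 → ℝ) × (Fin 3 → ℝ)))

instance : (volume : Measure (Heis n)).IsAddHaarMeasure :=
  Measure.prod.instIsAddHaarMeasure (volume : Measure (Fin n × Fin 4 → ℝ))
    (volume : Measure (Fin 3 → ℝ))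

instance : SigmaFinite (volume : Measure (Heis n)) :=
  inferInstanceAs (SigmaFinite (volume : Measure ((Fin n × Fin 4 → ℝ) × (Fin 3 → ℝ))))

/-- The horizontal coordinates. -/
def fstL : Heis n →L[ℝ] (Fin n × Fin 4 → ℝ) :=
  ContinuousLinearMap.fst ℝ (Fin n × Fin 4 → ℝ) (Fin 3 → ℝ)

/-- The central coordinates. -/
def sndL : Heis n →L[ℝ] (Fin 3 → ℝ) :=
  ContinuousLinearMap.snd ℝ (Fin n × Fin 4 → ℝ) (Fin 3 → ℝ)


/-- The point with given coordinates. -/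
def mk (x : Fin n × Fin 4 → ℝ) (t : Fin 3 → ℝ) : Heis n := (x, t)

@[simp] theorem mk_fst (x : Fin n × Fin 4 → ℝ) (t : Fin 3 → ℝ) : (mk x t).1 = x := rfl
@[simp] theorem mk_snd (x : Fin n × Fin 4 → ℝ) (t : Fin 3 → ℝ) : (mk x t).2 = t := rfl

theorem contDiff_mk {E : Type*} [NormedAddCommGroup E] [NormedSpace ℝ E] {m : WithTop ℕ∞}
    {f : E → Fin n × Fin 4 → ℝ} {g : E → Fin 3 → ℝ} (hf : ContDiff ℝ m f) (hg : ContDiff ℝ m g) :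
    ContDiff ℝ m (fun e => mk (f e) (g e)) :=
  ContDiff.prodMk hf hg

theorem contDiff_fst {m : WithTop ℕ∞} : ContDiff ℝ m (fun ξ : Heis n => ξ.1) :=
  (fstL (n := n)).contDiff

theorem contDiff_snd {m : WithTop ℕ∞} : ContDiff ℝ m (fun ξ : Heis n => ξ.2) :=
  (sndL (n := n)).contDiff

theorem contDiff_imPart {E : Type*} [NormedAddCommGroup E] [NormedSpace ℝ E] {m : WithTop ℕ∞}
    {f g : E → Fin n × Fin 4 → ℝ} (hf : ContDiff ℝ m f) (hg : ContDiff ℝ m g) (β : Fin 3) :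
    ContDiff ℝ m (fun e => imPart (f e) (g e) β) := by
  rw [contDiff_pi] at hf hg
  unfold imPart
  refine ContDiff.sum fun l _ => ContDiff.sum fun k _ => ContDiff.sum fun j _ => ?_
  exact (contDiff_const.mul (hf _)).mul (hg _)

theorem contDiff_mul' {E : Type*} [NormedAddCommGroup E] [NormedSpace ℝ E] {m : WithTop ℕ∞}
    {f g : E → Heis n} (hf : ContDiff ℝ m f) (hg : ContDiff ℝ m g) :
    ContDiff ℝ m (fun e => f e * g e) := by
  have h1 := contDiff_fst.comp hf
  have h2 := contDiff_fst.comp hg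
  have h3 := contDiff_snd.comp hf
  have h4 := contDiff_snd.comp hg
  refine contDiff_mk (h1.add h2) (contDiff_pi.2 fun β => ?_)
  exact ((contDiff_pi.1 h3 β).add (contDiff_pi.1 h4 β)).add
    (contDiff_const.mul (contDiff_imPart h1 h2 β))

theorem contDiff_inv' {E : Type*} [NormedAddCommGroup E] [NormedSpace ℝ E] {m : WithTop ℕ∞}
    {f : E → Heis n} (hf : ContDiff ℝ m f) : ContDiff ℝ m (fun e => (f e)⁻¹) := by
  have h1 := contDiff_fst.comp hf
  have h3 := contDiff_snd.comp hf
  refine contDiff_mk h1.neg (contDiff_pi.2 fun β => ?_)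
  exact (contDiff_pi.1 h3 β).neg.add (contDiff_const.mul (contDiff_imPart h1 h1 β))

instance : IsTopologicalGroup (Heis n) where
  continuous_mul := (contDiff_mul' (m := 0) _root_.contDiff_fst _root_.contDiff_snd).continuous
  continuous_inv := (contDiff_inv' (m := 0) contDiff_id).continuous

instance : MeasurableMul₂ (Heis n) := ⟨continuous_mul.measurable⟩

instance : MeasurableInv (Heis n) := ⟨continuous_inv.measurable⟩

/-! ### Invariance of Lebesgue measure -/

/-- Fubini: over each `x` the map is a translation in `t`. Left and right multiplications of the
group both have this shape. -/
theorem measurePreserving_skew (c : Fin n × Fin 4 → ℝ) (w : (Fin n × Fin 4 → ℝ) → Fin 3 → ℝ)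
    (hw : Measurable w) :
    MeasurePreserving (fun ξ : Heis n => mk (ξ.1 + c) (ξ.2 + w ξ.1)) := by
  refine MeasurePreserving.skew_product (f := fun x : Fin n × Fin 4 → ℝ => x + c)
    (measurePreserving_add_right volume c) (g := fun x t => t + w x) ?_ ?_
  · exact measurable_snd.add (hw.comp measurable_fst)
  · exact Filter.Eventually.of_forall fun x => (measurePreserving_add_right volume (w x)).map_eq

theorem measurePreserving_mul_left' (γ : Heis n) :
    MeasurePreserving (fun ξ : Heis n => γ * ξ) := by
  have h := measurePreserving_skew γ.1 (fun x β => γ.2 β + 2 * imPart γ.1 x β)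
    (continuous_pi fun β => (continuous_const.add (continuous_const.mul
      (contDiff_imPart (m := 0) contDiff_const contDiff_id β).continuous))).measurable
  convert h using 2 with ξ
  exact ext' (fun a => by simp [add_comm]) (fun β => by simp; ring)

theorem measurePreserving_mul_right' (γ : Heis n) :
    MeasurePreserving (fun ξ : Heis n => ξ * γ) := by
  have h := measurePreserving_skew γ.1 (fun x β => γ.2 β + 2 * imPart x γ.1 β)
    (continuous_pi fun β => (continuous_const.add (continuous_const.mul
      (contDiff_imPart (m := 0) contDiff_id contDiff_const β).continuous))).measurable
  convert h using 2 with ξ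
  exact ext' (fun a => by simp) (fun β => by simp; ring)

instance : (volume : Measure (Heis n)).IsMulLeftInvariant :=
  ⟨fun γ => (measurePreserving_mul_left' γ).map_eq⟩

/-! ### Fundamental domains of the lattice -/

theorem exists_lattice (m : Fin n × Fin 4 → ℤ) (s : Fin 3 → ℤ) :
    ∃ γ : lattice n, (γ : Heis n) = mk (fun a => (m a : ℝ)) (fun β => (s β : ℝ)) :=
  ⟨⟨mk (fun a => (m a : ℝ)) (fun β => (s β : ℝ)),
    ⟨fun a => ⟨m a, rfl⟩, fun β => ⟨s β, rfl⟩⟩⟩, rfl⟩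

theorem lattice_eq (γ : lattice n) :
    ∃ (m : Fin n × Fin 4 → ℤ) (s : Fin 3 → ℤ),
      (γ : Heis n) = mk (fun a => (m a : ℝ)) (fun β => (s β : ℝ)) := by
  obtain ⟨γ, h1, h2⟩ := γ
  refine ⟨fun a => (h1 a).choose, fun β => (h2 β).choose, ext' (fun a => ?_) fun β => ?_⟩
  · exact (h1 a).choose_spec.symm
  · exact (h2 β).choose_spec.symm

instance : Countable (lattice n) := by
  choose m s h using lattice_eq (n := n)
  refine Function.Injective.countable (f := fun γ => (m γ, s γ)) fun γ γ' e => ?_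
  simp only [Prod.mk.injEq] at e
  exact Subtype.ext (by rw [h, h γ', e.1, e.2])

theorem existsUnique_int (x : ℝ) : ∃! m : ℤ, (m : ℝ) + x ∈ Set.Ico (0 : ℝ) 1 := by
  obtain ⟨m, hm, hu⟩ := existsUnique_add_zsmul_mem_Ico (zero_lt_one' ℝ) x 0
  refine ⟨m, ?_, fun k hk => hu k ?_⟩
  · simpa [add_comm] using hm
  · simpa [add_comm] using hk

/-- The translates of the set of points `(x, t)` with `x - c ∈ [0, 1)` and `t - w x ∈ [0, 1)`
under the lattice form a partition. -/
theorem existsUnique_lattice (c : Fin n × Fin 4 → ℝ) (w : (Fin n × Fin 4 → ℝ) → Fin 3 → ℝ)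
    (ξ : Heis n) :
    ∃! γ : lattice n, (∀ a, ((γ : Heis n) * ξ).1 a - c a ∈ Set.Ico (0 : ℝ) 1) ∧
      ∀ β, ((γ : Heis n) * ξ).2 β - w ((γ : Heis n) * ξ).1 β ∈ Set.Ico (0 : ℝ) 1 := by
  choose m hm hmu using fun a => existsUnique_int (ξ.1 a - c a)
  set M : Fin n × Fin 4 → ℝ := fun a => (m a : ℝ) with hM
  -- The central integers come after the horizontal ones: both the twist `2 Im (M x̄)` and the value
  -- of `w` at the moved point depend on `M`.
  choose s hs hsu using fun β =>
    existsUnique_int (ξ.2 β + 2 * imPart M ξ.1 β - w (M + ξ.1) β)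
  obtain ⟨γ, hγ⟩ := exists_lattice m s
  refine ⟨γ, ⟨fun a => ?_, fun β => ?_⟩, fun γ' ⟨h1, h2⟩ => ?_⟩
  · have := hm a
    rw [hγ, mul_fst, mk_fst, Pi.add_apply]
    convert this using 1; ring
  · have := hs β
    rw [hγ, mul_snd, mul_fst, mk_fst, mk_snd]
    convert this using 1
    simp only [hM]; ring
  · obtain ⟨m', s', h⟩ := lattice_eq γ'
    rw [h] at h1 h2
    have e1 : m' = m := funext fun a => hmu a _ (by
      have := h1 a
      rw [mul_fst, mk_fst, Pi.add_apply] at this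
      convert this using 1; ring)
    subst e1
    have e2 : s' = s := funext fun β => hsu β _ (by
      have := h2 β
      rw [mul_snd, mul_fst, mk_fst, mk_snd] at this
      convert this using 1
      simp only [hM]; ring)
    subst e2
    exact Subtype.ext (h.trans hγ.symm)

theorem measurableSet_fundSet : MeasurableSet (fundSet n) := by
  have h1 : MeasurableSet {ξ : Heis n | ∀ a, ξ.1 a ∈ Set.Ico (0 : ℝ) 1} := by
    rw [Set.ofPred_forall]
    exact MeasurableSet.iInter fun a =>
      ((measurable_pi_apply a).comp (contDiff_fst (m := 0)).continuous.measurable) measurableSet_Ico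
  have h2 : MeasurableSet {ξ : Heis n | ∀ β, ξ.2 β ∈ Set.Ico (0 : ℝ) 1} := by
    rw [Set.ofPred_forall]
    exact MeasurableSet.iInter fun a =>
      ((measurable_pi_apply a).comp (contDiff_snd (m := 0)).continuous.measurable) measurableSet_Ico
  exact h1.inter h2

theorem isFundamentalDomain_fundSet :
    IsFundamentalDomain (lattice n) (fundSet n) (volume : Measure (Heis n)) := by
  refine IsFundamentalDomain.mk' measurableSet_fundSet.nullMeasurableSet fun ξ => ?_
  simpa only [fundSet, Subgroup.smul_def, smul_eq_mul, Set.mem_ofPred_eq, Pi.zero_apply, sub_zero]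
    using existsUnique_lattice 0 0 ξ

/-- Left translation by `η` need not commute with the lattice action, so this is not formal. It
holds because the preimage is still cut out by shifted unit intervals in `x` and, over each `x`, in
`t`. -/
theorem isFundamentalDomain_left (η : Heis n) :
    IsFundamentalDomain (lattice n) ((fun ξ => η * ξ) ⁻¹' fundSet n)
      (volume : Measure (Heis n)) := by
  refine IsFundamentalDomain.mk'
    (measurable_const_mul η measurableSet_fundSet).nullMeasurableSet fun ξ => ?_
  convert existsUnique_lattice (-η.1) (fun x β => -η.2 β - 2 * imPart η.1 x β) ξ using 2 with γ
  rw [Subgroup.smul_def, smul_eq_mul, Set.mem_preimage]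
  generalize (γ : Heis n) * ξ = ζ
  simp only [fundSet, Set.mem_ofPred_eq, mul_fst, mul_snd, Pi.add_apply, Pi.neg_apply]
  refine and_congr (forall_congr' fun a => ?_) (forall_congr' fun β => ?_)
  · rw [sub_neg_eq_add, add_comm]
  · rw [show η.2 β + ζ.2 β + 2 * imPart η.1 ζ.1 β
      = ζ.2 β - (-η.2 β - 2 * imPart η.1 ζ.1 β) by ring]

theorem isFundamentalDomain_right (η : Heis n) :
    IsFundamentalDomain (lattice n) ((fun ξ => ξ * η) ⁻¹' fundSet n)
      (volume : Measure (Heis n)) := by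
  refine IsFundamentalDomain.mk'
    (measurable_mul_const η measurableSet_fundSet).nullMeasurableSet fun ξ => ?_
  convert existsUnique_lattice (-η.1) (fun x β => -η.2 β - 2 * imPart x η.1 β) ξ using 2 with γ
  rw [Subgroup.smul_def, smul_eq_mul, Set.mem_preimage]
  generalize (γ : Heis n) * ξ = ζ
  simp only [fundSet, Set.mem_ofPred_eq, mul_fst, mul_snd, Pi.add_apply, Pi.neg_apply]
  refine and_congr (forall_congr' fun a => ?_) (forall_congr' fun β => ?_)
  · rw [sub_neg_eq_add]
  · rw [show ζ.2 β + η.2 β + 2 * imPart ζ.1 η.1 β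
      = ζ.2 β - (-η.2 β - 2 * imPart ζ.1 η.1 β) by ring]

/-! ### The quotient -/

theorem measurable_proj : Measurable (proj : Heis n → Nil n) :=
  measurable_from_quotient.1 measurable_id

theorem proj_surjective : Function.Surjective (proj : Heis n → Nil n) := Quotient.mk_surjective

theorem proj_smul (γ : lattice n) (ξ : Heis n) : proj (γ • ξ) = proj ξ :=
  Quotient.sound ⟨γ, rfl⟩

theorem proj_eq_iff {ξ ζ : Heis n} : proj ξ = proj ζ ↔ ∃ γ : lattice n, γ • ζ = ξ :=
  Quotient.eq.trans Iff.rfl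

@[simp] theorem translate_proj (η ξ : Heis n) : translate η (proj ξ) = proj (ξ * η) := rfl

theorem measurable_nil_iff {β : Type*} [MeasurableSpace β] {F : Nil n → β} :
    Measurable F ↔ Measurable fun ξ => F (proj ξ) :=
  measurable_from_quotient

theorem translate_translate (η ζ : Heis n) (q : Nil n) :
    translate η (translate ζ q) = translate (ζ * η) q := by
  obtain ⟨ξ, rfl⟩ := proj_surjective q
  simp [mul_assoc]

@[simp] theorem translate_one (q : Nil n) : translate 1 q = q := by
  obtain ⟨ξ, rfl⟩ := proj_surjective q
  simp

theorem measurable_translate (η : Heis n) : Measurable (translate η) :=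
  measurable_nil_iff.2 (measurable_proj.comp (measurable_mul_const η))

theorem integral_nil {F : Nil n → ℂ} (hF : Measurable F) :
    ∫ q, F q ∂(nilMeasure n) = ∫ ξ in fundSet n, F (proj ξ) :=
  integral_map measurable_proj.aemeasurable hF.aestronglyMeasurable

theorem preimage_smul_proj (A : Set (Nil n)) (γ : lattice n) :
    (fun ξ => γ • ξ) ⁻¹' (proj ⁻¹' A) = proj ⁻¹' A := by
  ext ξ
  simp [proj_smul]

/-- An invariant set has the same measure in every fundamental domain. Comparing the cube with its
right translate, and using right invariance of Lebesgue measure, gives the claim. -/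
theorem measurePreserving_translate (η : Heis n) :
    MeasurePreserving (translate η) (nilMeasure n) (nilMeasure n) := by
  refine ⟨measurable_translate η, Measure.ext fun A hA => ?_⟩
  rw [Measure.map_apply (measurable_translate η) hA, nilMeasure,
    Measure.map_apply measurable_proj (measurable_translate η hA),
    Measure.map_apply measurable_proj hA,
    Measure.restrict_apply (measurable_proj (measurable_translate η hA)),
    Measure.restrict_apply (measurable_proj hA)]
  have h1 := (isFundamentalDomain_fundSet (n := n)).measure_set_eq
    (isFundamentalDomain_right η⁻¹) (measurable_proj hA) (preimage_smul_proj A)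
  rw [h1, ← (measurePreserving_mul_right' η).measure_preimage
    ((measurable_proj hA).inter
      (measurable_mul_const _ measurableSet_fundSet)).nullMeasurableSet]
  congr 1
  ext ξ
  simp

theorem ae_proj {p : Nil n → Prop} (h : ∀ᵐ q ∂(nilMeasure n), p q) :
    ∀ᵐ ξ : Heis n, p (proj ξ) := by
  obtain ⟨A, hA, hAm, hA0⟩ := exists_measurable_superset_of_null h
  rw [nilMeasure, Measure.map_apply measurable_proj hAm,
    Measure.restrict_apply (measurable_proj hAm)] at hA0
  have h0 := (isFundamentalDomain_fundSet (n := n)).measure_zero_of_invariant (proj ⁻¹' A)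
    (fun γ => by
      rw [← Set.preimage_smul_inv]
      exact preimage_smul_proj A γ⁻¹) hA0
  refine measure_mono_null (fun ξ hξ => ?_) h0
  exact hA hξ

theorem volume_fundSet : (volume : Measure (Heis n)) (fundSet n) = 1 := by
  have h : fundSet n = (Set.pi Set.univ fun _ : Fin n × Fin 4 => Set.Ico (0 : ℝ) 1) ×ˢ
      (Set.pi Set.univ fun _ : Fin 3 => Set.Ico (0 : ℝ) 1) := by
    ext ξ
    refine Iff.trans ?_ Set.mem_prod.symm
    simp only [fundSet, Set.mem_ofPred_eq, Set.mem_pi, Set.mem_univ, true_imp_iff]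
  rw [h]
  change (volume.prod volume) _ = _
  rw [Measure.prod_prod, Real.volume_pi_Ico, Real.volume_pi_Ico]
  simp

instance : IsProbabilityMeasure (nilMeasure n) := by
  refine ⟨?_⟩
  rw [nilMeasure, Measure.map_apply measurable_proj MeasurableSet.univ]
  simp [volume_fundSet]

/-! ### A measurable section of the projection -/

theorem existsUnique_fundSet (ξ : Heis n) : ∃! γ : lattice n, γ • ξ ∈ fundSet n := by
  simpa only [fundSet, Subgroup.smul_def, smul_eq_mul, Set.mem_ofPred_eq, Pi.zero_apply, sub_zero]
    using existsUnique_lattice 0 0 ξ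

theorem exists_fundSet_proj (q : Nil n) : ∃ ξ ∈ fundSet n, proj ξ = q := by
  obtain ⟨ξ, rfl⟩ := proj_surjective q
  obtain ⟨γ, hγ, -⟩ := existsUnique_fundSet ξ
  exact ⟨γ • ξ, hγ, proj_smul γ ξ⟩

/-- The representative in the fundamental set. -/
def sec (q : Nil n) : Heis n := (exists_fundSet_proj q).choose

theorem sec_mem (q : Nil n) : sec q ∈ fundSet n := (exists_fundSet_proj q).choose_spec.1

@[simp] theorem proj_sec (q : Nil n) : proj (sec q) = q := (exists_fundSet_proj q).choose_spec.2

theorem measurable_sec : Measurable (sec : Nil n → Heis n) := by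
  refine measurable_nil_iff.2 fun A hA => ?_
  have h : (fun ξ : Heis n => sec (proj ξ)) ⁻¹' A =
      ⋃ γ : lattice n, (fun ξ : Heis n => (γ : Heis n) * ξ) ⁻¹' (fundSet n ∩ A) := by
    ext ξ
    obtain ⟨γ, hγ⟩ := proj_eq_iff.1 (proj_sec (proj ξ))
    have hs := sec_mem (proj ξ)
    rw [← hγ] at hs
    simp only [Set.mem_preimage, Set.mem_iUnion, Set.mem_inter_iff]
    rw [← hγ]
    constructor
    · exact fun h => ⟨γ, hs, h⟩
    · rintro ⟨γ', h1, h2⟩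
      rwa [(existsUnique_fundSet ξ).unique hs h1]
  rw [h]
  exact MeasurableSet.iUnion fun γ =>
    measurable_const_mul _ (measurableSet_fundSet.inter hA)

/-- Factoring through the measurable section `sec` reduces joint measurability to that of the group
multiplication. The Fubini arguments below rest on it. -/
theorem measurable_translate_prod :
    Measurable fun p : Heis n × Nil n => translate p.1 p.2 := by
  have h : (fun p : Heis n × Nil n => translate p.1 p.2) = fun p => proj (sec p.2 * p.1) := by
    funext p
    rw [← translate_proj, proj_sec]
  rw [h]
  exact measurable_proj.comp ((measurable_sec.comp measurable_snd).mul measurable_fst)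

/-- Right translation as a measurable equivalence. -/
def translateEquiv (η : Heis n) : Nil n ≃ᵐ Nil n where
  toFun := translate η
  invFun := translate η⁻¹
  left_inv q := by simp [translate_translate]
  right_inv q := by simp [translate_translate]
  measurable_toFun := measurable_translate η
  measurable_invFun := measurable_translate η⁻¹

theorem integral_translate (η : Heis n) (F : Nil n → ℂ) :
    ∫ q, F (translate η q) ∂(nilMeasure n) = ∫ q, F q ∂(nilMeasure n) :=
  (measurePreserving_translate η).integral_comp (translateEquiv η).measurableEmbedding F

/-! ### Left invariant vector fields -/

theorem B_antisymm : ∀ (β : Fin 3) (k j : Fin 4), B β k j = -B β j k := by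
  intro β k j
  fin_cases β <;> fin_cases k <;> fin_cases j <;> rfl

theorem imPart_antisymm (x y : Fin n × Fin 4 → ℝ) (β : Fin 3) :
    imPart x y β = -imPart y x β := by
  simp only [imPart, ← Finset.sum_neg_distrib]
  refine Finset.sum_congr rfl fun l _ => ?_
  rw [Finset.sum_comm]
  refine Finset.sum_congr rfl fun k _ => Finset.sum_congr rfl fun j _ => ?_
  rw [B_antisymm β j k]
  push_cast
  ring

theorem imPart_self (x : Fin n × Fin 4 → ℝ) (β : Fin 3) : imPart x x β = 0 := by
  linarith [imPart_antisymm x x β]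

theorem imPart_smul_right (c : ℝ) (x y : Fin n × Fin 4 → ℝ) (β : Fin 3) :
    imPart x (c • y) β = c * imPart x y β := by
  simp only [imPart, Finset.mul_sum, Pi.smul_apply, smul_eq_mul]
  refine Finset.sum_congr rfl fun l _ => Finset.sum_congr rfl fun k _ =>
    Finset.sum_congr rfl fun j _ => ?_
  ring

@[simp] theorem add_fst' (ξ η : Heis n) : (ξ + η).1 = ξ.1 + η.1 := rfl
@[simp] theorem add_snd' (ξ η : Heis n) : (ξ + η).2 = ξ.2 + η.2 := rfl
@[simp] theorem smul_fst' (c : ℝ) (ξ : Heis n) : (c • ξ).1 = c • ξ.1 := rfl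
@[simp] theorem smul_snd' (c : ℝ) (ξ : Heis n) : (c • ξ).2 = c • ξ.2 := rfl
@[simp] theorem zero_fst' : (0 : Heis n).1 = 0 := rfl
@[simp] theorem zero_snd' : (0 : Heis n).2 = 0 := rfl

@[simp] theorem mul_zero' (ξ : Heis n) : ξ * 0 = ξ :=
  ext' (fun a => by simp) (fun β => by simp)

@[simp] theorem translate_zero (q : Nil n) : translate 0 q = q := by
  obtain ⟨ξ, rfl⟩ := proj_surjective q
  simp

/-- The value at `ξ` of the left invariant vector field which is `v` at the identity. -/
def field (v ξ : Heis n) : Heis n := mk v.1 (fun β => v.2 β + 2 * imPart ξ.1 v.1 β)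

/-- Linearity of `imPart` in its second argument makes the orbits straight lines, so left invariant
derivatives are ordinary directional derivatives. -/
theorem mul_smul_eq (v ξ : Heis n) (t : ℝ) : ξ * (t • v) = ξ + t • field v ξ :=
  ext' (fun a => by simp [field]) (fun β => by simp [field, imPart_smul_right]; ring)

theorem field_mul_smul (v ξ : Heis n) (t : ℝ) : field v (ξ * (t • v)) = field v ξ :=
  ext' (fun a => by simp [field])
    (fun β => by
      simp only [field, mk_snd, mul_fst, smul_fst', imPart_add_left]
      rw [imPart_antisymm (t • v.1), imPart_smul_right, imPart_self]
      simp)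

theorem contDiff_field {m : WithTop ℕ∞} (v : Heis n) : ContDiff ℝ m (field v) :=
  contDiff_mk contDiff_const (contDiff_pi.2 fun β =>
    contDiff_const.add (contDiff_const.mul (contDiff_imPart contDiff_fst contDiff_const β)))

theorem field_add (v w ξ : Heis n) : field (v + w) ξ = field v ξ + field w ξ :=
  ext' (fun a => by simp [field]) (fun β => by simp [field, imPart_add_right]; ring)

theorem field_smul (c : ℝ) (v ξ : Heis n) : field (c • v) ξ = c • field v ξ :=
  ext' (fun a => by simp [field]) (fun β => by simp [field, imPart_smul_right]; ring)

theorem field_add_smul (v ξ ζ : Heis n) (t : ℝ) :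
    field v (ξ + t • ζ) = field v ξ + t • mk 0 (fun β => 2 * imPart ζ.1 v.1 β) :=
  ext' (fun a => by simp [field]) (fun β => by
    simp only [field, mk_snd, add_fst', add_snd', smul_snd', smul_fst', imPart_add_left,
      Pi.add_apply, Pi.smul_apply, smul_eq_mul]
    rw [imPart_antisymm (t • ζ.1), imPart_smul_right, imPart_antisymm ζ.1]
    ring)

/-- The lift of a function to the group. -/
def lift (φ : Nil n → ℂ) : Heis n → ℂ := fun ξ => φ (proj ξ)

theorem SmoothFun.differentiableAt {φ : Nil n → ℂ} (hφ : SmoothFun φ) (ξ : Heis n) :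
    DifferentiableAt ℝ (lift φ) ξ :=
  (ContDiff.differentiable hφ (by simp)) ξ

/-- The derivative along the left invariant vector field with value `v` at the identity. -/
def lieD (v : Heis n) (φ : Nil n → ℂ) : Nil n → ℂ :=
  fun q => deriv (fun t : ℝ => φ (translate (t • v) q)) 0

theorem hasDerivAt_lift {φ : Nil n → ℂ} (hφ : SmoothFun φ) (v ξ : Heis n) (t : ℝ) :
    HasDerivAt (fun t : ℝ => φ (translate (t • v) (proj ξ)))
      (fderiv ℝ (lift φ) (ξ * (t • v)) (field v (ξ * (t • v)))) t := by
  have h1 : HasDerivAt (fun t : ℝ => ξ + t • field v ξ) (field v ξ) t := by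
    simpa using ((hasDerivAt_id t).smul_const (field v ξ)).const_add ξ
  have h2 := (hφ.differentiableAt (ξ + t • field v ξ)).hasFDerivAt.comp_hasDerivAt t h1
  rw [field_mul_smul, mul_smul_eq]
  refine h2.congr_of_eventuallyEq (Filter.Eventually.of_forall fun s => ?_)
  simp only [translate_proj, mul_smul_eq, lift, Function.comp_apply]

theorem lieD_proj {φ : Nil n → ℂ} (hφ : SmoothFun φ) (v ξ : Heis n) :
    lieD v φ (proj ξ) = fderiv ℝ (lift φ) ξ (field v ξ) := by
  have h := (hasDerivAt_lift hφ v ξ 0).deriv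
  simpa [lieD] using h

theorem hasDerivAt_translate {φ : Nil n → ℂ} (hφ : SmoothFun φ) (v : Heis n) (q : Nil n) (t : ℝ) :
    HasDerivAt (fun t : ℝ => φ (translate (t • v) q)) (lieD v φ (translate (t • v) q)) t := by
  obtain ⟨ξ, rfl⟩ := proj_surjective q
  rw [translate_proj, lieD_proj hφ]
  exact hasDerivAt_lift hφ v ξ t

theorem lift_lieD {φ : Nil n → ℂ} (hφ : SmoothFun φ) (v : Heis n) :
    lift (lieD v φ) = fun ξ => fderiv ℝ (lift φ) ξ (field v ξ) :=
  funext fun ξ => lieD_proj hφ v ξ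

theorem SmoothFun.lieD {φ : Nil n → ℂ} (hφ : SmoothFun φ) (v : Heis n) :
    SmoothFun (lieD v φ) := by
  change ContDiff ℝ ∞ (lift (QHeis.lieD v φ))
  rw [lift_lieD hφ]
  exact (ContDiff.fderiv_right (m := ∞) (n := ∞) hφ (by simp)).clm_apply (contDiff_field v)

theorem SmoothFun.translate {φ : Nil n → ℂ} (hφ : SmoothFun φ) (η : Heis n) :
    SmoothFun fun q => φ (translate η q) :=
  ContDiff.comp (g := lift φ) hφ (contDiff_mul' contDiff_id contDiff_const)

theorem SmoothFun.conj {φ : Nil n → ℂ} (hφ : SmoothFun φ) :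
    SmoothFun fun q => (starRingEnd ℂ) (φ q) :=
  ContDiff.comp (g := Complex.conjCLE) Complex.conjCLE.contDiff hφ

theorem SmoothFun.add {φ ψ : Nil n → ℂ} (hφ : SmoothFun φ) (hψ : SmoothFun ψ) :
    SmoothFun (φ + ψ) := ContDiff.add hφ hψ

theorem SmoothFun.smul {φ : Nil n → ℂ} (c : ℂ) (hφ : SmoothFun φ) : SmoothFun (c • φ) :=
  ContDiff.mul contDiff_const hφ

theorem SmoothFun.mul {φ ψ : Nil n → ℂ} (hφ : SmoothFun φ) (hψ : SmoothFun ψ) :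
    SmoothFun (φ * ψ) := ContDiff.mul hφ hψ

theorem smoothFun_const (c : ℂ) : SmoothFun (fun _ : Nil n => c) := contDiff_const

theorem SmoothFun.continuous_lift {φ : Nil n → ℂ} (hφ : SmoothFun φ) :
    Continuous (lift φ) := ContDiff.continuous hφ

theorem SmoothFun.measurable {φ : Nil n → ℂ} (hφ : SmoothFun φ) : Measurable φ :=
  measurable_nil_iff.2 hφ.continuous_lift.measurable

/-- The closed unit cube, which contains the fundamental set. -/
def cube (n : ℕ) : Set (Heis n) :=
  Set.Icc (α := (Fin n × Fin 4 → ℝ) × (Fin 3 → ℝ)) 0 1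

theorem isCompact_cube : IsCompact (cube n) :=
  isCompact_Icc (α := (Fin n × Fin 4 → ℝ) × (Fin 3 → ℝ))

theorem fundSet_subset_cube : fundSet n ⊆ cube n := by
  rintro ξ ⟨h₁, h₂⟩
  exact ⟨⟨fun a => (h₁ a).1, fun β => (h₂ β).1⟩, ⟨fun a => (h₁ a).2.le, fun β => (h₂ β).2.le⟩⟩

theorem SmoothFun.bounded {φ : Nil n → ℂ} (hφ : SmoothFun φ) : ∃ C, ∀ q, ‖φ q‖ ≤ C := by
  obtain ⟨C, hC⟩ := isCompact_cube.exists_bound_of_continuousOn hφ.continuous_lift.continuousOn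
  refine ⟨C, fun q => ?_⟩
  have := hC (sec q) (fundSet_subset_cube (sec_mem q))
  simpa [lift] using this

theorem SmoothFun.memLp {φ : Nil n → ℂ} (hφ : SmoothFun φ) {p : ENNReal} :
    MemLp φ p (nilMeasure n) := by
  obtain ⟨C, hC⟩ := hφ.bounded
  exact MemLp.of_bound hφ.measurable.aestronglyMeasurable C (Filter.Eventually.of_forall hC)

theorem lieD_add_left {φ : Nil n → ℂ} (hφ : SmoothFun φ) (v w : Heis n) :
    lieD (v + w) φ = lieD v φ + lieD w φ := by
  funext q
  obtain ⟨ξ, rfl⟩ := proj_surjective q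
  simp only [Pi.add_apply, lieD_proj hφ, field_add, map_add]

theorem lieD_smul_left {φ : Nil n → ℂ} (hφ : SmoothFun φ) (c : ℝ) (v : Heis n) :
    lieD (c • v) φ = (c : ℂ) • lieD v φ := by
  funext q
  obtain ⟨ξ, rfl⟩ := proj_surjective q
  simp [lieD_proj hφ, field_smul]

theorem lieD_add {φ ψ : Nil n → ℂ} (hφ : SmoothFun φ) (hψ : SmoothFun ψ) (v : Heis n) :
    lieD v (φ + ψ) = lieD v φ + lieD v ψ := by
  funext q
  have h := (hasDerivAt_translate hφ v q 0).add (hasDerivAt_translate hψ v q 0)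
  simp only [zero_smul, translate_zero] at h
  exact h.deriv

theorem lieD_smul {φ : Nil n → ℂ} (c : ℂ) (hφ : SmoothFun φ) (v : Heis n) :
    lieD v (c • φ) = c • lieD v φ := by
  funext q
  have h := (hasDerivAt_translate hφ v q 0).const_mul c
  simp only [zero_smul, translate_zero] at h
  exact h.deriv

theorem lieD_conj {φ : Nil n → ℂ} (hφ : SmoothFun φ) (v : Heis n) :
    lieD v (fun q => (starRingEnd ℂ) (φ q)) = fun q => (starRingEnd ℂ) (lieD v φ q) := by
  funext q
  have h := (hasDerivAt_translate hφ v q 0).star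
  simp only [zero_smul, translate_zero] at h
  exact h.deriv

theorem lieD_mul {φ ψ : Nil n → ℂ} (hφ : SmoothFun φ) (hψ : SmoothFun ψ) (v : Heis n) :
    lieD v (φ * ψ) = lieD v φ * ψ + φ * lieD v ψ := by
  funext q
  have h := (hasDerivAt_translate hφ v q 0).mul (hasDerivAt_translate hψ v q 0)
  simp only [zero_smul, translate_zero] at h
  exact h.deriv

@[simp] theorem lieD_const (v : Heis n) (c : ℂ) : lieD v (fun _ => c) = 0 := by
  funext q
  simp [lieD]

/-- The direction `field w` changes affinely along the orbit of `v`; the product rule gives a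
Hessian term, symmetric in `v` and `w`, and a central first order term, which alone survives in the
commutator. -/
theorem lieD_lieD_proj {φ : Nil n → ℂ} (hφ : SmoothFun φ) (v w ξ : Heis n) :
    lieD v (lieD w φ) (proj ξ) =
      fderiv ℝ (fderiv ℝ (lift φ)) ξ (field v ξ) (field w ξ) +
        fderiv ℝ (lift φ) ξ (mk 0 (fun β => 2 * imPart v.1 w.1 β)) := by
  have hd : DifferentiableAt ℝ (fderiv ℝ (lift φ)) ξ :=
    ((ContDiff.fderiv_right (m := ∞) (n := ∞) hφ (by simp)).differentiable (by simp)) ξ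
  have h1 : HasDerivAt (fun t : ℝ => ξ + t • field v ξ) (field v ξ) 0 := by
    simpa using ((hasDerivAt_id (0 : ℝ)).smul_const (field v ξ)).const_add ξ
  have h2 : HasDerivAt (fun t : ℝ => fderiv ℝ (lift φ) (ξ + t • field v ξ))
      (fderiv ℝ (fderiv ℝ (lift φ)) ξ (field v ξ)) 0 := by
    have := HasFDerivAt.comp_hasDerivAt_of_eq (0 : ℝ) hd.hasFDerivAt h1 (by simp)
    exact this
  have h3 : HasDerivAt (fun t : ℝ => field w (ξ + t • field v ξ))
      (mk 0 (fun β => 2 * imPart v.1 w.1 β)) 0 := by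
    simp only [field_add_smul]
    simpa [field] using ((hasDerivAt_id (0 : ℝ)).smul_const
      (mk (n := n) 0 (fun β => 2 * imPart v.1 w.1 β))).const_add (field w ξ)
  have h4 := h2.clm_apply h3
  simp only [zero_smul, add_zero] at h4
  have h5 : (fun t : ℝ => lieD w φ (translate (t • v) (proj ξ))) =
      fun t => fderiv ℝ (lift φ) (ξ + t • field v ξ) (field w (ξ + t • field v ξ)) := by
    funext t
    rw [translate_proj, lieD_proj hφ, mul_smul_eq]
  rw [lieD, h5, h4.deriv]

/-- The commutator of two left invariant vector fields. -/
theorem lieD_comm {φ : Nil n → ℂ} (hφ : SmoothFun φ) (v w : Heis n) :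
    lieD v (lieD w φ) - lieD w (lieD v φ) = lieD (mk 0 fun β => 4 * imPart v.1 w.1 β) φ := by
  funext q
  obtain ⟨ξ, rfl⟩ := proj_surjective q
  have hsymm : fderiv ℝ (fderiv ℝ (lift φ)) ξ (field v ξ) (field w ξ) =
      fderiv ℝ (fderiv ℝ (lift φ)) ξ (field w ξ) (field v ξ) := by
    have h : ContDiffAt ℝ ∞ (lift φ) ξ := ContDiff.contDiffAt hφ
    exact h.isSymmSndFDerivAt (by
      rw [minSmoothness_of_isRCLikeNormedField]
      exact WithTop.coe_le_coe.2 (le_top : (2 : ℕ∞) ≤ ⊤)) _ _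
  rw [Pi.sub_apply, lieD_lieD_proj hφ, lieD_lieD_proj hφ, hsymm, lieD_proj hφ,
    add_sub_add_left_eq_sub, ← map_sub]
  congr 1
  refine ext' (fun a => ?_) fun β => ?_
  · change (0 : ℝ) - 0 = 0
    simp
  · change 2 * imPart v.1 w.1 β - 2 * imPart w.1 v.1 β = 4 * imPart v.1 w.1 β + 2 * imPart ξ.1 0 β
    rw [imPart_antisymm w.1, imPart_zero_right]
    ring

/-- Moving `v` past `η⁻¹` is the adjoint action, which in a two-step group adds only a central
vector. This is the whole source of the mollification error. -/
theorem translate_lieD {φ : Nil n → ℂ} (hφ : SmoothFun φ) (v η : Heis n) (q : Nil n) :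
    lieD v φ (translate η⁻¹ q) = lieD v (fun q => φ (translate η⁻¹ q)) q +
      lieD (mk 0 fun β => 4 * imPart v.1 η.1 β) φ (translate η⁻¹ q) := by
  obtain ⟨ξ, rfl⟩ := proj_surjective q
  set ζ := ξ * η⁻¹ with hζ
  have h1 : HasDerivAt (fun t : ℝ => ζ + t • (field v ζ - mk 0 fun β => 4 * imPart v.1 η.1 β))
      (field v ζ - mk 0 fun β => 4 * imPart v.1 η.1 β) 0 := by
    simpa using ((hasDerivAt_id (0 : ℝ)).smul_const
      (field v ζ - mk 0 fun β => 4 * imPart v.1 η.1 β)).const_add ζ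
  have h2 := HasFDerivAt.comp_hasDerivAt_of_eq (0 : ℝ) (hφ.differentiableAt ζ).hasFDerivAt h1
    (by simp)
  have h3 : (fun t : ℝ => φ (translate η⁻¹ (translate (t • v) (proj ξ)))) =
      lift φ ∘ fun t : ℝ => ζ + t • (field v ζ - mk 0 fun β => 4 * imPart v.1 η.1 β) := by
    funext t
    simp only [translate_proj, lift, Function.comp_apply]
    congr 2
    refine ext' (fun a => ?_) fun β => ?_
    · change ξ.1 a + t * v.1 a + -η.1 a = ξ.1 a + -η.1 a + t * (v.1 a - 0)
      ring
    · change ξ.2 β + t * v.2 β + 2 * imPart ξ.1 (t • v.1) β + (-η.2 β + 2 * imPart η.1 η.1 β) +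
          2 * imPart (ξ.1 + t • v.1) (-η.1) β = ξ.2 β + (-η.2 β + 2 * imPart η.1 η.1 β) +
          2 * imPart ξ.1 (-η.1) β + t * (v.2 β + 2 * imPart (ξ.1 + -η.1) v.1 β -
            4 * imPart v.1 η.1 β)
      rw [imPart_add_left, imPart_smul_right, imPart_add_left, imPart_antisymm (t • v.1),
        imPart_smul_right, imPart_neg_left, imPart_antisymm v.1]
      ring
  have hz : field (mk 0 fun β => 4 * imPart v.1 η.1 β) ζ =
      mk 0 fun β => 4 * imPart v.1 η.1 β :=
    ext' (fun a => by simp [field]) (fun β => by simp [field])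
  have h4 : lieD v (fun q => φ (translate η⁻¹ q)) (proj ξ) = fderiv ℝ (lift φ) ζ
      (field v ζ - mk 0 fun β => 4 * imPart v.1 η.1 β) := by
    rw [lieD, h3, h2.deriv]
  rw [h4, translate_proj, lieD_proj hφ, lieD_proj hφ, hz, map_sub, sub_add_cancel]

/-! ### Differentiation under the integral sign -/

theorem hasDerivAt_integral_translate {φ ψ : Nil n → ℂ} (hφ : SmoothFun φ)
    (hψ : Integrable ψ (nilMeasure n)) (v : Heis n) (t : ℝ) :
    HasDerivAt (fun t : ℝ => ∫ q, φ (translate (t • v) q) * ψ q ∂(nilMeasure n))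
      (∫ q, lieD v φ (translate (t • v) q) * ψ q ∂(nilMeasure n)) t := by
  obtain ⟨C, hC⟩ := (hφ.lieD v).bounded
  obtain ⟨C', hC'⟩ := hφ.bounded
  have hm : ∀ {φ : Nil n → ℂ}, SmoothFun φ → ∀ t : ℝ,
      AEStronglyMeasurable (fun q => φ (translate (t • v) q) * ψ q) (nilMeasure n) := fun h t =>
    (h.translate _).measurable.aestronglyMeasurable.mul hψ.aestronglyMeasurable
  refine (hasDerivAt_integral_of_dominated_loc_of_deriv_le (s := Set.univ) (x₀ := t)
    (bound := fun q => C * ‖ψ q‖)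
    (F' := fun t q => lieD v φ (translate (t • v) q) * ψ q) Filter.univ_mem
    (Filter.Eventually.of_forall fun t => hm hφ t) ?_ (hm (hφ.lieD v) t) ?_ (hψ.norm.const_mul C)
    ?_).2
  · exact hψ.bdd_mul (hφ.translate _).measurable.aestronglyMeasurable
      (Filter.Eventually.of_forall fun q => hC' _)
  · refine Filter.Eventually.of_forall fun q s _ => ?_
    rw [norm_mul]
    exact mul_le_mul_of_nonneg_right (hC _) (norm_nonneg _)
  · exact Filter.Eventually.of_forall fun q s _ => (hasDerivAt_translate hφ v q s).mul_const (ψ q)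

/-- By invariance of the measure the integral of a translate does not depend on the translation
parameter. -/
theorem integral_lieD {φ : Nil n → ℂ} (hφ : SmoothFun φ) (v : Heis n) :
    ∫ q, lieD v φ q ∂(nilMeasure n) = 0 := by
  have h := hasDerivAt_integral_translate hφ (integrable_const (1 : ℂ)) v 0
  simp only [mul_one, integral_translate] at h
  exact h.unique (hasDerivAt_const _ _)

theorem integral_lieD_mul {φ ψ : Nil n → ℂ} (hφ : SmoothFun φ) (hψ : SmoothFun ψ) (v : Heis n) :
    ∫ q, lieD v φ q * ψ q ∂(nilMeasure n) = -∫ q, φ q * lieD v ψ q ∂(nilMeasure n) := by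
  have h := integral_lieD (hφ.mul hψ) v
  rw [lieD_mul hφ hψ] at h
  rw [eq_neg_iff_add_eq_zero, ← h, ← integral_add]
  · rfl
  · exact memLp_one_iff_integrable.1 ((hφ.lieD v).mul hψ).memLp
  · exact memLp_one_iff_integrable.1 (hφ.mul (hψ.lieD v)).memLp

/-! ### Smooth functions inside the Hilbert space of square integrable functions -/

/-- The scalar Hilbert space. -/
abbrev HL (n : ℕ) : Type := Lp ℂ 2 (nilMeasure n)

/-- The space of smooth functions on the quotient. -/
def Sm (n : ℕ) : Submodule ℂ (Nil n → ℂ) where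
  carrier := {φ | SmoothFun φ}
  zero_mem' := smoothFun_const 0
  add_mem' h₁ h₂ := h₁.add h₂
  smul_mem' c _ h := h.smul c

/-- The embedding of the smooth functions into the Hilbert space. -/
def emb : Sm n →ₗ[ℂ] HL n where
  toFun φ := MemLp.toLp (φ : Nil n → ℂ) (SmoothFun.memLp φ.2)
  map_add' _ _ := rfl
  map_smul' _ _ := rfl

theorem coeFn_emb (φ : Sm n) : (emb φ : Nil n → ℂ) =ᵐ[nilMeasure n] (φ : Nil n → ℂ) :=
  MemLp.coeFn_toLp (SmoothFun.memLp φ.2)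

/-- The left invariant vector fields on smooth functions. -/
def smD (v : Heis n) : Sm n →ₗ[ℂ] Sm n where
  toFun φ := ⟨lieD v φ, SmoothFun.lieD φ.2 v⟩
  map_add' φ ψ := Subtype.ext (lieD_add φ.2 ψ.2 v)
  map_smul' c φ := Subtype.ext (lieD_smul c φ.2 v)

/-- Right translation of smooth functions. -/
def smR (η : Heis n) : Sm n →ₗ[ℂ] Sm n where
  toFun φ := ⟨fun q => (φ : Nil n → ℂ) (translate η q), SmoothFun.translate φ.2 η⟩
  map_add' _ _ := rfl
  map_smul' _ _ := rfl

/-- The constant function one. -/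
def smOne : Sm n := ⟨fun _ => 1, smoothFun_const 1⟩

theorem smR_apply (η : Heis n) (φ : Sm n) (q : Nil n) :
    (smR η φ : Nil n → ℂ) q = (φ : Nil n → ℂ) (translate η q) := rfl

theorem smD_coe (v : Heis n) (φ : Sm n) : (smD v φ : Nil n → ℂ) = lieD v φ := rfl

theorem smOne_apply (q : Nil n) : ((smOne : Sm n) : Nil n → ℂ) q = 1 := rfl

@[simp] theorem smD_one (v : Heis n) : smD v smOne = 0 := Subtype.ext (lieD_const v 1)

theorem smR_mul (ξ η : Heis n) (φ : Sm n) : smR (ξ * η) φ = smR ξ (smR η φ) :=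
  Subtype.ext (funext fun q => by simp only [smR_apply, translate_translate])

/-! ### Inner products with smooth functions, skew symmetry of the fields, unitarity of translations
-/

theorem inner_emb_left (φ : Sm n) (g : HL n) :
    inner ℂ (emb φ) g = ∫ q, (starRingEnd ℂ) ((φ : Nil n → ℂ) q) * g q ∂(nilMeasure n) := by
  rw [L2.inner_def]
  refine integral_congr_ae ?_
  filter_upwards [coeFn_emb φ] with q hq
  rw [RCLike.inner_apply, hq, mul_comm]

theorem inner_emb_right (φ : Sm n) (g : HL n) :
    inner ℂ g (emb φ) = ∫ q, (φ : Nil n → ℂ) q * (starRingEnd ℂ) (g q) ∂(nilMeasure n) := by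
  rw [L2.inner_def]
  refine integral_congr_ae ?_
  filter_upwards [coeFn_emb φ] with q hq
  rw [RCLike.inner_apply, hq]

theorem inner_emb_emb (φ ψ : Sm n) :
    inner ℂ (emb φ) (emb ψ) =
      ∫ q, (starRingEnd ℂ) ((φ : Nil n → ℂ) q) * (ψ : Nil n → ℂ) q ∂(nilMeasure n) := by
  rw [inner_emb_left]
  refine integral_congr_ae ?_
  filter_upwards [coeFn_emb ψ] with q hq
  rw [hq]

theorem inner_smD (v : Heis n) (φ ψ : Sm n) :
    inner ℂ (emb (smD v φ)) (emb ψ) = -inner ℂ (emb φ) (emb (smD v ψ)) := by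
  rw [inner_emb_emb, inner_emb_emb, smD_coe, smD_coe,
    ← integral_lieD_mul (SmoothFun.conj φ.2) ψ.2 v, lieD_conj φ.2]

theorem norm_smR (η : Heis n) (φ : Sm n) : ‖emb (smR η φ)‖ = ‖emb φ‖ := by
  have h : inner ℂ (emb (smR η φ)) (emb (smR η φ)) = inner ℂ (emb φ) (emb φ) := by
    rw [inner_emb_emb, inner_emb_emb]
    exact integral_translate η fun q =>
      (starRingEnd ℂ) ((φ : Nil n → ℂ) q) * (φ : Nil n → ℂ) q
  rw [inner_self_eq_norm_sq_to_K, inner_self_eq_norm_sq_to_K] at h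
  have h2 : ‖emb (smR η φ)‖ ^ 2 = ‖emb φ‖ ^ 2 := by exact_mod_cast h
  exact (sq_eq_sq₀ (norm_nonneg _) (norm_nonneg _)).1 h2

theorem integrable_HL (g : HL n) : Integrable g (nilMeasure n) :=
  (Lp.memLp g).integrable (by norm_num)

theorem integrable_conj {g : Nil n → ℂ} (hg : Integrable g (nilMeasure n)) :
    Integrable (fun q => (starRingEnd ℂ) (g q)) (nilMeasure n) :=
  Complex.conjLIE.integrable_comp_iff.2 hg

/-! ### The Poincaré inequality -/

/-- Pairing the orbit with the difference `g` itself leaves a scalar function of `t` whose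
derivative is at most `‖g‖` times the right side, because translations are isometries; the mean
value inequality on `[0, 1]` finishes. -/
theorem norm_smR_sub_le (v : Heis n) (φ : Sm n) :
    ‖emb (smR v φ) - emb φ‖ ≤ ‖emb (smD v φ)‖ := by
  set g := emb (smR v φ) - emb φ with hg
  have hd : ∀ t : ℝ, HasDerivAt (fun t : ℝ => inner ℂ g (emb (smR (t • v) φ)))
      (inner ℂ g (emb (smR (t • v) (smD v φ)))) t := fun t => by
    simp only [inner_emb_right]
    exact hasDerivAt_integral_translate φ.2 (integrable_conj (integrable_HL g)) v t
  have h := norm_image_sub_le_of_norm_deriv_le_segment_01'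
    (C := ‖g‖ * ‖emb (smD v φ)‖) (fun t _ => (hd t).hasDerivWithinAt) (fun t _ => by
      refine (norm_inner_le_norm _ _).trans ?_
      rw [norm_smR])
  have h0 : smR ((0 : ℝ) • v) φ = φ :=
    Subtype.ext (funext fun q => by rw [smR_apply, zero_smul, translate_zero])
  rw [one_smul, h0, ← inner_sub_right, ← hg, inner_self_eq_norm_sq_to_K] at h
  have h' : ‖g‖ * ‖g‖ ≤ ‖g‖ * ‖emb (smD v φ)‖ := by simpa [sq] using h
  rcases (norm_nonneg g).eq_or_lt with h1 | h1
  · rw [← h1]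
    exact norm_nonneg _
  · exact le_of_mul_le_mul_left h' h1

theorem norm_smR_mul_sub_le (ξ η : Heis n) (φ : Sm n) :
    ‖emb (smR (ξ * η) φ) - emb φ‖ ≤ ‖emb (smR ξ φ) - emb φ‖ + ‖emb (smR η φ) - emb φ‖ := by
  have h : emb (smR (ξ * η) φ) - emb φ =
      (emb (smR ξ φ) - emb φ) + emb (smR ξ (smR η φ - φ)) := by
    rw [smR_mul, map_sub, map_sub]
    abel
  rw [h]
  refine (norm_add_le _ _).trans ?_
  rw [norm_smR, map_sub]

/-- The tangent vector at the identity in the direction of a horizontal coordinate. -/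
def basisVec (a : Fin n × Fin 4) : Heis n := mk (Pi.single a 1) 0

/-- The fields `Y_a` on smooth functions. -/
def smY (a : Fin n × Fin 4) : Sm n →ₗ[ℂ] Sm n := smD (basisVec a)

theorem smD_horizontal (x : Fin n × Fin 4 → ℝ) (φ : Sm n) :
    smD (mk x 0) φ = ∑ a, (x a : ℂ) • smY a φ := by
  have h : mk x 0 = ∑ a, x a • basisVec a := by
    have h1 : (mk x 0 : Heis n) = LinearMap.inl ℝ (Fin n × Fin 4 → ℝ) (Fin 3 → ℝ) x := rfl
    rw [h1]
    conv_lhs => rw [pi_eq_sum_univ' x]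
    rw [map_sum]
    refine Finset.sum_congr rfl fun a _ => ?_
    rw [map_smul]
    rfl
  have h2 : ∀ s : Finset (Fin n × Fin 4), smD (∑ a ∈ s, x a • basisVec a) φ =
      ∑ a ∈ s, (x a : ℂ) • smY a φ := by
    intro s
    induction s using Finset.cons_induction with
    | empty =>
      refine Subtype.ext ?_
      have := lieD_smul_left φ.2 0 (0 : Heis n)
      simpa [smD_coe] using this
    | cons a s ha ih =>
      rw [Finset.sum_cons, Finset.sum_cons, ← ih]
      refine Subtype.ext ?_
      rw [smD_coe, lieD_add_left φ.2, lieD_smul_left φ.2]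
      rfl
  rw [h, h2]

/-- The sum of the norms of the horizontal derivatives. -/
def gradNorm (φ : Sm n) : ℝ := ∑ a, ‖emb (smY a φ)‖

theorem norm_smR_horizontal (x : Fin n × Fin 4 → ℝ) (hx : ∀ a, |x a| ≤ 1) (φ : Sm n) :
    ‖emb (smR (mk x 0) φ) - emb φ‖ ≤ gradNorm φ := by
  refine (norm_smR_sub_le _ φ).trans ?_
  rw [smD_horizontal, map_sum]
  refine (norm_sum_le _ _).trans (Finset.sum_le_sum fun a _ => ?_)
  rw [map_smul, norm_smul, Complex.norm_real, Real.norm_eq_abs]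
  exact mul_le_of_le_one_left (norm_nonneg _) (hx a)

theorem commutator_horizontal (x y : Fin n × Fin 4 → ℝ) :
    mk x 0 * mk y 0 * mk (-x) 0 * mk (-y) 0 = mk 0 (fun β => 4 * imPart x y β) :=
  ext' (fun a => by simp) (fun β => by
    have h1 : imPart x (-y) β = -imPart x y β := by
      rw [imPart_antisymm, imPart_neg_left, imPart_antisymm y, neg_neg]
    have h2 : imPart y (-x) β = imPart x y β := by
      rw [imPart_antisymm, imPart_neg_left, neg_neg]
    have h3 : imPart x (-x) β = 0 := by
      rw [imPart_antisymm, imPart_neg_left, imPart_self]; simp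
    have h4 : imPart y (-y) β = 0 := by
      rw [imPart_antisymm, imPart_neg_left, imPart_self]; simp
    simp only [mul_snd, mul_fst, mk_fst, mk_snd, imPart_add_left, imPart_neg_left, h1, h2, h3, h4,
      Pi.zero_apply]
    ring)

/-- A central translation is a group commutator of two horizontal ones, hence a product of four
horizontal translations, each costing at most `gradNorm φ`. -/
theorem norm_smR_central (hn : 0 < n) (t : Fin 3 → ℝ) (ht : ∀ β, |t β| ≤ 1) (φ : Sm n) :
    ‖emb (smR (mk 0 t) φ) - emb φ‖ ≤ 4 * gradNorm φ := by
  set x : Fin n × Fin 4 → ℝ := Pi.single (⟨0, hn⟩, 0) 1 with hx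
  -- With `x` the real unit of the first quaternion, `4 Im (x ȳ) = -4 Im y`, where `y` on the right
  -- is its first quaternion; this is `t` for imaginary part `-t / 4`.
  set y : Fin n × Fin 4 → ℝ := fun a =>
    (![0, -t 0 / 4, -t 1 / 4, -t 2 / 4] : Fin 4 → ℝ) a.2 with hy
  have hxy : mk 0 t = mk x 0 * mk y 0 * mk (-x) 0 * mk (-y) 0 := by
    rw [commutator_horizontal]
    congr 1
    funext β
    have : imPart x y β = t β / 4 := by
      unfold imPart
      rw [Finset.sum_eq_single (⟨0, hn⟩ : Fin n) (fun l _ hl => by simp [hx, hl]) (by simp),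
        Finset.sum_eq_single (0 : Fin 4) (fun k _ hk => by simp [hx, hk]) (by simp)]
      fin_cases β <;> simp [hx, hy, B, Fin.sum_univ_four] <;> ring
    rw [this]
    ring
  have hx1 : ∀ a, |x a| ≤ 1 := fun a => by
    rw [hx]
    by_cases h : a = (⟨0, hn⟩, 0)
    · subst h; simp
    · simp [h]
  have hy1 : ∀ a, |y a| ≤ 1 := fun a => by
    obtain ⟨l, j⟩ := a
    have h0 := ht 0
    have h1 := ht 1
    have h2 := ht 2
    fin_cases j <;> simp [hy, abs_div] <;> linarith
  have h1 := norm_smR_horizontal x hx1 φ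
  have h2 := norm_smR_horizontal y hy1 φ
  have h3 := norm_smR_horizontal (-x) (fun a => by simpa using hx1 a) φ
  have h4 := norm_smR_horizontal (-y) (fun a => by simpa using hy1 a) φ
  rw [hxy]
  have h5 := norm_smR_mul_sub_le (mk x 0 * mk y 0 * mk (-x) 0) (mk (-y) 0) φ
  have h6 := norm_smR_mul_sub_le (mk x 0 * mk y 0) (mk (-x) 0) φ
  have h7 := norm_smR_mul_sub_le (mk x 0) (mk y 0) φ
  linarith

theorem norm_smR_fundSet (hn : 0 < n) {η : Heis n} (hη : η ∈ fundSet n) (φ : Sm n) :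
    ‖emb (smR η φ) - emb φ‖ ≤ 5 * gradNorm φ := by
  have h : η = mk η.1 0 * mk 0 η.2 := ext' (fun a => by simp) (fun β => by simp)
  have h1 := norm_smR_horizontal η.1 (fun a => by
    rw [abs_of_nonneg (hη.1 a).1]; exact (hη.1 a).2.le) φ
  have h2 := norm_smR_central hn η.2 (fun a => by
    rw [abs_of_nonneg (hη.2 a).1]; exact (hη.2 a).2.le) φ
  have h3 := norm_smR_mul_sub_le (mk η.1 0) (mk 0 η.2) φ
  rw [← h] at h3
  linarith

/-- As `η` runs through the cube, `ξ η` runs through a left translate of it, which is again a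
fundamental domain. -/
theorem setIntegral_translate (φ : Sm n) (q : Nil n) :
    ∫ η in fundSet n, (φ : Nil n → ℂ) (translate η q) =
      ∫ q, (φ : Nil n → ℂ) q ∂(nilMeasure n) := by
  obtain ⟨ξ, rfl⟩ := proj_surjective q
  have he : MeasurableEmbedding (fun η : Heis n => ξ * η) := measurableEmbedding_mulLeft ξ
  have h1 := (measurePreserving_mul_left' ξ).setIntegral_preimage_emb he
    (fun ζ => (φ : Nil n → ℂ) (proj ζ)) ((fun ζ => ξ⁻¹ * ζ) ⁻¹' fundSet n)
  have h2 : (fun η : Heis n => ξ * η) ⁻¹' ((fun ζ => ξ⁻¹ * ζ) ⁻¹' fundSet n) = fundSet n := by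
    ext η
    simp
  rw [h2] at h1
  simp only [translate_proj]
  rw [h1, integral_nil (SmoothFun.measurable φ.2)]
  exact (isFundamentalDomain_left ξ⁻¹).setIntegral_eq isFundamentalDomain_fundSet
    fun γ ζ => by rw [proj_smul]

/-- The mean is the average over the cube of the translates of `φ`, each within `5 * gradNorm φ` of
`φ`. Averaging after pairing with the difference `g` keeps all integrals scalar. -/
theorem norm_sub_mean_le (hn : 0 < n) (φ : Sm n) :
    ‖emb φ - emb ((∫ q, (φ : Nil n → ℂ) q ∂(nilMeasure n)) • smOne)‖ ≤ 5 * gradNorm φ := by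
  set m := ∫ q, (φ : Nil n → ℂ) q ∂(nilMeasure n) with hm
  set g := emb φ - emb (m • smOne) with hg
  have hgi := integrable_conj (integrable_HL g)
  obtain ⟨C, hC⟩ := SmoothFun.bounded φ.2
  have : IsFiniteMeasure ((volume : Measure (Heis n)).restrict (fundSet n)) :=
    ⟨by rw [Measure.restrict_apply_univ, volume_fundSet]; exact ENNReal.one_lt_top⟩
  have hmean : inner ℂ g (emb (m • smOne)) =
      ∫ η in fundSet n, inner ℂ g (emb (smR η φ)) := by
    have h1 : inner ℂ g (emb (m • smOne)) = ∫ q, (∫ η in fundSet n,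
        (φ : Nil n → ℂ) (translate η q) * (starRingEnd ℂ) (g q)) ∂(nilMeasure n) := by
      rw [inner_emb_right]
      refine integral_congr_ae (Filter.Eventually.of_forall fun q => ?_)
      simp only
      rw [integral_mul_const, setIntegral_translate]
      simp [smOne_apply, hm]
    rw [h1, integral_integral_swap]
    · refine integral_congr_ae (Filter.Eventually.of_forall fun η => ?_)
      simp only
      rw [inner_emb_right]
      rfl
    · refine Integrable.bdd_mul (c := C) ?_ ?_ (Filter.Eventually.of_forall fun p => hC _)
      · exact hgi.comp_fst _
      · exact ((SmoothFun.measurable φ.2).comp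
          (measurable_translate_prod.comp measurable_swap)).aestronglyMeasurable
  have hgg : inner ℂ g g = ∫ η in fundSet n, inner ℂ g (emb φ - emb (smR η φ)) := by
    have h1 : ∀ η : Heis n, inner ℂ g (emb φ - emb (smR η φ)) =
        inner ℂ g (emb φ) - inner ℂ g (emb (smR η φ)) := fun η => inner_sub_right _ _ _
    simp only [h1]
    rw [integral_sub (integrable_const _), ← hmean, integral_const]
    · rw [measureReal_restrict_apply_univ, measureReal_def, volume_fundSet,
        ENNReal.toReal_one, one_smul, ← inner_sub_right]
    · refine Integrable.of_bound (C := ‖g‖ * ‖emb φ‖) ?_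
        (Filter.Eventually.of_forall fun η => ?_)
      · simp only [inner_emb_right]
        refine StronglyMeasurable.aestronglyMeasurable ?_
        refine StronglyMeasurable.integral_prod_right (f := fun η q =>
          (smR η φ : Nil n → ℂ) q * (starRingEnd ℂ) (g q)) ?_
        refine Measurable.stronglyMeasurable ?_
        refine ((SmoothFun.measurable φ.2).comp measurable_translate_prod).mul ?_
        exact Complex.continuous_conj.measurable.comp
          ((Lp.stronglyMeasurable g).measurable.comp measurable_snd)
      · exact (norm_inner_le_norm _ _).trans (by rw [norm_smR])
  have hb : ‖g‖ ^ 2 ≤ ‖g‖ * (5 * gradNorm φ) := by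
    have h1 : ‖inner ℂ g g‖ ≤ ‖g‖ * (5 * gradNorm φ) := by
      rw [hgg]
      refine (norm_setIntegral_le_of_norm_le_const (C := ‖g‖ * (5 * gradNorm φ))
        (by rw [volume_fundSet]; exact ENNReal.one_lt_top) fun η hη => ?_).trans ?_
      · refine (norm_inner_le_norm _ _).trans ?_
        exact mul_le_mul_of_nonneg_left
          ((norm_sub_rev _ _).trans_le (norm_smR_fundSet hn hη φ)) (norm_nonneg _)
      · rw [measureReal_def, volume_fundSet]
        simp
    rwa [inner_self_eq_norm_sq_to_K, norm_pow, RCLike.norm_ofReal, abs_norm] at h1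
  rcases (norm_nonneg g).eq_or_lt with h1 | h1
  · rw [← h1]
    exact mul_nonneg (by norm_num) (Finset.sum_nonneg fun a _ => norm_nonneg _)
  · rw [sq] at hb
    exact le_of_mul_le_mul_left hb h1

/-- The Poincaré inequality for smooth functions of mean zero. -/
theorem poincare (hn : 0 < n) (φ : Sm n) (hφ : inner ℂ (emb smOne) (emb φ) = 0) :
    ‖emb φ‖ ^ 2 ≤ 100 * n * ∑ a, ‖emb (smY a φ)‖ ^ 2 := by
  have h0 : ∫ q, (φ : Nil n → ℂ) q ∂(nilMeasure n) = 0 := by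
    rw [inner_emb_emb] at hφ
    simpa [smOne_apply] using hφ
  have h1 := norm_sub_mean_le hn φ
  rw [h0, zero_smul, map_zero, sub_zero] at h1
  have h2 : ‖emb φ‖ ^ 2 ≤ (5 * gradNorm φ) ^ 2 := by gcongr
  -- Cauchy–Schwarz over the `4n` directions; the constant is `100 n = 5² · 4n`.
  have h3 : gradNorm φ ^ 2 ≤ (4 * n) * ∑ a, ‖emb (smY a φ)‖ ^ 2 := by
    have := sq_sum_le_card_mul_sum_sq (s := (Finset.univ : Finset (Fin n × Fin 4)))
      (f := fun a => ‖emb (smY a φ)‖)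
    simp only [Finset.card_univ, Fintype.card_prod, Fintype.card_fin] at this
    push_cast at this
    rw [mul_comm (n : ℝ)] at this
    exact this
  nlinarith

/-! ### Mollification along right translations -/

theorem integrable_lift_right {g : Nil n → ℂ} (hg : Integrable g (nilMeasure n)) (η : Heis n) :
    IntegrableOn (lift g) ((fun ξ => ξ * η⁻¹) ⁻¹' fundSet n) := by
  have h1 : Integrable (g ∘ translate η) (nilMeasure n) :=
    (measurePreserving_translate η).integrable_comp_of_integrable hg
  have h2 : IntegrableOn (fun ξ => g (translate η (proj ξ))) (fundSet n) :=
    (integrable_map_measure h1.aestronglyMeasurable measurable_proj.aemeasurable).1 h1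
  have h3 : (fun ξ : Heis n => ξ * η) ⁻¹' ((fun ξ => ξ * η⁻¹) ⁻¹' fundSet n) = fundSet n := by
    ext ξ
    simp
  have he : MeasurableEmbedding (fun ξ : Heis n => ξ * η) := measurableEmbedding_mulRight η
  rw [← (measurePreserving_mul_right' η).integrableOn_comp_preimage he, h3]
  exact h2

theorem fundSet_mem_nhds : ∃ c : Heis n, fundSet n ∈ nhds c := by
  refine ⟨mk (fun _ => 1 / 2) (fun _ => 1 / 2), ?_⟩
  have h1 : IsOpen ({ξ : Heis n | ∀ a, ξ.1 a ∈ Set.Ioo (0 : ℝ) 1} ∩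
      {ξ : Heis n | ∀ β, ξ.2 β ∈ Set.Ioo (0 : ℝ) 1}) := by
    refine IsOpen.inter ?_ ?_
    · rw [Set.ofPred_forall]
      exact isOpen_iInter_of_finite fun a =>
        isOpen_Ioo.preimage ((continuous_apply a).comp (contDiff_fst (m := 0)).continuous)
    · rw [Set.ofPred_forall]
      exact isOpen_iInter_of_finite fun a =>
        isOpen_Ioo.preimage ((continuous_apply a).comp (contDiff_snd (m := 0)).continuous)
  refine Filter.mem_of_superset (h1.mem_nhds ⟨fun a => ?_, fun β => ?_⟩) fun ξ hξ =>
    ⟨fun a => Set.Ioo_subset_Ico_self (hξ.1 a), fun β => Set.Ioo_subset_Ico_self (hξ.2 β)⟩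
  · rw [mk_fst]; constructor <;> norm_num
  · rw [mk_snd]; constructor <;> norm_num

theorem locallyIntegrable_lift {g : Nil n → ℂ} (hg : Integrable g (nilMeasure n)) :
    LocallyIntegrable (lift g) := by
  intro ξ
  obtain ⟨c, hc⟩ := fundSet_mem_nhds (n := n)
  refine ⟨_, ?_, integrable_lift_right hg (c⁻¹ * ξ)⟩
  have h : Continuous fun ζ : Heis n => ζ * (c⁻¹ * ξ)⁻¹ := continuous_mul_const _
  refine h.continuousAt.preimage_mem_nhds ?_
  convert hc using 2
  group

/-- Averages of right translates. -/
def mollify (χ : Heis n → ℝ) (g : Nil n → ℂ) : Nil n → ℂ :=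
  fun q => ∫ η, (χ η : ℂ) * g (translate η q)

theorem smoothFun_mollify {χ : Heis n → ℝ} (hχ : ContDiff ℝ ∞ χ) (hc : HasCompactSupport χ)
    {g : Nil n → ℂ} (hg : Integrable g (nilMeasure n)) : SmoothFun (mollify χ g) := by
  -- On the group the average is `∫ χ (ξ⁻¹ ζ) g(ζ) dζ`. It becomes a Euclidean convolution once the
  -- kernel may depend on the point `p`, and smoothness of convolutions with a parameter applies.
  set ker : Heis n → Heis n → ℂ := fun p y => (χ (p⁻¹ * (p - y)) : ℂ) with hker
  have h1 : (fun ξ => mollify χ g (proj ξ)) =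
      fun ξ => convolution (lift g) (ker ξ) (ContinuousLinearMap.mul ℝ ℂ) volume (id ξ) := by
    funext ξ
    have h := integral_mul_left_eq_self (μ := (volume : Measure (Heis n)))
      (fun ζ => (χ (ξ⁻¹ * ζ) : ℂ) * g (proj ζ)) ξ
    simp only [inv_mul_cancel_left] at h
    rw [mollify]
    simp only [translate_proj]
    rw [h, convolution]
    refine integral_congr_ae (Filter.Eventually.of_forall fun ζ => ?_)
    simp only [hker, ContinuousLinearMap.mul_apply', lift, id, sub_sub_cancel]
    ring
  change ContDiff ℝ ∞ fun ξ => mollify χ g (proj ξ)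
  rw [h1, contDiff_iff_contDiffAt]
  intro ξ
  have hs : ContDiffOn ℝ ∞ (fun ξ => convolution (lift g) (ker ξ) (ContinuousLinearMap.mul ℝ ℂ)
      volume (id ξ)) (Metric.ball 0 (‖ξ‖ + 1)) := by
    refine contDiffOn_convolution_right_with_param_comp (n := ⊤) _ contDiff_id.contDiffOn
      (k := (fun p : Heis n × Heis n => p.1 - p.1 * p.2) ''
        (Metric.closedBall 0 (‖ξ‖ + 1) ×ˢ tsupport χ)) Metric.isOpen_ball ?_ ?_
      (locallyIntegrable_lift hg) ?_
    · refine ((isCompact_closedBall _ _).prod hc).image ?_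
      exact continuous_fst.sub (continuous_fst.mul continuous_snd)
    · intro p x hp hx
      by_contra hne
      refine hx ⟨(p, p⁻¹ * (p - x)), ⟨Metric.ball_subset_closedBall hp, ?_⟩, by simp⟩
      refine subset_tsupport _ ?_
      simp only [hker, Complex.ofReal_eq_zero] at hne
      exact hne
    · refine ContDiff.contDiffOn ?_
      refine Complex.ofRealCLM.contDiff.comp (hχ.comp ?_)
      exact contDiff_mul' (contDiff_inv' _root_.contDiff_fst)
        (_root_.contDiff_fst.sub _root_.contDiff_snd)
  exact hs.contDiffAt (Metric.isOpen_ball.mem_nhds (by simp))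

/-- The mollification of a square integrable function, as a smooth function. -/
def smM {χ : Heis n → ℝ} (hχ : ContDiff ℝ ∞ χ) (hc : HasCompactSupport χ) (g : HL n) : Sm n :=
  ⟨mollify χ g, smoothFun_mollify hχ hc (integrable_HL g)⟩

/-! ### Mollification transferred to the test function -/

theorem measurePreserving_translate_prod :
    MeasurePreserving (fun p : Heis n × Nil n => (p.1, translate p.1 p.2))
      (volume.prod (nilMeasure n)) (volume.prod (nilMeasure n)) :=
  MeasurePreserving.skew_product (MeasurePreserving.id _) measurable_translate_prod
    (Filter.Eventually.of_forall fun η => (measurePreserving_translate η).map_eq)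

theorem integral_mul_mollify {χ : Heis n → ℝ} (hχ : Integrable χ) {g φ : Nil n → ℂ}
    (hg : Integrable g (nilMeasure n)) (hφ : SmoothFun φ) :
    ∫ q, φ q * mollify χ g q ∂(nilMeasure n) =
      ∫ η, (χ η : ℂ) * ∫ q, φ (translate η⁻¹ q) * g q ∂(nilMeasure n) := by
  have h1 : ∀ q, φ q * mollify χ g q = ∫ η, φ q * ((χ η : ℂ) * g (translate η q)) := fun q =>
    (integral_const_mul _ _).symm
  simp only [h1]
  rw [integral_integral_swap]
  · refine integral_congr_ae (Filter.Eventually.of_forall fun η => ?_)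
    simp only
    rw [← integral_const_mul, ← integral_translate η fun q =>
      (χ η : ℂ) * (φ (translate η⁻¹ q) * g q)]
    refine integral_congr_ae (Filter.Eventually.of_forall fun q => ?_)
    simp only [translate_translate, mul_inv_cancel, translate_one]
    ring
  · obtain ⟨C, hC⟩ := hφ.bounded
    have h2 : Integrable (fun p : Heis n × Nil n => (χ p.1 : ℂ) * g p.2)
        (volume.prod (nilMeasure n)) := hχ.ofReal.mul_prod hg
    have h3 := measurePreserving_translate_prod.integrable_comp_of_integrable h2
    have h4 := h3.bdd_mul (c := C) (f := fun p => φ p.2)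
      (hφ.measurable.comp measurable_snd).aestronglyMeasurable
      (Filter.Eventually.of_forall fun p => hC _)
    exact h4.swap

theorem continuous_integrable {E : Type*} [NormedAddCommGroup E] {χ : Heis n → E}
    (hχ : Continuous χ) (hc : HasCompactSupport χ) : Integrable χ :=
  hχ.integrable_of_hasCompactSupport hc

/-- Fubini and invariance put the translations on `φ`. Weak equations for `g` can then be applied to
each translated test function. -/
theorem inner_smM {χ : Heis n → ℝ} (hχ : ContDiff ℝ ∞ χ) (hc : HasCompactSupport χ) (g : HL n)
    (φ : Sm n) :
    inner ℂ (emb φ) (emb (smM hχ hc g)) = ∫ η, (χ η : ℂ) * inner ℂ (emb (smR η⁻¹ φ)) g := by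
  rw [inner_emb_emb]
  refine (integral_mul_mollify (continuous_integrable hχ.continuous hc) (integrable_HL g)
    (SmoothFun.conj φ.2)).trans ?_
  refine integral_congr_ae (Filter.Eventually.of_forall fun η => ?_)
  simp only
  rw [inner_emb_left]
  rfl

theorem measurable_inner_smR (φ : Sm n) (g : HL n) :
    StronglyMeasurable fun η : Heis n => inner ℂ (emb (smR η⁻¹ φ)) g := by
  simp only [inner_emb_left]
  refine StronglyMeasurable.integral_prod_right (f := fun η q =>
    (starRingEnd ℂ) ((smR η⁻¹ φ : Nil n → ℂ) q) * g q) ?_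
  refine Measurable.stronglyMeasurable ?_
  refine (Complex.continuous_conj.measurable.comp ((SmoothFun.measurable φ.2).comp
    (measurable_translate_prod.comp ((measurable_inv.comp measurable_fst).prodMk
      measurable_snd)))).mul ?_
  exact (Lp.stronglyMeasurable g).measurable.comp measurable_snd

theorem norm_inner_smR_le (η : Heis n) (φ : Sm n) (g : HL n) :
    ‖inner ℂ (emb (smR η φ)) g‖ ≤ ‖emb φ‖ * ‖g‖ :=
  (norm_inner_le_norm _ _).trans (by rw [norm_smR])

theorem integrable_mul_inner_smR {θ : Heis n → ℝ} (hθ : Continuous θ) (hc : HasCompactSupport θ)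
    (φ : Sm n) (g : HL n) :
    Integrable fun η => (θ η : ℂ) * inner ℂ (emb (smR η⁻¹ φ)) g :=
  (continuous_integrable hθ hc).ofReal.mul_bdd (c := ‖emb φ‖ * ‖g‖)
    (measurable_inner_smR φ g).aestronglyMeasurable
    (Filter.Eventually.of_forall fun _ => norm_inner_smR_le _ φ g)

/-! ### Central derivatives -/

/-- The tangent vector at the identity in the direction of a central coordinate. -/
def centralVec (β : Fin 3) : Heis n := mk 0 (Pi.single β 1)

/-- The central vector fields on smooth functions. -/
def smT (β : Fin 3) : Sm n →ₗ[ℂ] Sm n := smD (centralVec β)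

theorem smD_add_left (v w : Heis n) (φ : Sm n) : smD (v + w) φ = smD v φ + smD w φ :=
  Subtype.ext (lieD_add_left φ.2 v w)

theorem smD_smul_left (c : ℝ) (v : Heis n) (φ : Sm n) : smD (c • v) φ = (c : ℂ) • smD v φ :=
  Subtype.ext (lieD_smul_left φ.2 c v)

theorem smD_central (s : Fin 3 → ℝ) (φ : Sm n) :
    smD (mk 0 s) φ = ∑ β, (s β : ℂ) • smT β φ := by
  have h : mk 0 s = s 0 • centralVec (n := n) 0 + s 1 • centralVec 1 + s 2 • centralVec 2 :=
    ext' (fun a => by simp [centralVec]) (fun β => by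
      fin_cases β <;> simp [centralVec])
  rw [h, smD_add_left, smD_add_left, smD_smul_left, smD_smul_left, smD_smul_left,
    Fin.sum_univ_three]
  rfl

theorem inv_eq_neg (ξ : Heis n) : ξ⁻¹ = -ξ :=
  ext' (fun a => rfl) (fun β => by
    rw [inv_snd, imPart_self, mul_zero, add_zero]
    rfl)

theorem central_comm (s : Fin 3 → ℝ) (ξ : Heis n) : ξ * mk 0 s = mk 0 s * ξ :=
  ext' (fun a => by simp) (fun β => by simp [add_comm])

theorem smR_smD (v η : Heis n) (φ : Sm n) :
    smR η⁻¹ (smD v φ) = smD v (smR η⁻¹ φ) +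
      ∑ β, ((4 * imPart v.1 η.1 β : ℝ) : ℂ) • smR η⁻¹ (smT β φ) := by
  have h : smR η⁻¹ (smD v φ) = smD v (smR η⁻¹ φ) +
      smR η⁻¹ (smD (mk 0 fun β => 4 * imPart v.1 η.1 β) φ) :=
    Subtype.ext (funext fun q => translate_lieD φ.2 v η q)
  rw [h, smD_central, map_sum]
  simp only [map_smul]

theorem smR_smT (β : Fin 3) (η : Heis n) (φ : Sm n) :
    smR η⁻¹ (smT β φ) = smT β (smR η⁻¹ φ) := by
  have h := smR_smD (centralVec β) η φ
  simpa [centralVec, smT] using h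

/-- Adding a central vector to `η` is multiplying by a central element, so the derivative in `η`
falls on `φ` as a central field; the sign comes from `η⁻¹`. -/
theorem hasLineDerivAt_inner_smR (β : Fin 3) (φ : Sm n) (g : HL n) (η : Heis n) :
    HasLineDerivAt ℝ (fun η => inner ℂ (emb (smR η⁻¹ φ)) g)
      (-inner ℂ (emb (smR η⁻¹ (smT β φ))) g) η (centralVec β) := by
  have h1 := hasDerivAt_integral_translate (SmoothFun.conj (smR η⁻¹ φ).2) (integrable_HL g)
    (centralVec β) 0
  have h2 := HasDerivAt.scomp_of_eq (0 : ℝ) h1 (hasDerivAt_neg (0 : ℝ)) (by simp)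
  unfold HasLineDerivAt
  convert h2 using 1
  · funext t
    rw [Function.comp_apply]
    refine (inner_emb_left _ _).trans ?_
    refine integral_congr_ae (Filter.Eventually.of_forall fun q => ?_)
    simp only [smR_apply, translate_translate]
    have h3 : (-t) • centralVec (n := n) β = mk 0 ((-t) • Pi.single β 1) :=
      ext' (fun a => by simp [centralVec, -neg_smul])
        (fun b => by simp [centralVec, -neg_smul])
    rw [h3, inv_eq_neg, inv_eq_neg, ← central_comm]
    have h4 : -(η + t • centralVec β) = -η * mk 0 ((-t) • Pi.single β 1) := by
      refine ext' (fun a => ?_) fun b => ?_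
      · change -(η.1 a + t * 0) = -η.1 a + 0
        ring
      · change -(η.2 b + t * (Pi.single β 1 : Fin 3 → ℝ) b) =
          -η.2 b + -t * (Pi.single β 1 : Fin 3 → ℝ) b + 2 * imPart (-η.1) 0 b
        rw [imPart_zero_right]
        ring
    rw [h4]
  · rw [inner_emb_left, neg_smul, one_smul]
    congr 1
    refine integral_congr_ae (Filter.Eventually.of_forall fun q => ?_)
    simp only [zero_smul, translate_zero]
    rw [lieD_conj (smR η⁻¹ φ).2, smR_smT]
    rfl

theorem hasLineDerivAt_mul_imPart {χ : Heis n → ℝ} (hχ : ContDiff ℝ ∞ χ)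
    (x : Fin n × Fin 4 → ℝ) (β : Fin 3) (η : Heis n) :
    HasLineDerivAt ℝ (fun η => χ η * (4 * imPart x η.1 β))
      (fderiv ℝ χ η (centralVec β) * (4 * imPart x η.1 β)) η (centralVec β) := by
  have h1 : HasLineDerivAt ℝ χ (fderiv ℝ χ η (centralVec β)) η (centralVec β) :=
    ((hχ.differentiable (by simp)) η).hasFDerivAt.hasLineDerivAt _
  unfold HasLineDerivAt at h1 ⊢
  have h2 : ∀ t : ℝ, (η + t • centralVec (n := n) β).1 = η.1 := fun t => by simp [centralVec]
  simp only [h2]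
  exact h1.mul_const _

/-- Integration by parts in `η` frees the test function of its derivative. The weight depends on
horizontal coordinates only and is not differentiated. -/
theorem integral_mul_inner_smT {χ : Heis n → ℝ} (hχ : ContDiff ℝ ∞ χ) (hc : HasCompactSupport χ)
    (x : Fin n × Fin 4 → ℝ) (β : Fin 3) (φ : Sm n) (g : HL n) :
    ∫ η, ((χ η * (4 * imPart x η.1 β) : ℝ) : ℂ) * inner ℂ (emb (smR η⁻¹ (smT β φ))) g =
      ∫ η, ((fderiv ℝ χ η (centralVec β) * (4 * imPart x η.1 β) : ℝ) : ℂ) *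
        inner ℂ (emb (smR η⁻¹ φ)) g := by
  have hi : Continuous fun η : Heis n => 4 * imPart x η.1 β :=
    continuous_const.mul (contDiff_imPart (m := 0) contDiff_const contDiff_fst β).continuous
  have hd : Continuous fun η => fderiv ℝ χ η (centralVec β) :=
    (hχ.continuous_fderiv (by simp)).clm_apply continuous_const
  have hdc : HasCompactSupport fun η => fderiv ℝ χ η (centralVec β) := hc.fderiv_apply ℝ _
  have h := integral_bilinear_hasLineDerivAt_right_eq_neg_left_of_integrable
    (μ := (volume : Measure (Heis n)))
    (B := ContinuousLinearMap.lsmul ℝ ℝ (E := ℂ)) (v := centralVec β)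
    (f := fun η => χ η * (4 * imPart x η.1 β))
    (f' := fun η => fderiv ℝ χ η (centralVec β) * (4 * imPart x η.1 β))
    (g := fun η => inner ℂ (emb (smR η⁻¹ φ)) g)
    (g' := fun η => -inner ℂ (emb (smR η⁻¹ (smT β φ))) g)
    (by
      simp only [ContinuousLinearMap.lsmul_apply, Complex.real_smul]
      exact integrable_mul_inner_smR (hd.mul hi) hdc.mul_right φ g)
    (by
      simp only [ContinuousLinearMap.lsmul_apply, Complex.real_smul, mul_neg]
      exact (integrable_mul_inner_smR (hχ.continuous.mul hi) hc.mul_right _ g).neg)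
    (by
      simp only [ContinuousLinearMap.lsmul_apply, Complex.real_smul]
      exact integrable_mul_inner_smR (hχ.continuous.mul hi) hc.mul_right φ g)
    (fun η _ => hasLineDerivAt_mul_imPart hχ x β η)
    (fun η _ => hasLineDerivAt_inner_smR β φ g η)
  simp only [ContinuousLinearMap.lsmul_apply, Complex.real_smul, mul_neg, integral_neg,
    neg_inj] at h
  exact h

/-- The size of the commutator of mollification with the field `Y_a`. -/
def commSize (χ : Heis n → ℝ) (a : Fin n × Fin 4) : ℝ :=
  ∑ β, ∫ η, |fderiv ℝ χ η (centralVec β) * (4 * imPart (Pi.single a 1) η.1 β)|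

/-- Mollification almost preserves weak solutions of first order equations. -/
theorem norm_sum_smY_smM_le {I : Type*} [Fintype I] {χ : Heis n → ℝ} (hχ : ContDiff ℝ ∞ χ)
    (hc : HasCompactSupport χ) (c : I → ℂ) (a : I → Fin n × Fin 4) (g : I → HL n)
    (hw : ∀ φ : Sm n, ∑ i, c i * inner ℂ (emb (smY (a i) φ)) (g i) = 0) :
    ‖emb (∑ i, c i • smY (a i) (smM hχ hc (g i)))‖ ≤ ∑ i, ‖c i‖ * commSize χ (a i) * ‖g i‖ := by
  set R := ∑ i, c i • smY (a i) (smM hχ hc (g i)) with hR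
  have hi : ∀ (i : I) (β : Fin 3), Continuous fun η : Heis n =>
      4 * imPart (Pi.single (a i) 1) η.1 β := fun i β =>
    continuous_const.mul (contDiff_imPart (m := 0) contDiff_const contDiff_fst β).continuous
  have hd : ∀ β, Continuous fun η => fderiv ℝ χ η (centralVec β) := fun β =>
    (hχ.continuous_fderiv (by simp)).clm_apply continuous_const
  have hdc : ∀ β, HasCompactSupport fun η => fderiv ℝ χ η (centralVec β) :=
    fun β => hc.fderiv_apply ℝ _
  -- Pull the field past the translation: the main term vanishes by the weak equation for the
  -- translated `φ`, and in the commutator term the central derivative is moved onto `χ`. No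
  -- derivative of `φ` remains.
  have key : ∀ φ : Sm n, inner ℂ (emb φ) (emb R) = -∑ i, c i * ∑ β,
      ∫ η, ((fderiv ℝ χ η (centralVec β) * (4 * imPart (Pi.single (a i) 1) η.1 β) : ℝ) : ℂ) *
        inner ℂ (emb (smR η⁻¹ φ)) (g i) := by
    intro φ
    have h1 : inner ℂ (emb φ) (emb R) =
        -∑ i, c i * ∫ η, (χ η : ℂ) * inner ℂ (emb (smR η⁻¹ (smY (a i) φ))) (g i) := by
      rw [hR, map_sum, inner_sum, ← Finset.sum_neg_distrib]
      refine Finset.sum_congr rfl fun i _ => ?_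
      rw [map_smul, inner_smul_right, ← inner_smM hχ hc, smY, inner_smD]
      ring
    have hint : ∀ i β, Integrable fun η =>
        ((χ η * (4 * imPart (Pi.single (a i) 1) η.1 β) : ℝ) : ℂ) *
        inner ℂ (emb (smR η⁻¹ (smT β φ))) (g i) := fun i β =>
      integrable_mul_inner_smR (hχ.continuous.mul (hi i β)) hc.mul_right _ _
    have e : ∀ i η, (χ η : ℂ) * inner ℂ (emb (smR η⁻¹ (smY (a i) φ))) (g i) =
        (χ η : ℂ) * inner ℂ (emb (smY (a i) (smR η⁻¹ φ))) (g i) +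
        ∑ β, ((χ η * (4 * imPart (Pi.single (a i) 1) η.1 β) : ℝ) : ℂ) *
          inner ℂ (emb (smR η⁻¹ (smT β φ))) (g i) := by
      intro i η
      rw [smY, smR_smD, map_add, inner_add_left, mul_add, map_sum, sum_inner, Finset.mul_sum]
      congr 1
      refine Finset.sum_congr rfl fun β _ => ?_
      rw [map_smul, inner_smul_left, Complex.conj_ofReal]
      simp only [basisVec, mk_fst]
      push_cast
      ring
    have hint0 : ∀ i, Integrable fun η =>
        (χ η : ℂ) * inner ℂ (emb (smY (a i) (smR η⁻¹ φ))) (g i) := by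
      intro i
      simp only [← fun η => sub_eq_of_eq_add (e i η)]
      exact (integrable_mul_inner_smR hχ.continuous hc _ _).sub
        (integrable_finsetSum _ fun β _ => hint i β)
    have h2 : ∀ i, ∫ η, (χ η : ℂ) * inner ℂ (emb (smR η⁻¹ (smY (a i) φ))) (g i) =
        (∫ η, (χ η : ℂ) * inner ℂ (emb (smY (a i) (smR η⁻¹ φ))) (g i)) +
        ∑ β, ∫ η, ((χ η * (4 * imPart (Pi.single (a i) 1) η.1 β) : ℝ) : ℂ) *
          inner ℂ (emb (smR η⁻¹ (smT β φ))) (g i) := by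
      intro i
      rw [← integral_finsetSum _ fun β _ => hint i β, ← integral_add (hint0 i)
        (integrable_finsetSum _ fun β _ => hint i β)]
      exact integral_congr_ae (Filter.Eventually.of_forall (e i))
    have h3 : ∑ i, c i * ∫ η, (χ η : ℂ) * inner ℂ (emb (smY (a i) (smR η⁻¹ φ))) (g i) = 0 := by
      simp only [← integral_const_mul]
      rw [← integral_finsetSum _ fun i _ => (hint0 i).const_mul _]
      refine integral_eq_zero_of_ae (Filter.Eventually.of_forall fun η => ?_)
      calc _ = (χ η : ℂ) * ∑ i, c i * inner ℂ (emb (smY (a i) (smR η⁻¹ φ))) (g i) := by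
            rw [Finset.mul_sum]
            exact Finset.sum_congr rfl fun i _ => by ring
        _ = 0 := by rw [hw, mul_zero]
    rw [h1]
    simp only [h2, mul_add, Finset.sum_add_distrib, h3, zero_add, integral_mul_inner_smT hχ hc]
  -- The choice `φ = R` turns the weak identity into a norm bound.
  have hb : ‖emb R‖ ^ 2 ≤ ‖emb R‖ * ∑ i, ‖c i‖ * commSize χ (a i) * ‖g i‖ := by
    have h1 : ‖inner ℂ (emb R) (emb R)‖ ≤ ‖emb R‖ * ∑ i, ‖c i‖ * commSize χ (a i) * ‖g i‖ := by
      rw [key R, norm_neg, Finset.mul_sum]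
      refine (norm_sum_le _ _).trans (Finset.sum_le_sum fun i _ => ?_)
      rw [norm_mul, commSize, show ∀ x y z w : ℝ, x * (y * z * w) = y * (z * (x * w)) by
        intros; ring, Finset.sum_mul]
      refine mul_le_mul_of_nonneg_left ?_ (norm_nonneg _)
      refine (norm_sum_le _ _).trans (Finset.sum_le_sum fun β _ => ?_)
      refine (norm_integral_le_integral_norm _).trans ?_
      rw [← integral_mul_const]
      refine integral_mono ?_ ?_ fun η => ?_
      · exact (integrable_mul_inner_smR ((hd β).mul (hi i β)) (hdc β).mul_right R (g i)).norm
      · exact ((continuous_integrable ((hd β).mul (hi i β)) (hdc β).mul_right).abs).mul_const _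
      · simp only [norm_mul, Complex.norm_real, Real.norm_eq_abs, abs_mul]
        exact mul_le_mul_of_nonneg_left (norm_inner_smR_le _ _ _) (by positivity)
    rwa [inner_self_eq_norm_sq_to_K, norm_pow, RCLike.norm_ofReal, abs_norm] at h1
  rcases (norm_nonneg (emb R)).eq_or_lt with h1 | h1
  · rw [← h1]
    refine Finset.sum_nonneg fun i _ => mul_nonneg (mul_nonneg (norm_nonneg _) ?_) (norm_nonneg _)
    exact Finset.sum_nonneg fun β _ => integral_nonneg fun η => abs_nonneg _
  · rw [sq] at hb
    exact le_of_mul_le_mul_left hb h1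

/-! ### Approximate identities -/

theorem abs_B_le (β : Fin 3) (k j : Fin 4) : |(B β k j : ℝ)| ≤ 1 := by
  fin_cases β <;> fin_cases k <;> fin_cases j <;> simp [B]

theorem abs_imPart_single_le (a : Fin n × Fin 4) (x : Fin n × Fin 4 → ℝ) (β : Fin 3) :
    |imPart (Pi.single a 1) x β| ≤ 16 * n * ‖x‖ := by
  unfold imPart
  refine (Finset.abs_sum_le_sum_abs _ _).trans ?_
  have h : ∀ l : Fin n, |∑ k : Fin 4, ∑ j : Fin 4,
      (B β k j : ℝ) * (Pi.single a 1 : Fin n × Fin 4 → ℝ) (l, k) * x (l, j)| ≤ 16 * ‖x‖ := by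
    intro l
    refine (Finset.abs_sum_le_sum_abs _ _).trans ?_
    have h2 : ∀ k : Fin 4, |∑ j : Fin 4,
      (B β k j : ℝ) * (Pi.single a 1 : Fin n × Fin 4 → ℝ) (l, k) * x (l, j)| ≤ 4 * ‖x‖ := by
      intro k
      refine (Finset.abs_sum_le_sum_abs _ _).trans ?_
      refine (Finset.sum_le_card_nsmul _ _ ‖x‖ fun j _ => ?_).trans (by simp)
      rw [abs_mul, abs_mul]
      have h3 : |(Pi.single a 1 : Fin n × Fin 4 → ℝ) (l, k)| ≤ 1 := by
        rw [Pi.single_apply]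
        split_ifs <;> simp
      have h4 : |x (l, j)| ≤ ‖x‖ := norm_le_pi_norm x (l, j)
      calc _ ≤ 1 * 1 * ‖x‖ := by
            gcongr
            exact abs_B_le β k j
        _ = ‖x‖ := by ring
    refine (Finset.sum_le_card_nsmul _ _ _ fun k _ => h2 k).trans (le_of_eq ?_)
    simp
    ring
  refine (Finset.sum_le_card_nsmul _ _ _ fun l _ => h l).trans (le_of_eq ?_)
  simp
  ring

theorem fderiv_mul_central {u : (Fin n × Fin 4 → ℝ) → ℝ} {w : (Fin 3 → ℝ) → ℝ}
    (hu : ContDiff ℝ ∞ u) (hw : ContDiff ℝ ∞ w) (η : Heis n) (β : Fin 3) :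
    fderiv ℝ (fun η : Heis n => u η.1 * w η.2) η (centralVec β) =
      u η.1 * fderiv ℝ w η.2 (Pi.single β 1) := by
  have hd : DifferentiableAt ℝ (fun η : Heis n => u η.1 * w η.2) η :=
    (((hu.comp contDiff_fst).mul (hw.comp contDiff_snd)).differentiable (by simp)) η
  have h1 : HasLineDerivAt ℝ w (fderiv ℝ w η.2 (Pi.single β 1)) η.2 (Pi.single β 1) :=
    ((hw.differentiable (by simp)) η.2).hasFDerivAt.hasLineDerivAt _
  have h2 : HasLineDerivAt ℝ (fun η : Heis n => u η.1 * w η.2)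
      (u η.1 * fderiv ℝ w η.2 (Pi.single β 1)) η (centralVec β) := by
    unfold HasLineDerivAt at h1 ⊢
    simp only [add_fst', add_snd', smul_fst', smul_snd', centralVec, mk_fst, mk_snd, smul_zero,
      add_zero]
    exact h1.const_mul _
  exact (hd.hasFDerivAt.hasLineDerivAt _).unique h2

theorem integral_prod_coord (u : (Fin n × Fin 4 → ℝ) → ℝ) (w : (Fin 3 → ℝ) → ℝ) :
    ∫ η : Heis n, u η.1 * w η.2 = (∫ x, u x) * ∫ t, w t :=
  integral_prod_mul (μ := (volume : Measure (Fin n × Fin 4 → ℝ)))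
    (ν := (volume : Measure (Fin 3 → ℝ))) u w

/-- The commutator pairs a central derivative of `χ` with a weight linear in the horizontal
variable. Fixing the central bump at scale `r` first and then shrinking the horizontal one makes the
product small. -/
theorem exists_mollifier (n : ℕ) {r : ℝ} (hr : 0 < r) :
    ∃ χ : Heis n → ℝ, ContDiff ℝ ∞ χ ∧ HasCompactSupport χ ∧ (∀ η, 0 ≤ χ η) ∧ ∫ η, χ η = 1 ∧
      (∀ η, χ η ≠ 0 → ‖η‖ ≤ r) ∧ ∀ a, commSize χ a ≤ r := by
  let bw : ContDiffBump (0 : Fin 3 → ℝ) := ⟨r / 2, r, by positivity, by linarith⟩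
  set w : (Fin 3 → ℝ) → ℝ := bw.normed volume with hw
  have hws : ContDiff ℝ ∞ w := bw.contDiff_normed
  have hwc : HasCompactSupport w := bw.hasCompactSupport_normed
  set D : ℝ := ∑ β : Fin 3, ∫ t, |fderiv ℝ w t (Pi.single β 1)| with hD
  have hD0 : 0 ≤ D := Finset.sum_nonneg fun β _ => integral_nonneg fun t => abs_nonneg _
  -- The commutator is at most `4 · 16 n · ε · D` for horizontal radius `ε`. The `+ 1` keeps `K`
  -- positive and gives `ε ≤ r`.
  set K : ℝ := 64 * n * D + 1 with hK
  have hK0 : 0 < K := by positivity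
  set ε : ℝ := r / K with hε
  have hε0 : 0 < ε := by positivity
  have hεr : ε ≤ r := div_le_self hr.le (by rw [hK]; nlinarith [Nat.cast_nonneg (α := ℝ) n])
  let bu : ContDiffBump (0 : Fin n × Fin 4 → ℝ) := ⟨ε / 2, ε, by positivity, by linarith⟩
  set u : (Fin n × Fin 4 → ℝ) → ℝ := bu.normed volume with hu
  have hus : ContDiff ℝ ∞ u := bu.contDiff_normed
  have huc : HasCompactSupport u := bu.hasCompactSupport_normed
  have hu0 : ∀ x, 0 ≤ u x := bu.nonneg_normed
  have hw0 : ∀ x, 0 ≤ w x := bw.nonneg_normed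
  have hu1 : ∫ x, u x = 1 := bu.integral_normed
  have hw1 : ∫ x, w x = 1 := bw.integral_normed
  have hue : ∀ x, u x ≠ 0 → ‖x‖ ≤ ε := fun x hx => by
    have : x ∈ Function.support u := hx
    rw [hu, bu.support_normed_eq, mem_ball_zero_iff] at this
    exact this.le
  have hwe : ∀ x, w x ≠ 0 → ‖x‖ ≤ r := fun x hx => by
    have : x ∈ Function.support w := hx
    rw [hw, bw.support_normed_eq, mem_ball_zero_iff] at this
    exact this.le
  have hcpt : ∀ {v : (Fin 3 → ℝ) → ℝ}, HasCompactSupport v →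
      HasCompactSupport fun η : Heis n => u η.1 * v η.2 := fun {v} hv => by
    have hK : IsCompact {η : Heis n | η.1 ∈ tsupport u ∧ η.2 ∈ tsupport v} :=
      IsCompact.prod (X := Fin n × Fin 4 → ℝ) (Y := Fin 3 → ℝ) huc hv
    refine HasCompactSupport.intro hK fun η hη => ?_
    by_contra hne
    exact hη ⟨subset_tsupport _ (left_ne_zero_of_mul hne),
      subset_tsupport _ (right_ne_zero_of_mul hne)⟩
  refine ⟨fun η => u η.1 * w η.2, (hus.comp contDiff_fst).mul (hws.comp contDiff_snd), hcpt hwc,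
    fun η => mul_nonneg (hu0 _) (hw0 _), ?_, fun η hη => ?_, fun a => ?_⟩
  · rw [integral_prod_coord, hu1, hw1, mul_one]
  · have h1 := (hue _ (left_ne_zero_of_mul hη)).trans hεr
    have h2 := hwe _ (right_ne_zero_of_mul hη)
    exact max_le h1 h2
  · have hwd : ∀ β : Fin 3, Continuous fun t => fderiv ℝ w t (Pi.single β 1) := fun β =>
      (hws.continuous_fderiv (by simp)).clm_apply continuous_const
    have hwdc : ∀ β : Fin 3, HasCompactSupport fun t => fderiv ℝ w t (Pi.single β 1) :=
      fun β => hwc.fderiv_apply ℝ _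
    have hβ : ∀ β : Fin 3, ∫ η : Heis n,
        |fderiv ℝ (fun η : Heis n => u η.1 * w η.2) η (centralVec β) *
          (4 * imPart (Pi.single a 1) η.1 β)| ≤
        64 * n * ε * ∫ t, |fderiv ℝ w t (Pi.single β 1)| := by
      intro β
      have h1 : 64 * n * ε * ∫ t, |fderiv ℝ w t (Pi.single β 1)| =
          ∫ η : Heis n, 64 * n * ε * (u η.1 * |fderiv ℝ w η.2 (Pi.single β 1)|) := by
        rw [integral_const_mul, integral_prod_coord u fun t => |fderiv ℝ w t (Pi.single β 1)|, hu1,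
          one_mul]
      rw [h1]
      refine integral_mono_of_nonneg (Filter.Eventually.of_forall fun η => abs_nonneg _) ?_
        (Filter.Eventually.of_forall fun η => ?_)
      · refine Integrable.const_mul (continuous_integrable ?_
          (hcpt (v := fun t => |fderiv ℝ w t (Pi.single β 1)|) ?_)) _
        · exact ((hus.continuous.comp (contDiff_fst (m := 0)).continuous).mul
            ((hwd β).comp (contDiff_snd (m := 0)).continuous).abs)
        · exact (hwdc β).abs
      · simp only
        rw [fderiv_mul_central hus hws, abs_mul, abs_mul, abs_mul, abs_of_nonneg (hu0 _),
          abs_of_pos (by norm_num : (0 : ℝ) < 4)]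
        by_cases hx : u η.1 = 0
        · simp [hx]
        · have h2 := (abs_imPart_single_le a η.1 β).trans
            (mul_le_mul_of_nonneg_left (hue _ hx) (by positivity))
          calc _ ≤ u η.1 * |fderiv ℝ w η.2 (Pi.single β 1)| * (4 * (16 * n * ε)) := by
                refine mul_le_mul_of_nonneg_left ?_ (mul_nonneg (hu0 _) (abs_nonneg _))
                linarith
            _ = _ := by ring
    calc commSize (fun η : Heis n => u η.1 * w η.2) a ≤
          ∑ β : Fin 3, 64 * n * ε * ∫ t, |fderiv ℝ w t (Pi.single β 1)| :=
          Finset.sum_le_sum fun β _ => hβ β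
      _ = ε * (64 * n * D) := by rw [← Finset.mul_sum]; ring
      _ ≤ ε * K := mul_le_mul_of_nonneg_left (by rw [hK]; linarith) hε0.le
      _ = r := div_mul_cancel₀ _ hK0.ne'

/-- A bound for the first derivatives of a smooth function. -/
def derivBound (φ : Sm n) : ℝ := gradNorm φ + ∑ β, ‖emb (smT β φ)‖

theorem derivBound_nonneg (φ : Sm n) : 0 ≤ derivBound φ :=
  add_nonneg (Finset.sum_nonneg fun _ _ => norm_nonneg _)
    (Finset.sum_nonneg fun _ _ => norm_nonneg _)

theorem norm_smD_le (v : Heis n) (φ : Sm n) : ‖emb (smD v φ)‖ ≤ ‖v‖ * derivBound φ := by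
  have h : v = mk v.1 0 + mk 0 v.2 := ext' (fun a => by simp) (fun β => by simp)
  have h1 : ‖v.1‖ ≤ ‖v‖ := le_max_left _ _
  have h2 : ‖v.2‖ ≤ ‖v‖ := le_max_right _ _
  have e : smD v φ = (∑ a, (v.1 a : ℂ) • smY a φ) + ∑ β, (v.2 β : ℂ) • smT β φ := by
    rw [← smD_horizontal, ← smD_central, ← smD_add_left, ← h]
  rw [e, map_add, map_sum, map_sum, derivBound, gradNorm, mul_add, Finset.mul_sum, Finset.mul_sum]
  refine (norm_add_le _ _).trans (add_le_add ?_ ?_)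
  · refine (norm_sum_le _ _).trans (Finset.sum_le_sum fun a _ => ?_)
    rw [map_smul, norm_smul, Complex.norm_real]
    exact mul_le_mul_of_nonneg_right ((norm_le_pi_norm v.1 a).trans h1) (norm_nonneg _)
  · refine (norm_sum_le _ _).trans (Finset.sum_le_sum fun a _ => ?_)
    rw [map_smul, norm_smul, Complex.norm_real]
    exact mul_le_mul_of_nonneg_right ((norm_le_pi_norm v.2 a).trans h2) (norm_nonneg _)

/-- Weak convergence of the mollifications, with a rate: `χ` has unit mass and moves the test
function by translations of size at most `r`. -/
theorem norm_inner_smM_sub_le {χ : Heis n → ℝ} (hχ : ContDiff ℝ ∞ χ) (hc : HasCompactSupport χ)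
    (h0 : ∀ η, 0 ≤ χ η) (h1 : ∫ η, χ η = 1) {r : ℝ} (hr : ∀ η, χ η ≠ 0 → ‖η‖ ≤ r)
    (φ : Sm n) (g : HL n) :
    ‖inner ℂ (emb φ) (emb (smM hχ hc g)) - inner ℂ (emb φ) g‖ ≤ r * (derivBound φ * ‖g‖) := by
  have hi := continuous_integrable hχ.continuous hc
  have e : inner ℂ (emb φ) (emb (smM hχ hc g)) - inner ℂ (emb φ) g =
      ∫ η, (χ η : ℂ) * inner ℂ (emb (smR η⁻¹ φ) - emb φ) g := by
    have e1 : inner ℂ (emb φ) g = ∫ η, (χ η : ℂ) * inner ℂ (emb φ) g := by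
      rw [integral_mul_const, integral_complex_ofReal, h1]
      simp
    have hi' : Integrable fun η : Heis n => (χ η : ℂ) * inner ℂ (emb φ) g :=
      hi.ofReal.mul_const _
    rw [inner_smM]
    conv_lhs => rw [e1]
    rw [← integral_sub (integrable_mul_inner_smR hχ.continuous hc φ g) hi']
    refine integral_congr_ae (Filter.Eventually.of_forall fun η => ?_)
    simp only
    rw [inner_sub_left]
    ring
  rw [e]
  calc _ ≤ ∫ η, χ η * (r * (derivBound φ * ‖g‖)) := by
        refine norm_integral_le_of_norm_le (hi.mul_const _)
          (Filter.Eventually.of_forall fun η => ?_)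
        rw [norm_mul, Complex.norm_real, Real.norm_eq_abs, abs_of_nonneg (h0 η)]
        by_cases hη : χ η = 0
        · simp [hη]
        · refine mul_le_mul_of_nonneg_left ?_ (h0 η)
          refine (norm_inner_le_norm _ _).trans ?_
          rw [← mul_assoc]
          refine mul_le_mul_of_nonneg_right ?_ (norm_nonneg _)
          refine ((norm_smR_sub_le _ _).trans (norm_smD_le _ _)).trans ?_
          refine mul_le_mul_of_nonneg_right ?_ (derivBound_nonneg φ)
          rw [inv_eq_neg, norm_neg]
          exact hr η hη
    _ = _ := by rw [integral_mul_const, h1, one_mul]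

theorem inner_one_smM {χ : Heis n → ℝ} (hχ : ContDiff ℝ ∞ χ) (hc : HasCompactSupport χ)
    (g : HL n) (hg : inner ℂ (emb smOne) g = 0) :
    inner ℂ (emb smOne) (emb (smM hχ hc g)) = 0 := by
  rw [inner_smM]
  refine integral_eq_zero_of_ae (Filter.Eventually.of_forall fun η => ?_)
  have h : smR η⁻¹ (smOne : Sm n) = smOne := rfl
  simp only [h, hg, mul_zero, Pi.zero_apply]

/-- Smooth functions are total in the Hilbert space. -/
theorem eq_zero_of_inner_emb (g : HL n) (hg : ∀ φ : Sm n, inner ℂ (emb φ) g = 0) : g = 0 := by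
  have h1 : ∀ᵐ ξ : Heis n, lift g ξ = 0 := by
    refine ae_eq_zero_of_integral_contDiff_smul_eq_zero
      (locallyIntegrable_lift (integrable_HL g)) fun χ hχ hc => ?_
    -- The pairing of a mollification with itself reduces to pairings of `g` with smooth functions.
    -- Being continuous, the mollification then vanishes everywhere, and its value at the identity
    -- is `∫ χ · lift g`.
    have hM : emb (smM hχ hc g) = 0 := by
      rw [← inner_self_eq_zero (𝕜 := ℂ), inner_smM]
      exact integral_eq_zero_of_ae (Filter.Eventually.of_forall fun η => by simp [hg])
    have hM0 : ∀ᵐ q ∂(nilMeasure n), mollify χ g q = 0 := by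
      filter_upwards [coeFn_emb (smM hχ hc g), Lp.coeFn_zero ℂ 2 (nilMeasure n)] with q h1 h2
      rw [hM, h2] at h1
      exact h1.symm
    have hs : SmoothFun (mollify χ g) := smoothFun_mollify hχ hc (integrable_HL g)
    have hl : lift (mollify χ g) = fun _ => 0 :=
      (hs.continuous_lift.ae_eq_iff_eq (volume : Measure (Heis n)) continuous_const).1
        (ae_proj hM0)
    have h2 := congrFun hl 1
    simp only [lift, mollify, translate_proj, one_mul] at h2
    simpa only [Complex.real_smul, lift] using h2
  have h2 : ∀ᵐ q ∂(nilMeasure n), g q = 0 := by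
    exact (ae_map_iff measurable_proj.aemeasurable
      ((Lp.stronglyMeasurable g).measurable (measurableSet_singleton 0))).2 (ae_restrict_of_ae h1)
  exact (Lp.eq_zero_iff_ae_eq_zero).2 h2

/-! ### The algebra of the complex horizontal fields -/

theorem imPart_single (l l' : Fin n) (j k : Fin 4) (β : Fin 3) :
    imPart (Pi.single (l, j) 1) (Pi.single (l', k) 1) β = if l = l' then (B β j k : ℝ) else 0 := by
  unfold imPart
  rw [Finset.sum_eq_single l (fun m _ hm => by simp [hm]) (by simp),
    Finset.sum_eq_single j (fun m _ hm => by simp [hm]) (by simp),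
    Finset.sum_eq_single k (fun m _ hm => by simp [hm]) (by simp)]
  by_cases h : l = l'
  · simp [h]
  · simp [h]

theorem smD_comm (v w : Heis n) (φ : Sm n) :
    smD v (smD w φ) = smD w (smD v φ) + ∑ β, ((4 * imPart v.1 w.1 β : ℝ) : ℂ) • smT β φ := by
  rw [← smD_central, ← sub_eq_iff_eq_add']
  exact Subtype.ext (lieD_comm φ.2 v w)

theorem smY_comm_of_ne {l l' : Fin n} (h : l ≠ l') (j k : Fin 4) (φ : Sm n) :
    smY (l, j) (smY (l', k) φ) = smY (l', k) (smY (l, j) φ) := by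
  rw [smY, smY, smD_comm]
  simp [basisVec, imPart_single, h]

theorem smY_comm (l : Fin n) (j k : Fin 4) (φ : Sm n) :
    smY (l, j) (smY (l, k) φ) =
      smY (l, k) (smY (l, j) φ) + ∑ β, (4 * (B β j k : ℂ)) • smT β φ := by
  rw [smY, smY, smD_comm]
  simp [basisVec, imPart_single]

theorem smY_10 (l : Fin n) (φ : Sm n) :
    smY (l, 1) (smY (l, 0) φ) = smY (l, 0) (smY (l, 1) φ) + (4 : ℂ) • smT 0 φ := by
  rw [smY_comm]; simp [B, Fin.sum_univ_three]

theorem smY_20 (l : Fin n) (φ : Sm n) :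
    smY (l, 2) (smY (l, 0) φ) = smY (l, 0) (smY (l, 2) φ) + (4 : ℂ) • smT 1 φ := by
  rw [smY_comm]; simp [B, Fin.sum_univ_three]

theorem smY_30 (l : Fin n) (φ : Sm n) :
    smY (l, 3) (smY (l, 0) φ) = smY (l, 0) (smY (l, 3) φ) + (4 : ℂ) • smT 2 φ := by
  rw [smY_comm]; simp [B, Fin.sum_univ_three]

theorem smY_21 (l : Fin n) (φ : Sm n) :
    smY (l, 2) (smY (l, 1) φ) = smY (l, 1) (smY (l, 2) φ) + (4 : ℂ) • smT 2 φ := by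
  rw [smY_comm]; simp [B, Fin.sum_univ_three]

theorem smY_31 (l : Fin n) (φ : Sm n) :
    smY (l, 3) (smY (l, 1) φ) = smY (l, 1) (smY (l, 3) φ) + (-4 : ℂ) • smT 1 φ := by
  rw [smY_comm]; simp [B, Fin.sum_univ_three]

theorem smY_32 (l : Fin n) (φ : Sm n) :
    smY (l, 3) (smY (l, 2) φ) = smY (l, 2) (smY (l, 3) φ) + (4 : ℂ) • smT 0 φ := by
  rw [smY_comm]; simp [B, Fin.sum_univ_three]

/-- The field `Z_A^{A'}` on smooth functions. -/
def smZ (A : Fin n × Fin 2) (A' : Fin 2) : Sm n →ₗ[ℂ] Sm n :=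
  match A.2, A' with
  | 0, 0 => -smY (A.1, 2) - Complex.I • smY (A.1, 3)
  | 0, 1 => -smY (A.1, 0) - Complex.I • smY (A.1, 1)
  | 1, 0 => smY (A.1, 0) - Complex.I • smY (A.1, 1)
  | 1, 1 => -smY (A.1, 2) + Complex.I • smY (A.1, 3)

/-- The complex conjugate of the field `Z_A^{A'}` on smooth functions. -/
def smW (A : Fin n × Fin 2) (A' : Fin 2) : Sm n →ₗ[ℂ] Sm n :=
  match A.2, A' with
  | 0, 0 => -smY (A.1, 2) + Complex.I • smY (A.1, 3)
  | 0, 1 => -smY (A.1, 0) + Complex.I • smY (A.1, 1)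
  | 1, 0 => smY (A.1, 0) + Complex.I • smY (A.1, 1)
  | 1, 1 => -smY (A.1, 2) - Complex.I • smY (A.1, 3)

theorem smZ_00 (l : Fin n) (φ : Sm n) :
    smZ (l, 0) 0 φ = -smY (l, 2) φ - Complex.I • smY (l, 3) φ := rfl
theorem smZ_01 (l : Fin n) (φ : Sm n) :
    smZ (l, 0) 1 φ = -smY (l, 0) φ - Complex.I • smY (l, 1) φ := rfl
theorem smZ_10 (l : Fin n) (φ : Sm n) :
    smZ (l, 1) 0 φ = smY (l, 0) φ - Complex.I • smY (l, 1) φ := rfl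
theorem smZ_11 (l : Fin n) (φ : Sm n) :
    smZ (l, 1) 1 φ = -smY (l, 2) φ + Complex.I • smY (l, 3) φ := rfl
theorem smW_00 (l : Fin n) (φ : Sm n) :
    smW (l, 0) 0 φ = -smY (l, 2) φ + Complex.I • smY (l, 3) φ := rfl
theorem smW_01 (l : Fin n) (φ : Sm n) :
    smW (l, 0) 1 φ = -smY (l, 0) φ + Complex.I • smY (l, 1) φ := rfl
theorem smW_10 (l : Fin n) (φ : Sm n) :
    smW (l, 1) 0 φ = smY (l, 0) φ + Complex.I • smY (l, 1) φ := rfl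
theorem smW_11 (l : Fin n) (φ : Sm n) :
    smW (l, 1) 1 φ = -smY (l, 2) φ - Complex.I • smY (l, 3) φ := rfl

/-- The commutator of `smW (l, α) A'` and `smZ (l, β) A'`. -/
def smC (α β : Fin 2) : Sm n →ₗ[ℂ] Sm n :=
  match α, β with
  | 0, 0 => (-8 * Complex.I) • smT 0
  | 0, 1 => (-8 : ℂ) • smT 1 + (8 * Complex.I) • smT 2
  | 1, 0 => (8 : ℂ) • smT 1 + (8 * Complex.I) • smT 2
  | 1, 1 => (8 * Complex.I) • smT 0

theorem smC_00 (φ : Sm n) : smC 0 0 φ = (-8 * Complex.I) • smT 0 φ := rfl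
theorem smC_01 (φ : Sm n) :
    smC 0 1 φ = (-8 : ℂ) • smT 1 φ + (8 * Complex.I) • smT 2 φ := rfl
theorem smC_10 (φ : Sm n) :
    smC 1 0 φ = (8 : ℂ) • smT 1 φ + (8 * Complex.I) • smT 2 φ := rfl
theorem smC_11 (φ : Sm n) : smC 1 1 φ = (8 * Complex.I) • smT 0 φ := rfl

theorem smW_smZ_of_ne {l l' : Fin n} (h : l ≠ l') (α β A' B' : Fin 2) (φ : Sm n) :
    smW (l, α) A' (smZ (l', β) B' φ) = smZ (l', β) B' (smW (l, α) A' φ) := by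
  fin_cases α <;> fin_cases β <;> fin_cases A' <;> fin_cases B' <;>
  · simp only [Fin.zero_eta, Fin.mk_one, smZ_00, smZ_01, smZ_10, smZ_11, smW_00, smW_01, smW_10,
      smW_11, map_add, map_sub, map_neg, map_smul, smY_comm_of_ne h]
    module

theorem smZ_smZ_of_ne {l l' : Fin n} (h : l ≠ l') (α β A' B' : Fin 2) (φ : Sm n) :
    smZ (l, α) A' (smZ (l', β) B' φ) = smZ (l', β) B' (smZ (l, α) A' φ) := by
  fin_cases α <;> fin_cases β <;> fin_cases A' <;> fin_cases B' <;>
  · simp only [Fin.zero_eta, Fin.mk_one, smZ_00, smZ_01, smZ_10, smZ_11,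
      map_add, map_sub, map_neg, map_smul, smY_comm_of_ne h]
    module

theorem I_smul_I_smul (φ : Sm n) : Complex.I • Complex.I • φ = -φ := by
  rw [smul_smul, Complex.I_mul_I, neg_smul, one_smul]

/-- The quaternion relations cancel the commutator when the primed indices differ. Otherwise it
depends neither on `A'` nor on `l`; independence of `l` is what the averaging in `smC_lower_bound`
exploits. -/
theorem smW_smZ (l : Fin n) (α β A' B' : Fin 2) (φ : Sm n) :
    smW (l, α) A' (smZ (l, β) B' φ) =
      smZ (l, β) B' (smW (l, α) A' φ) + if A' = B' then smC α β φ else 0 := by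
  fin_cases α <;> fin_cases β <;> fin_cases A' <;> fin_cases B' <;>
  · simp only [Fin.zero_eta, Fin.mk_one, smZ_00, smZ_01, smZ_10, smZ_11, smW_00, smW_01, smW_10,
      smW_11, smC_00, smC_01, smC_10, smC_11, map_add, map_sub, map_neg, map_smul,
      smY_10, smY_20, smY_30, smY_21, smY_31, smY_32, smul_add, smul_sub, smul_neg,
      I_smul_I_smul, if_true, zero_ne_one, one_ne_zero, if_false]
    module

theorem smZ_smZ (l : Fin n) (α β : Fin 2) (φ : Sm n) :
    smZ (l, α) 0 (smZ (l, β) 0 φ) = smZ (l, β) 0 (smZ (l, α) 0 φ) ∧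
    smZ (l, α) 1 (smZ (l, β) 1 φ) = smZ (l, β) 1 (smZ (l, α) 1 φ) ∧
    smZ (l, α) 0 (smZ (l, β) 1 φ) + smZ (l, α) 1 (smZ (l, β) 0 φ) =
      smZ (l, β) 0 (smZ (l, α) 1 φ) + smZ (l, β) 1 (smZ (l, α) 0 φ) := by
  fin_cases α <;> fin_cases β <;> refine ⟨?_, ?_, ?_⟩ <;>
  · simp only [Fin.zero_eta, Fin.mk_one, smZ_00, smZ_01, smZ_10, smZ_11,
      map_add, map_sub, map_neg, map_smul,
      smY_10, smY_20, smY_30, smY_21, smY_31, smY_32, smul_add, smul_sub, smul_neg,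
      I_smul_I_smul]
    try module

/-- The fields with equal primed indices commute, and those with different primed indices commute
after symmetrisation. -/
theorem smZ_comm (A A₁ : Fin n × Fin 2) (φ : Sm n) :
    smZ A 0 (smZ A₁ 0 φ) = smZ A₁ 0 (smZ A 0 φ) ∧
    smZ A 1 (smZ A₁ 1 φ) = smZ A₁ 1 (smZ A 1 φ) ∧
    smZ A 0 (smZ A₁ 1 φ) + smZ A 1 (smZ A₁ 0 φ) =
      smZ A₁ 0 (smZ A 1 φ) + smZ A₁ 1 (smZ A 0 φ) := by
  obtain ⟨l, α⟩ := A
  obtain ⟨l', β⟩ := A₁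
  by_cases h : l = l'
  · subst h
    exact smZ_smZ l α β φ
  · refine ⟨smZ_smZ_of_ne h _ _ _ _ _, smZ_smZ_of_ne h _ _ _ _ _, ?_⟩
    rw [smZ_smZ_of_ne h, smZ_smZ_of_ne h, add_comm]

/-- Conjugate transpose times block is scalar, as for the matrix of a quaternion, and here all
central terms cancel. In the opposite order, `sum_smZ_smW`, they survive as `smC`. -/
theorem sum_smW_smZ (l : Fin n) (A' B' : Fin 2) (φ : Sm n) :
    ∑ α, smW (l, α) A' (smZ (l, α) B' φ) =
      if A' = B' then ∑ j, smY (l, j) (smY (l, j) φ) else 0 := by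
  fin_cases A' <;> fin_cases B' <;>
  · simp only [Fin.sum_univ_two, Fin.sum_univ_four,
      Fin.zero_eta, Fin.mk_one, smZ_00, smZ_01, smZ_10, smZ_11, smW_00, smW_01, smW_10,
      smW_11, map_add, map_sub, map_neg, map_smul,
      smY_10, smY_20, smY_30, smY_21, smY_31, smY_32, smul_add, smul_sub, smul_neg,
      I_smul_I_smul, if_true, zero_ne_one, one_ne_zero, if_false]
    module

theorem sum_smZ_smW (l : Fin n) (α β : Fin 2) (φ : Sm n) :
    ∑ A', smZ (l, β) A' (smW (l, α) A' φ) =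
      (if α = β then ∑ j, smY (l, j) (smY (l, j) φ) else 0) - smC α β φ := by
  fin_cases α <;> fin_cases β <;>
  · simp only [Fin.sum_univ_two, Fin.sum_univ_four,
      Fin.zero_eta, Fin.mk_one, smZ_00, smZ_01, smZ_10, smZ_11, smW_00, smW_01, smW_10,
      smW_11, smC_00, smC_01, smC_10, smC_11, map_add, map_sub, map_neg, map_smul,
      smY_10, smY_20, smY_30, smY_21, smY_31, smY_32, smul_add, smul_sub, smul_neg,
      I_smul_I_smul, if_true, zero_ne_one, one_ne_zero, if_false]
    module

/-! ### Integration by parts -/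

theorem inner_smZ (A : Fin n × Fin 2) (A' : Fin 2) (φ ψ : Sm n) :
    inner ℂ (emb (smZ A A' φ)) (emb ψ) = -inner ℂ (emb φ) (emb (smW A A' ψ)) := by
  obtain ⟨l, α⟩ := A
  fin_cases α <;> fin_cases A' <;>
  · simp only [Fin.zero_eta, Fin.mk_one, smZ_00, smZ_01, smZ_10, smZ_11, smW_00, smW_01, smW_10,
      smW_11, smY, map_add, map_sub, map_neg, map_smul, inner_add_left, inner_sub_left,
      inner_neg_left, inner_smul_left, inner_add_right, inner_sub_right, inner_neg_right,
      inner_smul_right, inner_smD, Complex.conj_I]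
    ring

theorem inner_smW (A : Fin n × Fin 2) (A' : Fin 2) (φ ψ : Sm n) :
    inner ℂ (emb (smW A A' φ)) (emb ψ) = -inner ℂ (emb φ) (emb (smZ A A' ψ)) := by
  rw [← inner_conj_symm, ← neg_eq_iff_eq_neg.2 (inner_smZ A A' ψ φ), map_neg, inner_conj_symm]

theorem sum_inner_smZ_smZ (A' B' : Fin 2) (φ ψ : Sm n) :
    ∑ A, inner ℂ (emb (smZ A A' φ)) (emb (smZ A B' ψ)) =
      if A' = B' then ∑ a, inner ℂ (emb (smY a φ)) (emb (smY a ψ)) else 0 := by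
  have h : ∀ l : Fin n, ∑ α, inner ℂ (emb (smZ (l, α) A' φ)) (emb (smZ (l, α) B' ψ)) =
      if A' = B' then ∑ j, inner ℂ (emb (smY (l, j) φ)) (emb (smY (l, j) ψ)) else 0 := by
    intro l
    simp only [inner_smZ, Finset.sum_neg_distrib, ← inner_sum, ← map_sum, sum_smW_smZ]
    split_ifs
    · simp only [smY, inner_smD, map_sum, inner_sum, Finset.sum_neg_distrib]
    · simp
  rw [Fintype.sum_prod_type]
  simp only [h]
  split_ifs
  · rw [Fintype.sum_prod_type]
  · simp

/-- Two integrations by parts exchange the fields, at the price of their commutator. -/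
theorem inner_smZ_smZ (A A₁ : Fin n × Fin 2) (A' B' : Fin 2) (φ ψ : Sm n) :
    inner ℂ (emb (smZ A A' φ)) (emb (smZ A₁ B' ψ)) =
      inner ℂ (emb (smW A₁ B' φ)) (emb (smW A A' ψ)) -
        if A.1 = A₁.1 then (if A' = B' then inner ℂ (emb φ) (emb (smC A.2 A₁.2 ψ)) else 0)
          else 0 := by
  obtain ⟨l, α⟩ := A
  obtain ⟨l', β⟩ := A₁
  rw [inner_smZ, inner_smW]
  simp only
  split_ifs with h1 h2
  · subst h1
    rw [smW_smZ, if_pos h2, map_add, inner_add_right]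
    ring
  · subst h1
    rw [smW_smZ, if_neg h2, add_zero, sub_zero]
  · rw [smW_smZ_of_ne h1, sub_zero]

theorem sum_inner_smW_smW (l : Fin n) (α β : Fin 2) (φ ψ : Sm n) :
    ∑ A', inner ℂ (emb (smW (l, β) A' φ)) (emb (smW (l, α) A' ψ)) =
      (if α = β then ∑ j, inner ℂ (emb (smY (l, j) φ)) (emb (smY (l, j) ψ)) else 0) +
        inner ℂ (emb φ) (emb (smC α β ψ)) := by
  simp only [inner_smW, Finset.sum_neg_distrib, ← inner_sum, ← map_sum, sum_smZ_smW]
  rw [map_sub, inner_sub_right, neg_sub, sub_eq_neg_add]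
  congr 1
  split_ifs
  · simp only [smY, inner_smD, map_sum, inner_sum, Finset.sum_neg_distrib]
  · simp

/-! ### The basic estimate for smooth functions -/

/-- The derivatives `∑_{A'} Z_A^{A'} f_{B A'}`. -/
def zDeriv (f : Fin n × Fin 2 → Fin 2 → Sm n) (A₁ A₂ : Fin n × Fin 2) : Sm n :=
  ∑ A', smZ A₁ A' (f A₂ A')

/-- The conjugate divergence `∑_A W_A^{C'} f_A`. -/
def wDiv (f : Fin n × Fin 2 → Sm n) (C' : Fin 2) : Sm n := ∑ A, smW A C' (f A)

theorem sum_inner_zDeriv_self (f : Fin n × Fin 2 → Fin 2 → Sm n) :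
    ∑ A₁, ∑ A₂, inner ℂ (emb (zDeriv f A₁ A₂)) (emb (zDeriv f A₁ A₂)) =
      ∑ A₂, ∑ A', ∑ a, inner ℂ (emb (smY a (f A₂ A'))) (emb (smY a (f A₂ A'))) := by
  rw [Finset.sum_comm]
  refine Finset.sum_congr rfl fun A₂ _ => ?_
  simp only [zDeriv, map_sum, sum_inner, inner_sum]
  rw [Finset.sum_comm]
  refine Finset.sum_congr rfl fun A' _ => ?_
  rw [Finset.sum_comm]
  simp only [sum_inner_smZ_smZ]
  simp

/-- This is the cross term in the square of the antisymmetrised derivative: exchanging the fields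
exposes divergences, which vanish for coclosed tuples, and leaves a central term. -/
theorem sum_inner_zDeriv_swap (f : Fin n × Fin 2 → Fin 2 → Sm n) :
    ∑ A₁, ∑ A₂, inner ℂ (emb (zDeriv f A₁ A₂)) (emb (zDeriv f A₂ A₁)) =
      (∑ A', ∑ B', inner ℂ (emb (wDiv (fun A => f A A') B')) (emb (wDiv (fun A => f A B') A'))) -
        ∑ A', ∑ l, ∑ α, ∑ β,
          inner ℂ (emb (f (l, β) A')) (emb (smC α β (f (l, α) A'))) := by
  have h1 : ∀ A₁ A₂, inner ℂ (emb (zDeriv f A₁ A₂)) (emb (zDeriv f A₂ A₁)) =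
      ∑ A', ∑ B', (inner ℂ (emb (smW A₂ B' (f A₂ A'))) (emb (smW A₁ A' (f A₁ B'))) -
        if A₁.1 = A₂.1 then
          (if A' = B' then inner ℂ (emb (f A₂ A')) (emb (smC A₁.2 A₂.2 (f A₁ B'))) else 0)
          else 0) := by
    intro A₁ A₂
    simp only [zDeriv, map_sum, sum_inner, inner_sum, inner_smZ_smZ]
    rw [Finset.sum_comm]
  simp only [h1, Finset.sum_sub_distrib]
  congr 1
  · simp only [wDiv, map_sum, sum_inner, inner_sum]
    simp only [Finset.sum_comm (s := (Finset.univ : Finset (Fin n × Fin 2)))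
      (t := (Finset.univ : Finset (Fin 2)))]
  · simp only [Finset.sum_comm (s := (Finset.univ : Finset (Fin n × Fin 2)))
      (t := (Finset.univ : Finset (Fin 2)))]
    refine Finset.sum_congr rfl fun A' _ => ?_
    simp only [Fintype.sum_prod_type, Fin.sum_univ_two]
    fin_cases A' <;> simp [Finset.sum_add_distrib]

theorem re_inner_self_emb (φ : Sm n) : (inner ℂ (emb φ) (emb φ)).re = ‖emb φ‖ ^ 2 := by
  rw [inner_self_eq_norm_sq_to_K]
  norm_cast

/-- For every `l` the squares `‖∑ α, W_{(l,α)} F α‖²`, summed over the primed index, equal the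
energy of `F` in the directions of the variable `l` plus the same central form. Positivity for all
`l`, summed, bounds `n` copies of that form by one full energy. -/
theorem smC_lower_bound (F : Fin 2 → Sm n) :
    -∑ α, ∑ a, ‖emb (smY a (F α))‖ ^ 2 ≤
      n * (∑ α, ∑ β, inner ℂ (emb (F β)) (emb (smC α β (F α)))).re := by
  have h : ∀ l : Fin n, -∑ α, ∑ j, ‖emb (smY (l, j) (F α))‖ ^ 2 ≤
      (∑ α, ∑ β, inner ℂ (emb (F β)) (emb (smC α β (F α)))).re := by
    intro l
    have h1 : ∑ A', inner ℂ (emb (∑ α, smW (l, α) A' (F α))) (emb (∑ α, smW (l, α) A' (F α))) =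
        (∑ α, ∑ j, inner ℂ (emb (smY (l, j) (F α))) (emb (smY (l, j) (F α)))) +
        ∑ α, ∑ β, inner ℂ (emb (F β)) (emb (smC α β (F α))) := by
      have h00 := sum_inner_smW_smW l 0 0 (F 0) (F 0)
      have h01 := sum_inner_smW_smW l 0 1 (F 1) (F 0)
      have h10 := sum_inner_smW_smW l 1 0 (F 0) (F 1)
      have h11 := sum_inner_smW_smW l 1 1 (F 1) (F 1)
      simp only [Fin.sum_univ_two, if_true, zero_ne_one, one_ne_zero, if_false, map_add,
        inner_add_left, inner_add_right] at h00 h01 h10 h11 ⊢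
      linear_combination h00 + h01 + h10 + h11
    have h2 := congrArg Complex.re h1
    rw [Complex.add_re] at h2
    simp only [Complex.re_sum, re_inner_self_emb] at h2 ⊢
    have h3 : 0 ≤ ∑ A', ‖emb (∑ α, smW (l, α) A' (F α))‖ ^ 2 :=
      Finset.sum_nonneg fun _ _ => sq_nonneg _
    linarith
  have h4 := Finset.sum_le_sum fun l (_ : l ∈ Finset.univ) => h l
  rw [Finset.sum_const, Finset.card_univ, Fintype.card_fin, nsmul_eq_mul,
    Finset.sum_neg_distrib] at h4
  refine le_trans (le_of_eq ?_) h4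
  rw [Finset.sum_comm]
  simp only [Fintype.sum_prod_type]
  exact congrArg _ (Finset.sum_congr rfl fun l _ => Finset.sum_comm)

/-- With `G` the energy, `P` the divergence products and `X` the central term, the antisymmetrised
square is `2G - 2 (Re P - Re X)`. Multiply by `n` and insert `n Re X ≥ -G`. -/
theorem basic_estimate (f : Fin n × Fin 2 → Fin 2 → Sm n) :
    2 * (n - 1) * ∑ A, ∑ A', ∑ a, ‖emb (smY a (f A A'))‖ ^ 2 ≤
      n * (∑ A₁, ∑ A₂, ‖emb (zDeriv f A₁ A₂ - zDeriv f A₂ A₁)‖ ^ 2 +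
        2 * ∑ A', ∑ B', ‖emb (wDiv (fun A => f A A') B')‖ * ‖emb (wDiv (fun A => f A B') A')‖) := by
  set G := ∑ A, ∑ A', ∑ a, ‖emb (smY a (f A A'))‖ ^ 2 with hG
  set X := ∑ A', ∑ l, ∑ α, ∑ β, inner ℂ (emb (f (l, β) A')) (emb (smC α β (f (l, α) A')))
    with hX
  set P := ∑ A', ∑ B', inner ℂ (emb (wDiv (fun A => f A A') B'))
    (emb (wDiv (fun A => f A B') A')) with hP
  have h1 : ∑ A₁, ∑ A₂, ‖emb (zDeriv f A₁ A₂ - zDeriv f A₂ A₁)‖ ^ 2 =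
      2 * G - 2 * (P.re - X.re) := by
    have e1 := congrArg Complex.re (sum_inner_zDeriv_self f)
    have e2 := congrArg Complex.re (sum_inner_zDeriv_swap f)
    simp only [Complex.re_sum, re_inner_self_emb] at e1
    rw [Complex.sub_re] at e2
    have e3 : ∀ A₁ A₂, ‖emb (zDeriv f A₁ A₂ - zDeriv f A₂ A₁)‖ ^ 2 =
        ‖emb (zDeriv f A₁ A₂)‖ ^ 2 + ‖emb (zDeriv f A₂ A₁)‖ ^ 2 -
          2 * (inner ℂ (emb (zDeriv f A₁ A₂)) (emb (zDeriv f A₂ A₁))).re := by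
      intro A₁ A₂
      rw [map_sub, norm_sub_sq (𝕜 := ℂ)]
      simp only [RCLike.re_eq_complex_re]
      ring
    simp only [e3, Finset.sum_sub_distrib, Finset.sum_add_distrib, ← Finset.mul_sum]
    rw [Finset.sum_comm (f := fun A₁ A₂ => ‖emb (zDeriv f A₂ A₁)‖ ^ 2), e1]
    simp only [Complex.re_sum] at e2
    rw [e2]
    simp only [hP, hX, hG, Complex.re_sum]
    ring
  have h2 : -G ≤ n * X.re := by
    have e : ∀ A' l, -∑ α, ∑ a, ‖emb (smY a (f (l, α) A'))‖ ^ 2 ≤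
      n * (∑ α, ∑ β, inner ℂ (emb (f (l, β) A')) (emb (smC α β (f (l, α) A')))).re :=
      fun A' l => smC_lower_bound fun α => f (l, α) A'
    have e2 := Finset.sum_le_sum fun A' (_ : A' ∈ (Finset.univ : Finset (Fin 2))) =>
      Finset.sum_le_sum fun l (_ : l ∈ (Finset.univ : Finset (Fin n))) => e A' l
    simp only [Finset.sum_neg_distrib, ← Finset.mul_sum, ← Complex.re_sum] at e2
    refine le_trans (le_of_eq ?_) e2
    rw [hG, Finset.sum_comm]
    simp only [Fintype.sum_prod_type]
  have h3 : P.re ≤ ∑ A', ∑ B', ‖emb (wDiv (fun A => f A A') B')‖ *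
      ‖emb (wDiv (fun A => f A B') A')‖ := by
    rw [hP]
    simp only [Complex.re_sum]
    refine Finset.sum_le_sum fun A' _ => Finset.sum_le_sum fun B' _ => ?_
    exact (Complex.re_le_norm _).trans (norm_inner_le_norm _ _)
  rw [h1]
  have hn : (0 : ℝ) ≤ n := Nat.cast_nonneg n
  nlinarith [mul_le_mul_of_nonneg_left h3 hn]

/-! ### Uniqueness for the first order system -/

theorem exists_coeff (A : Fin n × Fin 2) (A' : Fin 2) :
    ∃ c : Fin n × Fin 4 → ℂ, (∀ φ, smZ A A' φ = ∑ a, c a • smY a φ) ∧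
      ∀ φ, smW A A' φ = ∑ a, (starRingEnd ℂ) (c a) • smY a φ := by
  obtain ⟨l, α⟩ := A
  have h : ∀ (x y : ℂ) (j k : Fin 4) (φ : Sm n),
      ∑ a, (Pi.single (l, j) x + Pi.single (l, k) y : Fin n × Fin 4 → ℂ) a • smY a φ =
        x • smY (l, j) φ + y • smY (l, k) φ := by
    intro x y j k φ
    simp only [Pi.add_apply, add_smul, Finset.sum_add_distrib]
    rw [Finset.sum_eq_single (l, j) (fun a _ ha => by simp [ha]) (by simp),
      Finset.sum_eq_single (l, k) (fun a _ ha => by simp [ha]) (by simp)]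
    simp
  have h' : ∀ (x y : ℂ) (j k : Fin 4) (φ : Sm n),
      ∑ a, (starRingEnd ℂ) ((Pi.single (l, j) x + Pi.single (l, k) y : Fin n × Fin 4 → ℂ) a) •
        smY a φ = (starRingEnd ℂ) x • smY (l, j) φ + (starRingEnd ℂ) y • smY (l, k) φ := by
    intro x y j k φ
    rw [← h]
    refine Finset.sum_congr rfl fun a _ => ?_
    simp only [Pi.add_apply, map_add]
    congr 2
    · by_cases ha : a = (l, j)
      · subst ha; simp
      · simp [ha]
    · by_cases ha : a = (l, k)
      · subst ha; simp
      · simp [ha]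
  fin_cases α <;> fin_cases A'
  · refine ⟨Pi.single (l, 2) (-1) + Pi.single (l, 3) (-Complex.I), fun φ => ?_, fun φ => ?_⟩
    · simp only [Fin.zero_eta, h, smZ_00]; module
    · simp only [Fin.zero_eta, h', smW_00, map_neg, map_one, Complex.conj_I]; module
  · refine ⟨Pi.single (l, 0) (-1) + Pi.single (l, 1) (-Complex.I), fun φ => ?_, fun φ => ?_⟩
    · simp only [Fin.zero_eta, Fin.mk_one, h, smZ_01]; module
    · simp only [Fin.zero_eta, Fin.mk_one, h', smW_01, map_neg, map_one, Complex.conj_I]; module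
  · refine ⟨Pi.single (l, 0) 1 + Pi.single (l, 1) (-Complex.I), fun φ => ?_, fun φ => ?_⟩
    · simp only [Fin.zero_eta, Fin.mk_one, h, smZ_10]; module
    · simp only [Fin.zero_eta, Fin.mk_one, h', smW_10, map_neg, map_one, Complex.conj_I]; module
  · refine ⟨Pi.single (l, 2) (-1) + Pi.single (l, 3) Complex.I, fun φ => ?_, fun φ => ?_⟩
    · simp only [Fin.mk_one, h, smZ_11]; module
    · simp only [Fin.mk_one, h', smW_11, map_neg, map_one, Complex.conj_I]; module

theorem norm_sum_field_smM_le {J : Type*} [Fintype J] (c : J → Fin n × Fin 4 → ℂ)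
    (X X' : J → Sm n → Sm n) (hX : ∀ j φ, X j φ = ∑ a, c j a • smY a φ)
    (hX' : ∀ j φ, X' j φ = ∑ a, (starRingEnd ℂ) (c j a) • smY a φ) (g : J → HL n)
    (hw : ∀ φ : Sm n, ∑ j, inner ℂ (emb (X j φ)) (g j) = 0)
    {χ : Heis n → ℝ} (hχ : ContDiff ℝ ∞ χ) (hc : HasCompactSupport χ) {r : ℝ}
    (hr : ∀ a, commSize χ a ≤ r) :
    ‖emb (∑ j, X' j (smM hχ hc (g j)))‖ ≤ r * ∑ j, ∑ a, ‖c j a‖ * ‖g j‖ := by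
  have h := norm_sum_smY_smM_le hχ hc (I := J × (Fin n × Fin 4))
    (fun p => (starRingEnd ℂ) (c p.1 p.2)) (fun p => p.2) (fun p => g p.1) (fun φ => by
      rw [← hw φ, Fintype.sum_prod_type]
      refine Finset.sum_congr rfl fun j _ => ?_
      simp only [hX, map_sum, map_smul, sum_inner, inner_smul_left])
  rw [Fintype.sum_prod_type, Fintype.sum_prod_type] at h
  simp only [← hX'] at h
  refine h.trans ?_
  rw [Finset.mul_sum]
  refine Finset.sum_le_sum fun j _ => ?_
  rw [Finset.mul_sum]
  refine Finset.sum_le_sum fun a _ => ?_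
  rw [RCLike.norm_conj, mul_comm ‖c j a‖, mul_assoc]
  exact mul_le_mul_of_nonneg_right (hr a) (by positivity)

/-- The mollified tuple satisfies the two systems up to `O(r)`, so the basic estimate and Poincaré
give it norm `O(r)`; yet it converges weakly to `g` as `r` tends to zero. -/
theorem eq_zero_of_weak (hn : 2 ≤ n) (g : Fin n × Fin 2 → Fin 2 → HL n)
    (hm : ∀ A A', inner ℂ (emb smOne) (g A A') = 0)
    (hdiv : ∀ A' C' (φ : Sm n), ∑ A, inner ℂ (emb (smZ A C' φ)) (g A A') = 0)
    (hcl : ∀ A₁ A₂ (φ : Sm n), ∑ A', (inner ℂ (emb (smW A₁ A' φ)) (g A₂ A') -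
      inner ℂ (emb (smW A₂ A' φ)) (g A₁ A')) = 0) (A : Fin n × Fin 2) (A' : Fin 2) :
    g A A' = 0 := by
  choose c hZ hW using exists_coeff (n := n)
  have hconj : ∀ A A' φ, smZ A A' φ =
      ∑ a, (starRingEnd ℂ) ((starRingEnd ℂ) (c A A' a)) • smY a φ := fun A A' φ => by
    simp only [Complex.conj_conj, hZ]
  have hK1 : ∀ A' C', ∃ K, ∀ {χ : Heis n → ℝ} (hχ : ContDiff ℝ ∞ χ) (hc : HasCompactSupport χ)
      {r : ℝ}, (∀ a, commSize χ a ≤ r) →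
      ‖emb (wDiv (fun A => smM hχ hc (g A A')) C')‖ ≤ r * K := fun A' C' =>
    ⟨_, fun hχ hc r hr => norm_sum_field_smM_le (fun A => c A C') (fun A => smZ A C')
      (fun A => smW A C') (fun A φ => hZ A C' φ) (fun A φ => hW A C' φ) (fun A => g A A')
      (hdiv A' C') hχ hc hr⟩
  have hK2 : ∀ A₁ A₂, ∃ K, ∀ {χ : Heis n → ℝ} (hχ : ContDiff ℝ ∞ χ) (hc : HasCompactSupport χ)
      {r : ℝ}, (∀ a, commSize χ a ≤ r) →
      ‖emb (zDeriv (fun A A' => smM hχ hc (g A A')) A₁ A₂ -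
        zDeriv (fun A A' => smM hχ hc (g A A')) A₂ A₁)‖ ≤ r * K := by
    intro A₁ A₂
    -- The two summands of `Fin 2 ⊕ Fin 2` carry the two halves of the antisymmetrisation. The test
    -- side uses `smW`, hence the conjugated coefficients.
    have h := fun (χ : Heis n → ℝ) (hχ : ContDiff ℝ ∞ χ) (hc : HasCompactSupport χ) (r : ℝ)
      (hr : ∀ a, commSize χ a ≤ r) => norm_sum_field_smM_le (J := Fin 2 ⊕ Fin 2)
      (Sum.elim (fun A' a => (starRingEnd ℂ) (c A₁ A' a))
        (fun A' a => -(starRingEnd ℂ) (c A₂ A' a)))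
      (Sum.elim (fun A' => smW A₁ A') (fun A' φ => -smW A₂ A' φ))
      (Sum.elim (fun A' => smZ A₁ A') (fun A' φ => -smZ A₂ A' φ))
      (by
        rintro (A' | A') φ
        · exact hW A₁ A' φ
        · simp only [Sum.elim_inr, hW]
          rw [← Finset.sum_neg_distrib]
          exact Finset.sum_congr rfl fun a _ => (neg_smul _ _).symm)
      (by
        rintro (A' | A') φ
        · exact hconj A₁ A' φ
        · simp only [Sum.elim_inr, hconj A₂]
          rw [← Finset.sum_neg_distrib]
          refine Finset.sum_congr rfl fun a _ => ?_
          rw [map_neg]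
          exact (neg_smul _ _).symm)
      (Sum.elim (fun A' => g A₂ A') (fun A' => g A₁ A'))
      (fun φ => by
        rw [Fintype.sum_sum_type, ← hcl A₁ A₂ φ, Finset.sum_sub_distrib]
        simp only [Sum.elim_inl, Sum.elim_inr, map_neg, inner_neg_left, Finset.sum_neg_distrib]
        ring)
      hχ hc hr
    refine ⟨_, fun {χ} hχ hc r hr => le_of_eq_of_le ?_ (h χ hχ hc r hr)⟩
    congr 2
    rw [Fintype.sum_sum_type]
    simp only [Sum.elim_inl, Sum.elim_inr, zDeriv, Finset.sum_neg_distrib]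
    rw [sub_eq_add_neg]
  choose K1 hK1 using hK1
  choose K2 hK2 using hK2
  set C : ℝ := 100 * n * (n * (∑ A₁, ∑ A₂, K2 A₁ A₂ ^ 2 +
    2 * ∑ A', ∑ B', |K1 A' B'| * |K1 B' A'|)) with hC
  have hn' : (2 : ℝ) ≤ n := by exact_mod_cast hn
  have hC0 : 0 ≤ C := by
    have h1 : 0 ≤ ∑ A₁, ∑ A₂, K2 A₁ A₂ ^ 2 :=
      Finset.sum_nonneg fun _ _ => Finset.sum_nonneg fun _ _ => sq_nonneg _
    have h2 : 0 ≤ ∑ A', ∑ B', |K1 A' B'| * |K1 B' A'| :=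
      Finset.sum_nonneg fun _ _ => Finset.sum_nonneg fun _ _ => by positivity
    positivity
  have hG : ∀ {χ : Heis n → ℝ} (hχ : ContDiff ℝ ∞ χ) (hc : HasCompactSupport χ) {r : ℝ}, 0 < r →
      (∀ a, commSize χ a ≤ r) → ∀ A A', ‖emb (smM hχ hc (g A A'))‖ ^ 2 ≤ r ^ 2 * C := by
    intro χ hχ hc r hr0 hr A A'
    have h1 := poincare (by omega) (smM hχ hc (g A A')) (inner_one_smM hχ hc _ (hm A A'))
    have h2 := basic_estimate fun A A' => smM hχ hc (g A A')
    have h3 : ∑ a, ‖emb (smY a (smM hχ hc (g A A')))‖ ^ 2 ≤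
        ∑ A, ∑ A', ∑ a, ‖emb (smY a (smM hχ hc (g A A')))‖ ^ 2 := by
      refine le_trans ?_ (Finset.single_le_sum (f := fun A =>
        ∑ A', ∑ a, ‖emb (smY a (smM hχ hc (g A A')))‖ ^ 2)
        (fun A _ => Finset.sum_nonneg fun _ _ => Finset.sum_nonneg fun _ _ => sq_nonneg _)
        (Finset.mem_univ A))
      exact Finset.single_le_sum (f := fun A' => ∑ a, ‖emb (smY a (smM hχ hc (g A A')))‖ ^ 2)
        (fun A' _ => Finset.sum_nonneg fun _ _ => sq_nonneg _) (Finset.mem_univ A')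
    have h4 : ∑ A₁, ∑ A₂, ‖emb (zDeriv (fun A A' => smM hχ hc (g A A')) A₁ A₂ -
        zDeriv (fun A A' => smM hχ hc (g A A')) A₂ A₁)‖ ^ 2 ≤
        r ^ 2 * ∑ A₁, ∑ A₂, K2 A₁ A₂ ^ 2 := by
      simp only [Finset.mul_sum]
      refine Finset.sum_le_sum fun A₁ _ => Finset.sum_le_sum fun A₂ _ => ?_
      rw [← mul_pow]
      exact pow_le_pow_left₀ (norm_nonneg _) (hK2 A₁ A₂ hχ hc hr) 2
    have h5 : ∑ A', ∑ B', ‖emb (wDiv (fun A => smM hχ hc (g A A')) B')‖ *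
        ‖emb (wDiv (fun A => smM hχ hc (g A B')) A')‖ ≤
        r ^ 2 * ∑ A', ∑ B', |K1 A' B'| * |K1 B' A'| := by
      simp only [Finset.mul_sum]
      refine Finset.sum_le_sum fun A' _ => Finset.sum_le_sum fun B' _ => ?_
      have e1 := (hK1 A' B' hχ hc hr).trans (mul_le_mul_of_nonneg_left (le_abs_self _) hr0.le)
      have e2 := (hK1 B' A' hχ hc hr).trans (mul_le_mul_of_nonneg_left (le_abs_self _) hr0.le)
      calc _ ≤ (r * |K1 A' B'|) * (r * |K1 B' A'|) :=
            mul_le_mul e1 e2 (norm_nonneg _) (by positivity)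
        _ = _ := by ring
    set G := ∑ A, ∑ A', ∑ a, ‖emb (smY a (smM hχ hc (g A A')))‖ ^ 2
    have hG0 : 0 ≤ G := Finset.sum_nonneg fun _ _ =>
      Finset.sum_nonneg fun _ _ => Finset.sum_nonneg fun _ _ => sq_nonneg _
    have h6 : G ≤ n * (r ^ 2 * ∑ A₁, ∑ A₂, K2 A₁ A₂ ^ 2 +
        2 * (r ^ 2 * ∑ A', ∑ B', |K1 A' B'| * |K1 B' A'|)) := by
      -- Here `n ≥ 2` enters; for `n = 1` the estimate would be empty.
      calc G ≤ 2 * (n - 1) * G := by nlinarith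
        _ ≤ _ := h2
        _ ≤ _ := by gcongr
    calc _ ≤ 100 * n * G := h1.trans (by gcongr)
      _ ≤ 100 * n * (n * (r ^ 2 * ∑ A₁, ∑ A₂, K2 A₁ A₂ ^ 2 +
        2 * (r ^ 2 * ∑ A', ∑ B', |K1 A' B'| * |K1 B' A'|))) := by gcongr
      _ = r ^ 2 * C := by rw [hC]; ring
  refine eq_zero_of_inner_emb _ fun φ => ?_
  have hb : ∀ r : ℝ, 0 < r → ‖inner ℂ (emb φ) (g A A')‖ ≤
      r * (derivBound φ * ‖g A A'‖ + ‖emb φ‖ * Real.sqrt C) := by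
    intro r hr0
    obtain ⟨χ, hχ, hc, h0, h1, hs, hr⟩ := exists_mollifier n hr0
    have e1 := norm_inner_smM_sub_le hχ hc h0 h1 hs φ (g A A')
    have e2 : ‖emb (smM hχ hc (g A A'))‖ ≤ r * Real.sqrt C := by
      refine abs_le_of_sq_le_sq' ?_ (by positivity) |>.2
      rw [mul_pow, Real.sq_sqrt hC0]
      exact hG hχ hc hr0 hr A A'
    have e3 := (norm_inner_le_norm (𝕜 := ℂ) (emb φ) (emb (smM hχ hc (g A A')))).trans
      (mul_le_mul_of_nonneg_left e2 (norm_nonneg _))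
    have e4 := norm_sub_norm_le (inner ℂ (emb φ) (g A A'))
      (inner ℂ (emb φ) (emb (smM hχ hc (g A A'))))
    rw [norm_sub_rev] at e4
    linarith
  have hz : ‖inner ℂ (emb φ) (g A A')‖ ≤ 0 := by
    refine le_of_forall_pos_le_add fun ε hε => ?_
    have hD : 0 ≤ derivBound φ * ‖g A A'‖ + ‖emb φ‖ * Real.sqrt C := by
      have := derivBound_nonneg φ
      positivity
    set D := derivBound φ * ‖g A A'‖ + ‖emb φ‖ * Real.sqrt C
    refine (hb (ε / (D + 1)) (by positivity)).trans ?_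
    rw [zero_add, div_mul_eq_mul_div, div_le_iff₀ (by positivity)]
    nlinarith
  exact norm_le_zero_iff.1 hz

/-! ### The weak solution -/

theorem sum_norm_smZ_add_smZ (φ ψ : Sm n) :
    ∑ A, ‖emb (smZ A 0 φ + smZ A 1 ψ)‖ ^ 2 =
      ∑ a, ‖emb (smY a φ)‖ ^ 2 + ∑ a, ‖emb (smY a ψ)‖ ^ 2 := by
  have h : ((∑ A, ‖emb (smZ A 0 φ + smZ A 1 ψ)‖ ^ 2 : ℝ) : ℂ) =
      ((∑ a, ‖emb (smY a φ)‖ ^ 2 + ∑ a, ‖emb (smY a ψ)‖ ^ 2 : ℝ) : ℂ) := by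
    have e : ∀ x : HL n, ((‖x‖ ^ 2 : ℝ) : ℂ) = inner ℂ x x := fun x => by
      rw [inner_self_eq_norm_sq_to_K]; norm_cast
    have h00 := sum_inner_smZ_smZ 0 0 φ φ
    have h01 := sum_inner_smZ_smZ 0 1 φ ψ
    have h10 := sum_inner_smZ_smZ 1 0 ψ φ
    have h11 := sum_inner_smZ_smZ 1 1 ψ ψ
    simp only [if_true, zero_ne_one, one_ne_zero, if_false] at h00 h01 h10 h11
    rw [Complex.ofReal_add]
    simp only [Complex.ofReal_sum, e, map_add, inner_add_left, inner_add_right,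
      Finset.sum_add_distrib, h00, h01, h10, h11]
    ring
  exact_mod_cast h

theorem smZ_one (A : Fin n × Fin 2) (A' : Fin 2) : smZ A A' (smOne : Sm n) = 0 := by
  obtain ⟨c, hc, -⟩ := exists_coeff A A'
  simp [hc, smY]

theorem smW_one (A : Fin n × Fin 2) (A' : Fin 2) : smW A A' (smOne : Sm n) = 0 := by
  obtain ⟨c, -, hc⟩ := exists_coeff A A'
  simp [hc, smY]

theorem exists_centered (φ : Sm n) :
    ∃ ψ : Sm n, inner ℂ (emb smOne) (emb ψ) = 0 ∧ ∀ A A', smZ A A' ψ = smZ A A' φ := by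
  have h1 : inner ℂ (emb (smOne : Sm n)) (emb smOne) = 1 := by
    rw [inner_emb_emb]
    simp [smOne_apply]
  refine ⟨φ - inner ℂ (emb smOne) (emb φ) • smOne, ?_, fun A A' => ?_⟩
  · rw [map_sub, map_smul, inner_sub_right, inner_smul_right, h1, mul_one, sub_self]
  · rw [map_sub, map_smul, smZ_one, smul_zero, sub_zero]

/-- This is `D₁ D₀ = 0` in components; symmetry in the primed indices makes the symmetrised
commutation relation enough. -/
theorem smZ_add_smZ_comm (A B : Fin n × Fin 2) (φ₀ φ₁ φ₂ : Sm n) :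
    smZ A 0 (smZ B 0 φ₀ + smZ B 1 φ₁) + smZ A 1 (smZ B 0 φ₁ + smZ B 1 φ₂) =
      smZ B 0 (smZ A 0 φ₀ + smZ A 1 φ₁) + smZ B 1 (smZ A 0 φ₁ + smZ A 1 φ₂) := by
  have h0 := (smZ_comm A B φ₀).1
  have h2 := (smZ_comm A B φ₂).2.1
  have h1 := (smZ_comm A B φ₁).2.2
  simp only [map_add]
  rw [h0, h2]
  rw [add_assoc, ← add_assoc (smZ A 0 (smZ B 1 φ₁)), h1]
  abel

/-- Up to sign, conjugation flips both indices of a field within its quaternionic variable.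
Contracting the closedness expression over the pairs `(l, 0), (l, 1)` therefore compares two
divergences. -/
theorem sum_inner_smW_trace (g₀ g₁ : Fin n × Fin 2 → HL n) (φ : Sm n) :
    ∑ l : Fin n, (inner ℂ (emb (smW (l, 0) 0 φ)) (g₀ (l, 1)) +
        inner ℂ (emb (smW (l, 0) 1 φ)) (g₁ (l, 1)) -
        (inner ℂ (emb (smW (l, 1) 0 φ)) (g₀ (l, 0)) +
        inner ℂ (emb (smW (l, 1) 1 φ)) (g₁ (l, 0)))) =
      ∑ A, inner ℂ (emb (smZ A 1 φ)) (g₀ A) - ∑ A, inner ℂ (emb (smZ A 0 φ)) (g₁ A) := by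
  rw [Fintype.sum_prod_type, Fintype.sum_prod_type, ← Finset.sum_sub_distrib]
  refine Finset.sum_congr rfl fun l _ => ?_
  have h1 : smW (l, 0) 0 φ = smZ (l, 1) 1 φ := by rw [smW_00, smZ_11]
  have h2 : smW (l, 0) 1 φ = -smZ (l, 1) 0 φ := by rw [smW_01, smZ_10]; abel
  have h3 : smW (l, 1) 0 φ = -smZ (l, 0) 1 φ := by rw [smW_10, smZ_01]; abel
  have h4 : smW (l, 1) 1 φ = smZ (l, 0) 0 φ := by rw [smW_11, smZ_00]
  simp only [h1, h2, h3, h4, map_neg, inner_neg_left, Fin.sum_univ_two]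
  ring

/-- The Hilbert space containing the range of the first operator. -/
abbrev TupleL2 (n K : ℕ) : Type := PiLp 2 fun _ : Fin (K + 1) × (Fin n × Fin 2) => HL n

/-- The first operator on tuples of smooth functions. -/
def smoothD (n K : ℕ) : (Fin (K + 2) → Sm n) →ₗ[ℂ] TupleL2 n K where
  toFun φ := WithLp.toLp 2 fun p =>
    emb (smZ p.2 0 (φ p.1.castSucc) + smZ p.2 1 (φ p.1.succ))
  map_add' φ ψ := by
    ext1 p
    simp only [PiLp.add_apply, Pi.add_apply, map_add]
    abel
  map_smul' c φ := by
    ext1 p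
    simp only [PiLp.smul_apply, Pi.smul_apply, map_add, map_smul, smul_add, RingHom.id_apply]

theorem smoothD_apply {K : ℕ} (φ : Fin (K + 2) → Sm n) (p : Fin (K + 1) × (Fin n × Fin 2)) :
    smoothD n K φ p = emb (smZ p.2 0 (φ p.1.castSucc) + smZ p.2 1 (φ p.1.succ)) := rfl

theorem norm_smoothD_sq {K : ℕ} (φ : Fin (K + 2) → Sm n) :
    ‖smoothD n K φ‖ ^ 2 = ∑ m : Fin (K + 1), (∑ a, ‖emb (smY a (φ m.castSucc))‖ ^ 2 +
      ∑ a, ‖emb (smY a (φ m.succ))‖ ^ 2) := by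
  rw [PiLp.norm_sq_eq_of_L2, Fintype.sum_prod_type]
  simp only [smoothD_apply, sum_norm_smZ_add_smZ]

theorem norm_emb_le_smoothD (hn : 0 < n) {K : ℕ} (φ : Fin (K + 2) → Sm n)
    (hφ : ∀ m, inner ℂ (emb smOne) (emb (φ m)) = 0) (m : Fin (K + 2)) :
    ‖emb (φ m)‖ ≤ 10 * n * ‖smoothD n K φ‖ := by
  have h1 := poincare hn (φ m) (hφ m)
  have h2 : ∑ a, ‖emb (smY a (φ m))‖ ^ 2 ≤ ‖smoothD n K φ‖ ^ 2 := by
    rw [norm_smoothD_sq]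
    have h0 : ∀ m, 0 ≤ ∑ a, ‖emb (smY a (φ m))‖ ^ 2 := fun m =>
      Finset.sum_nonneg fun a _ => sq_nonneg _
    have h3 := fun i => Finset.single_le_sum (f := fun m : Fin (K + 1) =>
      ∑ a, ‖emb (smY a (φ m.castSucc))‖ ^ 2 + ∑ a, ‖emb (smY a (φ m.succ))‖ ^ 2)
      (fun m _ => add_nonneg (h0 _) (h0 _)) (Finset.mem_univ i)
    rcases Fin.eq_zero_or_eq_succ m with rfl | ⟨i, rfl⟩
    · exact (le_add_of_nonneg_right (h0 _)).trans (h3 0)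
    · exact (le_add_of_nonneg_left (h0 _)).trans (h3 i)
  have hn1 : (1 : ℝ) ≤ n := by exact_mod_cast hn
  refine le_of_sq_le_sq ?_ (by positivity)
  calc ‖emb (φ m)‖ ^ 2 ≤ 100 * n * ‖smoothD n K φ‖ ^ 2 :=
        h1.trans (mul_le_mul_of_nonneg_left h2 (by positivity))
    -- `100 n ≤ (10 n)²` because `n ≥ 1`.
    _ ≤ (10 * n * ‖smoothD n K φ‖) ^ 2 := by nlinarith [sq_nonneg ‖smoothD n K φ‖]

/-- Every element of the closure of the range of the first operator is a weak image. -/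
theorem exists_of_mem_closure (hn : 0 < n) {K : ℕ} (h : TupleL2 n K)
    (hh : h ∈ closure (Set.range (smoothD n K))) :
    ∃ u : Fin (K + 2) → HL n, ∀ p φ, inner ℂ (emb φ) (h p) =
      -(inner ℂ (emb (smW p.2 0 φ)) (u p.1.castSucc) +
        inner ℂ (emb (smW p.2 1 φ)) (u p.1.succ)) := by
  obtain ⟨x, hx, hxh⟩ := mem_closure_iff_seq_limit.1 hh
  choose φ hφ using hx
  -- Removing the means does not change the images and makes Poincaré available, so convergent
  -- images force Cauchy preimages.
  choose ψ hψ1 hψ2 using fun j m => exists_centered (φ j m)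
  have hψ : ∀ j, smoothD n K (ψ j) = x j := fun j => by
    rw [← hφ j]
    ext1 p
    simp only [smoothD_apply, hψ2]
  have hcau : ∀ m, CauchySeq fun j => emb (ψ j m) := by
    intro m
    have hc := hxh.cauchySeq
    rw [Metric.cauchySeq_iff] at hc ⊢
    intro ε hε
    have hn0 : (0 : ℝ) < n := by exact_mod_cast hn
    obtain ⟨N, hN⟩ := hc (ε / (10 * n)) (by positivity)
    refine ⟨N, fun i hi j hj => ?_⟩
    have h1 := norm_emb_le_smoothD hn (ψ i - ψ j) (fun m => by
      rw [Pi.sub_apply, map_sub, inner_sub_right, hψ1, hψ1, sub_zero]) m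
    have h2 := hN i hi j hj
    rw [map_sub, hψ, hψ, ← dist_eq_norm, Pi.sub_apply, map_sub, ← dist_eq_norm] at h1
    rw [lt_div_iff₀' (by positivity)] at h2
    exact h1.trans_lt h2
  choose u hu using fun m => cauchySeq_tendsto_of_complete (hcau m)
  refine ⟨u, fun p θ => ?_⟩
  have hl : Filter.Tendsto (fun j => inner ℂ (emb θ) (x j p)) Filter.atTop
      (nhds (inner ℂ (emb θ) (h p))) :=
    tendsto_const_nhds.inner (((PiLp.continuous_apply 2 _ p).tendsto h).comp hxh)
  refine tendsto_nhds_unique hl ?_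
  have hr : ∀ j, inner ℂ (emb θ) (x j p) =
      -(inner ℂ (emb (smW p.2 0 θ)) (emb (ψ j p.1.castSucc)) +
        inner ℂ (emb (smW p.2 1 θ)) (emb (ψ j p.1.succ))) := fun j => by
    rw [← hψ j, smoothD_apply, map_add, inner_add_right, inner_smW, inner_smW]
    ring
  simp only [hr]
  exact ((tendsto_const_nhds.inner (hu _)).add (tendsto_const_nhds.inner (hu _))).neg

/-- The orthogonal projection of `f` onto the closed range has a weak preimage; the work is to show
that the remainder `g` vanishes. -/
theorem exists_weak_solution (hn : 2 ≤ n) {K : ℕ} (hK : 0 < K)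
    (f : Fin (K + 1) → Fin n × Fin 2 → HL n)
    (hmean : ∀ m A, inner ℂ (emb smOne) (f m A) = 0)
    (hcl : ∀ (m : Fin K) (A B : Fin n × Fin 2) (φ : Sm n),
      inner ℂ (emb (smW A 0 φ)) (f m.castSucc B) + inner ℂ (emb (smW A 1 φ)) (f m.succ B) =
      inner ℂ (emb (smW B 0 φ)) (f m.castSucc A) + inner ℂ (emb (smW B 1 φ)) (f m.succ A)) :
    ∃ u : Fin (K + 2) → HL n, ∀ m A φ, inner ℂ (emb φ) (f m A) =
      -(inner ℂ (emb (smW A 0 φ)) (u m.castSucc) + inner ℂ (emb (smW A 1 φ)) (u m.succ)) := by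
  set F : TupleL2 n K := WithLp.toLp 2 fun p => f p.1 p.2 with hF
  set S := (LinearMap.range (smoothD n K)).topologicalClosure with hS
  have : CompleteSpace S := (Submodule.isClosed_topologicalClosure _).completeSpace_coe
  obtain ⟨h, hh, g, hg, hFhg⟩ := S.exists_add_mem_mem_orthogonal F
  have hh' : h ∈ closure (Set.range (smoothD n K)) := hh
  obtain ⟨u, hu⟩ := exists_of_mem_closure (by omega) h hh'
  suffices hg0 : ∀ m A, g (m, A) = 0 by
    refine ⟨u, fun m A φ => ?_⟩
    rw [← hu (m, A) φ]
    have : F (m, A) = h (m, A) + g (m, A) := by rw [hFhg]; rfl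
    rw [hg0, add_zero] at this
    rw [← this]
  have hgf : ∀ m A, g (m, A) = f m A - h (m, A) := fun m A => by
    rw [eq_sub_iff_add_eq']
    have : F (m, A) = h (m, A) + g (m, A) := by rw [hFhg]; rfl
    exact this.symm
  have hgm : ∀ m A, inner ℂ (emb smOne) (g (m, A)) = 0 := fun m A => by
    rw [hgf, inner_sub_right, hmean, hu, smW_one, smW_one, map_zero, inner_zero_left,
      inner_zero_left]
    simp
  have hhcl : ∀ (m : Fin K) (A B : Fin n × Fin 2) (φ : Sm n),
      inner ℂ (emb (smW A 0 φ)) (h (m.castSucc, B)) +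
        inner ℂ (emb (smW A 1 φ)) (h (m.succ, B)) =
      inner ℂ (emb (smW B 0 φ)) (h (m.castSucc, A)) +
        inner ℂ (emb (smW B 1 φ)) (h (m.succ, A)) := by
    intro m A B φ
    refine closure_minimal (t := {h : TupleL2 n K |
      inner ℂ (emb (smW A 0 φ)) (h (m.castSucc, B)) +
        inner ℂ (emb (smW A 1 φ)) (h (m.succ, B)) =
      inner ℂ (emb (smW B 0 φ)) (h (m.castSucc, A)) +
        inner ℂ (emb (smW B 1 φ)) (h (m.succ, A))}) ?_
      (isClosed_eq (by fun_prop) (by fun_prop)) hh'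
    rintro _ ⟨ψ, rfl⟩
    have h1 := smZ_add_smZ_comm A B (ψ m.castSucc.castSucc) (ψ m.castSucc.succ) (ψ m.succ.succ)
    simp only [Set.mem_ofPred_eq, smoothD_apply, inner_smW, ← Fin.succ_castSucc]
    rw [← neg_add, ← neg_add, ← inner_add_right, ← inner_add_right, ← map_add, ← map_add, h1]
  have hgcl : ∀ (m : Fin K) (A B : Fin n × Fin 2) (φ : Sm n),
      inner ℂ (emb (smW A 0 φ)) (g (m.castSucc, B)) +
        inner ℂ (emb (smW A 1 φ)) (g (m.succ, B)) =
      inner ℂ (emb (smW B 0 φ)) (g (m.castSucc, A)) +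
        inner ℂ (emb (smW B 1 φ)) (g (m.succ, A)) := fun m A B φ => by
    simp only [hgf, inner_sub_right]
    linear_combination hcl m A B φ - hhcl m A B φ
  have horth : ∀ φ : Fin (K + 2) → Sm n, ∑ m : Fin (K + 1), (∑ A, inner ℂ (emb (smZ A 0 (φ m.castSucc))) (g (m, A)) +
      ∑ A, inner ℂ (emb (smZ A 1 (φ m.succ))) (g (m, A))) = 0 := fun φ => by
    have h1 := hg (smoothD n K φ) (Submodule.le_topologicalClosure _ ⟨φ, rfl⟩)
    rw [PiLp.inner_apply, Fintype.sum_prod_type] at h1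
    rw [← h1]
    refine Finset.sum_congr rfl fun m _ => ?_
    rw [← Finset.sum_add_distrib]
    refine Finset.sum_congr rfl fun A _ => ?_
    rw [smoothD_apply, map_add, inner_add_left]
  -- The trace of closedness says that these two divergences are equal, while `hsum`, from
  -- orthogonality tested on one interior component, says that they are opposite. The extreme
  -- components give the remaining two divergences.
  have htr : ∀ (i : Fin K) (φ : Sm n), ∑ A, inner ℂ (emb (smZ A 1 φ)) (g (i.castSucc, A)) =
      ∑ A, inner ℂ (emb (smZ A 0 φ)) (g (i.succ, A)) := fun i φ => by
    rw [← sub_eq_zero, ← sum_inner_smW_trace (fun A => g (i.castSucc, A))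
      (fun A => g (i.succ, A))]
    exact Finset.sum_eq_zero fun l _ => sub_eq_zero.2 (hgcl i (l, 0) (l, 1) φ)
  have hsum : ∀ (i : Fin K) (φ : Sm n), ∑ A, inner ℂ (emb (smZ A 0 φ)) (g (i.succ, A)) +
      ∑ A, inner ℂ (emb (smZ A 1 φ)) (g (i.castSucc, A)) = 0 := fun i φ => by
    have h1 := horth (Pi.single i.castSucc.succ φ)
    rw [Finset.sum_add_distrib, Finset.sum_eq_single i.succ, Finset.sum_eq_single i.castSucc] at h1
    · simpa [← Fin.succ_castSucc] using h1
    · intro m _ hm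
      simp [hm]
    · simp
    · intro m _ hm
      have : m.castSucc ≠ i.castSucc.succ := by
        rw [Fin.succ_castSucc]
        exact fun h => hm (Fin.castSucc_injective _ h)
      simp [this]
    · simp
  have h0 : ∀ m (φ : Sm n), ∑ A, inner ℂ (emb (smZ A 0 φ)) (g (m, A)) = 0 := fun m φ => by
    rcases Fin.eq_zero_or_eq_succ m with rfl | ⟨i, rfl⟩
    · have h1 := horth (Pi.single 0 φ)
      rw [Finset.sum_eq_single 0] at h1
      · simpa using h1
      · intro m _ hm
        have : m.castSucc ≠ 0 := by simpa using hm
        simp [this]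
      · simp
    · have h1 := hsum i φ
      rw [htr] at h1
      exact self_eq_neg.1 (eq_neg_of_add_eq_zero_left h1)
  have h1 : ∀ m (φ : Sm n), ∑ A, inner ℂ (emb (smZ A 1 φ)) (g (m, A)) = 0 := fun m φ => by
    rcases Fin.eq_castSucc_or_eq_last m with ⟨i, rfl⟩ | rfl
    · rw [htr, h0]
    · have h1 := horth (Pi.single (Fin.last (K + 1)) φ)
      rw [Finset.sum_eq_single (Fin.last K)] at h1
      · simpa using h1
      · intro m _ hm
        have : m.succ ≠ Fin.last (K + 1) := by simpa [Fin.succ_eq_last_succ] using hm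
        simp [this]
      · simp
  -- Two neighbouring components are treated as a tuple with a single primed index. As `K > 0`,
  -- every component belongs to such a pair.
  have key : ∀ (i : Fin K) (A : Fin n × Fin 2) (A' : Fin 2),
      (![g (i.castSucc, A), g (i.succ, A)] : Fin 2 → HL n) A' = 0 := fun i => by
    refine eq_zero_of_weak hn (fun A => ![g (i.castSucc, A), g (i.succ, A)]) ?_ ?_ ?_
    · intro A A'
      fin_cases A' <;> simp [hgm]
    · intro A' C' φ
      fin_cases A' <;> fin_cases C' <;> simp [h0, h1]
    · intro A₁ A₂ φ
      rw [Fin.sum_univ_two]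
      have := hgcl i A₁ A₂ φ
      simp only [Matrix.cons_val_zero, Matrix.cons_val_one]
      linear_combination this
  intro m A
  rcases Fin.eq_zero_or_eq_succ m with rfl | ⟨i, rfl⟩
  · exact key ⟨0, hK⟩ A 0
  · exact key i A 1

/-! ### Symmetric indices -/

/-- The number of ones in a tuple of primed indices. -/
def numOnes {N : ℕ} (a : Fin N → Fin 2) : ℕ := ∑ i, (a i : ℕ)

theorem numOnes_lt {N : ℕ} (a : Fin N → Fin 2) : numOnes a < N + 1 := by
  have h : numOnes a ≤ ∑ _i : Fin N, 1 := Finset.sum_le_sum fun i _ => by omega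
  simp at h
  omega

theorem numOnes_comp {N : ℕ} (a : Fin N → Fin 2) (σ : Equiv.Perm (Fin N)) :
    numOnes (a ∘ σ) = numOnes a :=
  Equiv.sum_comp σ fun i => (a i : ℕ)

theorem numOnes_consIdx {N : ℕ} (A' : Fin 2) (a : Fin N → Fin 2) :
    numOnes (N := N + 1) (consIdx (k := N + 1) (j := 0) A' a) = A' + numOnes a := by
  unfold numOnes
  rw [Fin.sum_univ_succ]
  rfl

/-- The tuple starting with `m` ones, followed by zeros. -/
def onesIdx (N m : ℕ) : Fin N → Fin 2 := fun i => if i.val < m then 1 else 0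

theorem numOnes_onesIdx {N m : ℕ} (hm : m ≤ N) : numOnes (onesIdx N m) = m := by
  unfold numOnes onesIdx
  rw [Fin.sum_univ_eq_sum_range (fun i => (((if i < m then 1 else 0 : Fin 2)) : ℕ)) N]
  have : ∀ i, (((if i < m then 1 else 0 : Fin 2)) : ℕ) = if i < m then 1 else 0 := fun i => by
    split_ifs <;> rfl
  simp only [this]
  rw [← Finset.sum_filter, Finset.sum_const, smul_eq_mul, mul_one]
  have : (Finset.range N).filter (· < m) = Finset.range m := by
    ext i
    simp only [Finset.mem_filter, Finset.mem_range]
    omega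
  rw [this, Finset.card_range]

theorem card_ones {N : ℕ} (a : Fin N → Fin 2) : Fintype.card {i // a i = 1} = numOnes a := by
  rw [Fintype.card_subtype, Finset.card_filter]
  refine Finset.sum_congr rfl fun i _ => ?_
  generalize a i = x
  fin_cases x <;> rfl

/-- Hence a symmetric tuple is determined by its values as a function of the number of ones. -/
theorem exists_perm_of_numOnes_eq {N : ℕ} {a b : Fin N → Fin 2} (h : numOnes a = numOnes b) :
    ∃ σ : Equiv.Perm (Fin N), a = b ∘ σ := by
  rw [← card_ones, ← card_ones] at h
  let e : {i // a i = 1} ≃ {i // b i = 1} := Fintype.equivOfCardEq h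
  refine ⟨e.extendSubtype, funext fun i => ?_⟩
  have h0 : ∀ x : Fin 2, x ≠ 1 → x = 0 := by decide
  by_cases hi : a i = 1
  · exact hi.trans (e.extendSubtype_mem i hi).symm
  · exact (h0 _ hi).trans (h0 _ (e.extendSubtype_not_mem i hi)).symm

/-! ### Components -/

/-- Evaluation of a component of an element of `V`. -/
def evalV (n k j : ℕ) (p : (Fin (k - j) → Fin 2) × (Fin j → Fin n × Fin 2)) :
    V n k j →L[ℂ] ℂ :=
  (EuclideanSpace.proj p).comp (V n k j).subtypeL

theorem evalV_apply {k j : ℕ} (p : (Fin (k - j) → Fin 2) × (Fin j → Fin n × Fin 2))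
    (v : V n k j) : evalV n k j p v =
      (v : EuclideanSpace ℂ ((Fin (k - j) → Fin 2) × (Fin j → Fin n × Fin 2))) p := rfl

/-- The components of a square integrable section. -/
def compL {k j : ℕ} (f : L2 n k j) (a : Fin (k - j) → Fin 2) (A : Fin j → Fin n × Fin 2) :
    HL n := (evalV n k j (a, A)).compLp f

theorem coeFn_compL {k j : ℕ} (f : L2 n k j) (a : Fin (k - j) → Fin 2)
    (A : Fin j → Fin n × Fin 2) : compL f a A =ᵐ[nilMeasure n] comp f a A :=
  (evalV n k j (a, A)).coeFn_compLp f

theorem compL_eq_of_numOnes {k j : ℕ} (f : L2 n k j) {a b : Fin (k - j) → Fin 2}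
    (h : numOnes a = numOnes b) (A : Fin j → Fin n × Fin 2) : compL f a A = compL f b A := by
  obtain ⟨σ, rfl⟩ := exists_perm_of_numOnes_eq h
  refine Lp.ext ?_
  filter_upwards [coeFn_compL f (b ∘ σ) A, coeFn_compL f b A] with q h1 h2
  rw [h1, h2]
  exact (f q).2.1 σ b A

/-! ### Test functions -/

/-- Complex conjugation of smooth functions. -/
def smConj (φ : Sm n) : Sm n :=
  ⟨fun q => (starRingEnd ℂ) ((φ : Nil n → ℂ) q), SmoothFun.conj φ.2⟩

theorem Y_eq (a : Fin n × Fin 4) (φ : Sm n) : Y a φ = (smY a φ : Nil n → ℂ) := by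
  have h : ∀ t, axis a t = t • basisVec a := fun t =>
    ext' (fun b => by
      change (Pi.single a t : Fin n × Fin 4 → ℝ) b = t * (Pi.single a 1 : Fin n × Fin 4 → ℝ) b
      by_cases hb : b = a
      · subst hb; simp
      · simp [hb])
      (fun β => (mul_zero t).symm)
  funext q
  simp only [Y, h]
  rfl

theorem smY_smConj (a : Fin n × Fin 4) (φ : Sm n) : smY a (smConj φ) = smConj (smY a φ) :=
  Subtype.ext (lieD_conj φ.2 _)

theorem Z_smConj (A : Fin n × Fin 2) (A' : Fin 2) (φ : Sm n) (q : Nil n) :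
    Z A A' (fun q => (starRingEnd ℂ) ((φ : Nil n → ℂ) q)) q =
      (starRingEnd ℂ) ((smW A A' φ : Nil n → ℂ) q) := by
  have h : ∀ a, Y a (fun q => (starRingEnd ℂ) ((φ : Nil n → ℂ) q)) q =
      (starRingEnd ℂ) ((smY a φ : Nil n → ℂ) q) := fun a => by
    have h1 := Y_eq a (smConj φ)
    rw [smY_smConj] at h1
    exact congrFun h1 q
  obtain ⟨l, α⟩ := A
  fin_cases α <;> fin_cases A' <;>
  · simp only [Z, h, Fin.zero_eta, Fin.mk_one, smW_00, smW_01, smW_10, smW_11]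
    simp [sub_eq_add_neg]

theorem distZ_smConj (A : Fin n × Fin 2) (A' : Fin 2) {u : Nil n → ℂ} {g : HL n}
    (h : g =ᵐ[nilMeasure n] u) (φ : Sm n) :
    distZ A A' u (fun q => (starRingEnd ℂ) ((φ : Nil n → ℂ) q)) =
      -inner ℂ (emb (smW A A' φ)) g := by
  rw [inner_emb_left, distZ]
  congr 1
  refine integral_congr_ae ?_
  filter_upwards [h] with q hq
  rw [Z_smConj, hq, mul_comm]

theorem integral_mul_smConj {u : Nil n → ℂ} {g : HL n} (h : g =ᵐ[nilMeasure n] u) (φ : Sm n) :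
    ∫ q, u q * (starRingEnd ℂ) ((φ : Nil n → ℂ) q) ∂(nilMeasure n) = inner ℂ (emb φ) g := by
  rw [inner_emb_left]
  refine integral_congr_ae ?_
  filter_upwards [h] with q hq
  rw [hq, mul_comm]

/-! ### The operators in terms of components -/

/-- Every test function is the conjugate of a smooth one. This turns the bilinear pairings into
inner products and `Z` into `smW`. -/
theorem isD_zero_iff {K : ℕ} (u : L2 n (K + 1) 0) (f : L2 n (K + 1) 1) :
    IsD u f ↔ ∀ (a : Fin K → Fin 2) (A : Fin n × Fin 2) (φ : Sm n),
      inner ℂ (emb φ) (compL f a fun _ => A) =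
        -∑ A', inner ℂ (emb (smW A A' φ))
          (compL u (consIdx (k := K + 1) (j := 0) A' a) Fin.elim0) := by
  have key : ∀ (a : Fin K → Fin 2) (A : Fin 1 → Fin n × Fin 2) (φ : Sm n),
      (∫ q, comp f a A q * (starRingEnd ℂ) ((φ : Nil n → ℂ) q) ∂(nilMeasure n) =
        ((0 : ℕ) + 1 : ℂ) * (1 / ((0 + 1).factorial : ℂ) *
          ∑ σ : Equiv.Perm (Fin (0 + 1)), ((Equiv.Perm.sign σ : ℤ) : ℂ) *
            ∑ A' : Fin 2,
              distZ (A (σ 0)) A' (comp u (consIdx A' a) fun i => A (σ i.succ))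
                (fun q => (starRingEnd ℂ) ((φ : Nil n → ℂ) q)))) ↔
      inner ℂ (emb φ) (compL f a fun _ => A 0) =
        -∑ A', inner ℂ (emb (smW (A 0) A' φ))
          (compL u (consIdx (k := K + 1) (j := 0) A' a) Fin.elim0) := by
    intro a A φ
    have hA : A = fun _ => A 0 := funext fun i => by rw [Subsingleton.elim i 0]
    have he : ∀ σ : Equiv.Perm (Fin (0 + 1)), (fun i : Fin 0 => A (σ i.succ)) = Fin.elim0 :=
      fun σ => funext fun i => i.elim0
    rw [integral_mul_smConj (coeFn_compL f a A), ← hA]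
    simp only [he, distZ_smConj _ _ (coeFn_compL u _ _)]
    simp
  constructor
  · intro h a A φ
    exact (key a (fun _ => A) φ).1 (h a (fun _ => A) _ (SmoothFun.conj φ.2))
  · intro h a A φ hφ
    have h1 := (key a A (smConj ⟨φ, hφ⟩)).2 (h a (A 0) _)
    have h2 : (fun q => (starRingEnd ℂ) ((smConj ⟨φ, hφ⟩ : Nil n → ℂ) q)) = φ :=
      funext fun q => Complex.conj_conj _
    rw [h2] at h1
    have h3 : ∀ q, (starRingEnd ℂ) ((smConj ⟨φ, hφ⟩ : Nil n → ℂ) q) = φ q := congrFun h2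
    simp only [h3] at h1
    exact h1

theorem closed_of_isD {K : ℕ} {f : L2 n (K + 2) 1} (h : IsD f 0) (a : Fin K → Fin 2)
    (A B : Fin n × Fin 2) (φ : Sm n) :
    ∑ A', inner ℂ (emb (smW A A' φ))
        (compL f (consIdx (k := K + 1) (j := 0) A' a) fun _ => B) =
      ∑ A', inner ℂ (emb (smW B A' φ))
        (compL f (consIdx (k := K + 1) (j := 0) A' a) fun _ => A) := by
  have h1 := h a ![A, B] _ (SmoothFun.conj φ.2)
  have hu : (Finset.univ : Finset (Equiv.Perm (Fin 2))) = {1, Equiv.swap 0 1} := by decide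
  have h0 : ∫ q, comp (0 : L2 n (K + 2) 2) a ![A, B] q *
      (starRingEnd ℂ) ((φ : Nil n → ℂ) q) ∂(nilMeasure n) = 0 := by
    refine integral_eq_zero_of_ae ?_
    filter_upwards [Lp.coeFn_zero (V n (K + 2) 2) 2 (nilMeasure n)] with q _
    simp [comp]
  have e1 : (fun i : Fin 1 => (![A, B] : Fin 2 → Fin n × Fin 2)
      ((1 : Equiv.Perm (Fin 2)) i.succ)) = fun _ => B := funext fun i => by
    rw [Subsingleton.elim i 0]; rfl
  have e2 : (fun i : Fin 1 => (![A, B] : Fin 2 → Fin n × Fin 2)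
      ((Equiv.swap 0 1 : Equiv.Perm (Fin 2)) i.succ)) = fun _ => A := funext fun i => by
    rw [Subsingleton.elim i 0]; simp
  have hne : (1 : Equiv.Perm (Fin 2)) ≠ Equiv.swap 0 1 := by decide
  rw [h0] at h1
  rw [hu, Finset.sum_pair hne, e1, e2] at h1
  simp only [distZ_smConj _ _ (coeFn_compL f _ _), Finset.sum_neg_distrib] at h1
  simp only [Equiv.Perm.sign_one, Equiv.Perm.sign_swap (zero_ne_one' (Fin 2)), Equiv.Perm.one_apply,
    Equiv.swap_apply_left, Matrix.cons_val_zero, Matrix.cons_val_one] at h1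
  -- For `j = 1` the normalising factor `(j + 1) / (j + 1)!` is `1`.
  norm_num [Nat.factorial] at h1
  have h2 : ∑ A', inner ℂ (emb (smW A A' φ))
        (compL f (consIdx (k := K + 2) (j := 1) A' a) fun _ => B) =
      ∑ A', inner ℂ (emb (smW B A' φ))
        (compL f (consIdx (k := K + 2) (j := 1) A' a) fun _ => A) := by
    rw [Fin.sum_univ_two, Fin.sum_univ_two]
    linear_combination -h1
  exact h2

/-- Test against the indicator of all indices with the same number of ones and the same `A`, which
is symmetric. By symmetry of `f` the pairing is a nonzero count times the mean of one component. -/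
theorem mean_zero_of_perpConst {K : ℕ} {f : L2 n (K + 1) 1} (h : PerpConst f)
    (a : Fin K → Fin 2) (A : Fin n × Fin 2) :
    inner ℂ (emb smOne) (compL f a fun _ => A) = 0 := by
  let c : V n (K + 1) 1 := ⟨WithLp.toLp 2 fun p =>
    if numOnes p.1 = numOnes a ∧ p.2 0 = A then 1 else 0, fun σ b D => by
      change (if _ then _ else _) = if _ then _ else _
      rw [numOnes_comp], fun σ b D => by
      rw [Subsingleton.elim σ 1]
      simp
      rfl⟩
  set S := (Finset.univ : Finset ((Fin K → Fin 2) × (Fin 1 → Fin n × Fin 2))).filter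
    fun p => numOnes p.1 = numOnes a ∧ p.2 0 = A with hS
  have h1 := h c
  rw [L2.inner_def] at h1
  have hall : ∀ᵐ q ∂(nilMeasure n), ∀ p : (Fin K → Fin 2) × (Fin 1 → Fin n × Fin 2),
      compL f p.1 p.2 q = comp f p.1 p.2 q :=
    ae_all_iff.2 fun p => coeFn_compL f p.1 p.2
  have h2 : ∀ᵐ q ∂(nilMeasure n), inner ℂ ((Lp.const 2 (nilMeasure n) c :
      L2 n (K + 1) 1) q) (f q) = (S.card : ℂ) * (compL f a fun _ => A) q := by
    filter_upwards [hall, Lp.coeFn_const (p := 2) (μ := nilMeasure n) c] with q hq hc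
    rw [hc, Function.const_apply, Submodule.coe_inner, PiLp.inner_apply]
    have h3 : ∀ p : (Fin K → Fin 2) × (Fin 1 → Fin n × Fin 2),
        inner ℂ (c.1 p) ((f q).1 p) =
          if numOnes p.1 = numOnes a ∧ p.2 0 = A then (compL f a fun _ => A) q else 0 := by
      intro p
      change inner ℂ (if numOnes p.1 = numOnes a ∧ p.2 0 = A then (1 : ℂ) else 0)
        (comp f p.1 p.2 q) = _
      split_ifs with hp
      · have hA : p.2 = fun _ => A := funext fun i => by rw [Subsingleton.elim i 0, hp.2]
        rw [← hq, hA, compL_eq_of_numOnes f hp.1]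
        simp
      · simp
    refine (Finset.sum_congr rfl fun p _ => h3 p).trans ?_
    rw [← Finset.sum_filter, ← nsmul_eq_mul]
    exact Finset.sum_const _
  rw [integral_congr_ae h2, integral_const_mul] at h1
  have hne : (S.card : ℂ) ≠ 0 := by
    have : (a, fun _ => A) ∈ S := by simp [hS]
    exact_mod_cast (Finset.card_pos.2 ⟨_, this⟩).ne'
  rw [inner_emb_left]
  simpa [smOne_apply] using (mul_eq_zero.1 h1).resolve_left hne

theorem exists_section {k : ℕ} (w : ℕ → HL n) :
    ∃ u : L2 n k 0, ∀ a A, compL u a A = w (numOnes a) := by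
  let s : ℕ → V n k 0 := fun m => ⟨WithLp.toLp 2 fun p =>
    if numOnes p.1 = m then 1 else 0, fun σ b D => by
      change (if _ then _ else _) = if _ then _ else _
      rw [numOnes_comp], fun σ b D => by
      rw [Subsingleton.elim σ 1]
      simp⟩
  refine ⟨∑ m ∈ Finset.range (k + 1),
    (ContinuousLinearMap.toSpanSingleton ℂ (s m)).compLp (w m), fun a A => ?_⟩
  have h1 : ∀ m, (evalV n k 0 (a, A)).compLp
      ((ContinuousLinearMap.toSpanSingleton ℂ (s m)).compLp (w m)) =
      if numOnes a = m then w m else 0 := by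
    intro m
    refine Lp.ext ?_
    filter_upwards [(evalV n k 0 (a, A)).coeFn_compLp
      ((ContinuousLinearMap.toSpanSingleton ℂ (s m)).compLp (w m)),
      (ContinuousLinearMap.toSpanSingleton ℂ (s m)).coeFn_compLp (w m),
      Lp.coeFn_zero ℂ 2 (nilMeasure n)] with q hq1 hq2 _
    rw [hq1, hq2, ContinuousLinearMap.toSpanSingleton_apply, map_smul, evalV_apply]
    change _ • (if numOnes a = m then (1 : ℂ) else 0) = _
    split_ifs
    · simp
    · simp
  have h2 : ∀ x : L2 n k 0, compL x a A =
      (evalV n k 0 (a, A)).compLpL 2 (nilMeasure n) x := fun _ => rfl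
  rw [h2, map_sum]
  refine (Finset.sum_congr rfl fun m _ => h1 m).trans ?_
  rw [Finset.sum_ite_eq, if_pos]
  have := numOnes_lt a
  simp only [Finset.mem_range]
  omega

theorem exists_isD (hn : 2 ≤ n) {k : ℕ} (hk : 2 ≤ k) (f : L2 n k 1) (hclosed : IsD f 0)
    (hperp : PerpConst f) : ∃ u : L2 n k 0, IsD u f := by
  -- With `k = K + 2`, the section `f` has `K + 1` primed indices, so `K + 2` possible numbers of
  -- ones, and `u` has `K + 3`.
  obtain ⟨K, rfl⟩ := Nat.exists_eq_add_of_le' hk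
  have hcons : ∀ (A' : Fin 2) (m : Fin (K + 1)) (A : Fin n × Fin 2),
      compL f (consIdx (k := K + 1) (j := 0) A' (onesIdx K m)) (fun _ => A) =
        compL f (onesIdx (K + 1) (A' + m)) fun _ => A := fun A' m A =>
    compL_eq_of_numOnes f (by
      have h1 := numOnes_consIdx A' (onesIdx K m)
      rw [numOnes_onesIdx (by omega)] at h1
      exact h1.trans (numOnes_onesIdx (by omega)).symm) _
  obtain ⟨u, hu⟩ := exists_weak_solution hn (K := K + 1) (by omega)
    (fun m A => compL f (onesIdx (K + 1) m) fun _ => A)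
    (fun m A => mean_zero_of_perpConst hperp _ A)
    (fun m A B φ => by
      have h1 := closed_of_isD hclosed (onesIdx K m) A B φ
      simp only [hcons, Fin.sum_univ_two, Fin.val_zero, Fin.val_one, zero_add,
        add_comm 1] at h1
      exact h1)
  obtain ⟨v, hv⟩ := exists_section (k := K + 2)
    fun m => if h : m < K + 3 then u ⟨m, h⟩ else 0
  refine ⟨v, (isD_zero_iff v f).2 fun a A φ => ?_⟩
  have h1 := hu ⟨numOnes a, numOnes_lt a⟩ A φ
  have h2 : compL f a (fun _ => A) = compL f (onesIdx (K + 1) (numOnes a)) fun _ => A :=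
    compL_eq_of_numOnes f (numOnes_onesIdx (Nat.lt_succ_iff.1 (numOnes_lt a))).symm _
  have h3 : ∀ A' : Fin 2, compL v (consIdx (k := K + 2) (j := 0) A' a) Fin.elim0 =
      u ⟨A' + numOnes a, by have := numOnes_lt a; omega⟩ := fun A' => by
    rw [hv]
    have h4 : numOnes (consIdx (k := K + 2) (j := 0) A' a) = A' + numOnes a :=
      numOnes_consIdx A' a
    have h5 := numOnes_lt a
    rw [dif_pos (by omega)]
    congr 1
    exact Fin.ext h4
  have e0 : compL v (consIdx (k := K + 2) (j := 0) 0 a) Fin.elim0 =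
      u (Fin.castSucc ⟨numOnes a, numOnes_lt a⟩) :=
    (h3 0).trans (congrArg u (Fin.ext (zero_add _)))
  have e1 : compL v (consIdx (k := K + 2) (j := 0) 1 a) Fin.elim0 =
      u (Fin.succ ⟨numOnes a, numOnes_lt a⟩) :=
    (h3 1).trans (congrArg u (Fin.ext (add_comm 1 _)))
  rw [h2, Fin.sum_univ_two, e0, e1]
  exact h1

theorem finrank_heis : Module.finrank ℝ (Heis n) = 4 * n + 3 := by
  have : Module.finrank ℝ ((Fin n × Fin 4 → ℝ) × (Fin 3 → ℝ)) = 4 * n + 3 := by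
    simp [mul_comm]
  exact this

end QHeis

end

theorem mainTheorem3 (n k : ℕ) (hdim : 19 ≤ Module.finrank ℝ (QHeis.Heis n)) (hk : 2 ≤ k)
    (f : QHeis.L2 n k 1) (hdom : f ∈ QHeis.domD n k 1) (hclosed : QHeis.IsD f 0)
    (hperp : QHeis.PerpConst f) :
    ∃ u : QHeis.L2 n k 0, u ∈ QHeis.domD n k 0 ∧ QHeis.IsD u f := by
  rw [QHeis.finrank_heis] at hdim
  -- `4n + 3 ≥ 19` gives `n ≥ 4`, more than the required `n ≥ 2`.
  obtain ⟨u, hu⟩ := QHeis.exists_isD (by omega) hk f hclosed hperp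
  exact ⟨u, ⟨f, hu⟩, hu⟩
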